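/- Let $p\ge 1$ be a fixed integer, $\theta_1\in\mathbb R^p$ a unit vector, $v>0$ and $(r_n)_{n\ge1}$ a bounded sequence of positive real numbers. For each $n\ge 1$, let $X_{n1},\dots,X_{nn}$ be independent random vectors with distribution $\mathcal N_p(0,\Sigma_n)$, where $\Sigma_n=I_p+r_nv\,\theta_1\theta_1'$. Let $\bar X_n=\frac1n\sum_{i=1}^nX_{ni}$ and $S_n=\frac1n\sum_{i=1}^n(X_{ni}-\bar X_n)(X_{ni}-\bar X_n)'$, and let $\hat\lambda_{n1}\ge\dots\ge\hat\lambda_{np}$ be the eigenvalues of $S_n$. Write $\mathrm{vec}(A)$ for the vector obtained by stacking the columns of $A$, $K_p$ for the commutation matrix ($K_p\,\mathrm{vec}(A)=\mathrm{vec}(A')$ for every $p\times p$ matrix $A$), and, for $u\ge0$, $\Lambda(u)=\mathrm{diag}(1+u,1,\dots,1)$. Let $Z(u)$ be a $p\times p$ random matrix with $$\mathrm{vec}(Z(u))\sim\mathcal N\big(0,(I_{p^2}+K_p)(\Lambda(u)\otimes\Lambda(u))\big),$$ and let $Z_{22}(u)$ be the matrix obtained from $Z(u)$ by deleting its first row and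 first column. Write $Z=Z(0)$ and $Z_{22}=Z_{22}(0)$. (These matrices are symmetric almost surely.) Then, as $n\to\infty$, the random vector $$\ell_n=\big(\sqrt n(\hat\lambda_{n1}-(1+r_nv)),\ \sqrt n(\hat\lambda_{n2}-1),\ \dots,\ \sqrt n(\hat\lambda_{np}-1)\big)'$$ converges weakly to a random vector $\ell=(\ell_1,\dots,\ell_p)'$, where $\ell$ is as follows. - (i) If $r_n=1$ for all $n$, then $\ell_1$ and $(\ell_2,\dots,\ell_p)'$ are independent, $\ell_1$ is normal with mean $0$ and variance $2(1+v)^2$, and $\ell_2\ge\dots\ge\ell_p$ are the eigenvalues of $Z_{22}(v)$. - (ii) If $r_n\to0$ and $\sqrt n\,r_n\to\infty$, then $\ell_1$ and $(\ell_2,\dots,\ell_p)'$ are independent, $\ell_1$ is normal with mean $0$ and variance $2$, and $\ell_2\ge\dots\ge\ell_p$ are the eigenvalues of $Z_{22}$. - (iii) If $r_n=1/\sqrt n$ for all $n$, then $\ell_1$ is the largest eigenvalue of $Z-\mathrm{diag}(0,v,\dots,v)$ and $\ell_2\ge\dots\ge\ell_p$ are the $p-1$ smallest eigenvalues of $Z+\mathrm{diag}(v,0,\dots,0)$,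 both computed from the same random matrix $Z$. - (iv) If $r_n=o(1/\sqrt n)$, then $\ell$ is the vector of the eigenvalues of $Z$ in decreasing order; hence it has the density $$(\ell_1,\dots,\ell_p)'\mapsto b_p\,\exp\Big(-\frac14\sum_{j=1}^p\ell_j^2\Big)\Big(\prod_{1\le k<j\le p}(\ell_k-\ell_j)\Big)\,\mathbb I[\ell_1\ge\dots\ge\ell_p]$$ with respect to Lebesgue measure on $\mathbb R^p$, where $b_p>0$ is the normalizing constant. -/

import Mathlib

open MeasureTheory ProbabilityTheory Filter Topology Matrix
open scoped Kronecker

namespace SpikedPCA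

/-- The spiked covariance matrix `I + ρ θ θ'`. -/
def spikedCov {p : ℕ} (θ : EuclideanSpace ℝ (Fin p)) (ρ : ℝ) : Matrix (Fin p) (Fin p) ℝ :=
  1 + ρ • vecMulVec θ.ofLp θ.ofLp

/-- The sample average `(1/n) ∑ xᵢ`. -/
noncomputable def sampleMean {p n : ℕ} (x : Fin n → EuclideanSpace ℝ (Fin p)) :
    EuclideanSpace ℝ (Fin p) :=
  (1 / (n : ℝ)) • ∑ i, x i

/-- The sample covariance matrix `(1/n) ∑ (xᵢ - x̄)(xᵢ - x̄)'`. -/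
noncomputable def sampleCov {p n : ℕ} (x : Fin n → EuclideanSpace ℝ (Fin p)) :
    Matrix (Fin p) (Fin p) ℝ :=
  (1 / (n : ℝ)) • ∑ i, vecMulVec (x i - sampleMean x).ofLp (x i - sampleMean x).ofLp

open Classical in
/-- The eigenvalues of a real symmetric matrix, repeated according to multiplicity and listed in
decreasing order, so that index `0` carries the largest one. (The value `0` is assigned to
matrices that are not symmetric; the matrices used below are symmetric, at least almost surely.) -/
noncomputable def orderedEigenvalues {p : ℕ} (A : Matrix (Fin p) (Fin p) ℝ) : Fin p → ℝ :=
  if hA : A.IsHermitian then fun j => hA.eigenvalues₀ (Fin.cast (Fintype.card_fin p).symm j)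
  else 0

/-- The vector `(√n (λ̂₁ - (1 + ρ)), √n (λ̂₂ - 1), …, √n (λ̂ₚ - 1))`, `p = m + 1`, of normalized
sample eigenvalues. -/
noncomputable def normalizedEigenvalues {m n : ℕ} (ρ : ℝ)
    (x : Fin n → EuclideanSpace ℝ (Fin (m + 1))) : Fin (m + 1) → ℝ :=
  Fin.cons (√(n : ℝ) * (orderedEigenvalues (sampleCov x) 0 - (1 + ρ)))
    (fun j : Fin m => √(n : ℝ) * (orderedEigenvalues (sampleCov x) j.succ - 1))

/-- The commutation matrix `K_p`. -/
def commutationMatrix (p : ℕ) : Matrix (Fin p × Fin p) (Fin p × Fin p) ℝ :=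
  Matrix.of fun a b => if b = a.swap then 1 else 0

/-- The defining property of the commutation matrix: `K vec(A) = vec(A')`. -/
theorem commutationMatrix_mulVec_vec (p : ℕ) (A : Matrix (Fin p) (Fin p) ℝ) :
    commutationMatrix p *ᵥ A.vec = Aᵀ.vec := by
  ext ⟨i, j⟩
  simp [commutationMatrix, mulVec, dotProduct, Matrix.vec]

/-- `Λ(u) = diag(1 + u, 1, …, 1)`. -/
def spikeDiag (m : ℕ) (u : ℝ) : Matrix (Fin (m + 1)) (Fin (m + 1)) ℝ :=
  diagonal (Fin.cons (1 + u) fun _ => 1)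

/-- The matrix `(I + K_p) (Λ(u) ⊗ Λ(u))`. -/
def limitCov (m : ℕ) (u : ℝ) :
    Matrix (Fin (m + 1) × Fin (m + 1)) (Fin (m + 1) × Fin (m + 1)) ℝ :=
  (1 + commutationMatrix (m + 1)) * (spikeDiag m u ⊗ₖ spikeDiag m u)

/-- The random matrix `Z` satisfies `vec(Z) ∼ N(0, (I + K_p) (Λ(u) ⊗ Λ(u)))`. -/
def HasLimitLaw {m : ℕ} {Ω : Type*} [MeasurableSpace Ω] (u : ℝ)
    (Z : Ω → Matrix (Fin (m + 1)) (Fin (m + 1)) ℝ) (Q : Measure Ω) : Prop :=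
  HasLaw (fun ω => WithLp.toLp 2 (Z ω).vec) (multivariateGaussian 0 (limitCov m u)) Q

/-- The matrix obtained by deleting the first row and the first column. -/
def lowerBlock {m : ℕ} (A : Matrix (Fin (m + 1)) (Fin (m + 1)) ℝ) : Matrix (Fin m) (Fin m) ℝ :=
  A.submatrix Fin.succ Fin.succ

open Classical in
/-- `exp(-(1/4) ∑ xⱼ²) ∏_{k < j} (x_k - x_j) 𝟙[x₁ ≥ ⋯ ≥ xₚ]`. -/
noncomputable def unnormalizedDensity {p : ℕ} (x : Fin p → ℝ) : ℝ :=
  if Antitone x then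
    Real.exp (-(1 / 4) * ∑ j, x j ^ 2) * ∏ k, ∏ j ∈ Finset.Ioi k, (x k - x j)
  else 0

/-- The normalizing constant `b_p`. -/
noncomputable def normalizingConstant (p : ℕ) : ℝ :=
  (∫ x : Fin p → ℝ, unnormalizedDensity x)⁻¹

end SpikedPCA

namespace SpikedPCA

/-! ### Ordered eigenvalues: comparison, uniqueness and continuity. -/

section Eigenvalues

variable {p : ℕ}

/-! Write `ρ = r n * v` and let `D = spikeRoot m ρ`, the diagonal square root of `diag(1 + ρ, 1, …,
1)`. If `R` is orthogonal with first column `θ`, the sample has the law of `R D Y` with `Y` standard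
Gaussian. The eigenvalues of its covariance are those of `D S D'`, where `S` is the sample
covariance of `Y`, and `√n (D S D' - 1) = corner (√n ρ) 0 + D W D'` with `W = √n (S - 1)`. Hence the
normalized eigenvalues are a deterministic function `eigenvalueMap` of `W`
(`normalizedEigenvalues_mulVec`), and all randomness sits in `W`, whose law does not involve the
spike.

The central limit theorem gives `vec W → N(0, 1 + K)` (`tendstoInDistribution_centeredCov`). The
covariance comes from diagonalizing quadratic forms of a standard Gaussian vector, and the mean
correction is negligible. The functions `eigenvalueMap` depend on `n`, so the extended continuous
mapping theorem is used: it suffices that they converge along every convergent sequence of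
arguments. If `√n ρ → ∞`, the spike decouples the corner entry from the lower block
(`tendsto_orderedEigenvalues_corner_add`). If `√n ρ → a`, then `D → 1` and continuity of the
spectrum leaves the eigenvalues of `corner a 0 + Z`. Independence in the first two regimes holds
because the corner entry and the lower block are jointly Gaussian and uncorrelated.

For the density, symmetric matrices are parametrized by eigenvalues and a skew matrix, through `C
diag(α) C'` with `C` a Cayley transform. The Jacobian is the product of the eigenvalue gaps times a
function of the skew matrix alone (`exists_measurable_abs_det_fderiv`), while the Gaussian weight
depends on `α` alone. On a domain that removes the sign ambiguity of the eigenvectors the map is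
injective, and integrating out the skew matrix leaves the stated density up to a constant, which
total mass one identifies. -/

theorem dotProduct_conj_diagonal_mulVec (U : Matrix (Fin p) (Fin p) ℝ) (α x : Fin p → ℝ) :
    x ⬝ᵥ ((U * diagonal α * Uᵀ) *ᵥ x) = ∑ i, α i * (Uᵀ *ᵥ x) i ^ 2 := by
  rw [← mulVec_mulVec, ← mulVec_mulVec, dotProduct_mulVec, ← mulVec_transpose, dotProduct]
  refine Finset.sum_congr rfl fun i _ => ?_
  rw [mulVec_diagonal]
  ring

theorem sum_sq_transpose_mulVec {U : Matrix (Fin p) (Fin p) ℝ} (hU : Uᵀ * U = 1)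
    (x : Fin p → ℝ) : ∑ i, (Uᵀ *ᵥ x) i ^ 2 = ∑ i, x i ^ 2 := by
  have h := dotProduct_conj_diagonal_mulVec U (fun _ => 1) x
  rw [diagonal_one, mul_one, mul_eq_one_comm.mp hU, one_mulVec] at h
  simp only [one_mul] at h
  rw [← h, dotProduct]
  exact Finset.sum_congr rfl fun i _ => (pow_two (x i)).symm

/-- The comparison half of the Courant–Fischer principle. -/
theorem antitone_le_of_quadForm_le {U V : Matrix (Fin p) (Fin p) ℝ} (hU : Uᵀ * U = 1)
    (hV : Vᵀ * V = 1) {α β : Fin p → ℝ} (hα : Antitone α) (hβ : Antitone β)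
    (h : ∀ x : Fin p → ℝ, x ⬝ᵥ ((U * diagonal α * Uᵀ) *ᵥ x) ≤
      x ⬝ᵥ ((V * diagonal β * Vᵀ) *ᵥ x)) : α ≤ β := by
  intro k
  -- The dimension count as a determinant. Rows after `k` ask that `c` vanish there, rows before `k`
  -- ask the same of `Vᵀ U c`, and row `k` is zero. So `M` is singular and a nonzero `c` meets all
  -- these conditions.
  let M : Matrix (Fin p) (Fin p) ℝ := Matrix.of fun i j =>
    if i = k then 0 else if k < i then (1 : Matrix (Fin p) (Fin p) ℝ) i j else (Vᵀ * U) i j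
  have hdet : M.det = 0 := det_eq_zero_of_row_eq_zero k fun j => by simp [M]
  obtain ⟨c, hc0, hc⟩ := exists_mulVec_eq_zero_iff.mpr hdet
  have h1 : ∀ i, k < i → c i = 0 := by
    intro i hi
    have := congrFun hc i
    have hM : M i = (1 : Matrix (Fin p) (Fin p) ℝ) i := by
      ext j; simp [M, hi, hi.ne']
    rw [mulVec, hM] at this
    rw [← one_mulVec c]
    exact this
  have h2 : ∀ i, i < k → ((Vᵀ * U) *ᵥ c) i = 0 := by
    intro i hi
    have := congrFun hc i
    have hM : M i = (Vᵀ * U) i := by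
      ext j; simp [M, hi.ne, hi.le]
    rw [mulVec, hM] at this
    exact this
  have hx := h (U *ᵥ c)
  rw [dotProduct_conj_diagonal_mulVec, dotProduct_conj_diagonal_mulVec, mulVec_mulVec,
    mulVec_mulVec, hU, one_mulVec] at hx
  have hs : ∑ i, ((Vᵀ * U) *ᵥ c) i ^ 2 = ∑ i, c i ^ 2 := by
    rw [← mulVec_mulVec, sum_sq_transpose_mulVec hV]
    have := sum_sq_transpose_mulVec (U := Uᵀ) (by simpa using mul_eq_one_comm.mp hU) c
    simpa using this
  have hlow : α k * ∑ i, c i ^ 2 ≤ ∑ i, α i * c i ^ 2 := by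
    rw [Finset.mul_sum]
    refine Finset.sum_le_sum fun i _ => ?_
    rcases lt_or_ge k i with hi | hi
    · simp [h1 i hi]
    · exact mul_le_mul_of_nonneg_right (hα hi) (sq_nonneg _)
  have hup : ∑ i, β i * ((Vᵀ * U) *ᵥ c) i ^ 2 ≤ β k * ∑ i, ((Vᵀ * U) *ᵥ c) i ^ 2 := by
    rw [Finset.mul_sum]
    refine Finset.sum_le_sum fun i _ => ?_
    rcases lt_or_ge i k with hi | hi
    · simp [h2 i hi]
    · exact mul_le_mul_of_nonneg_right (hβ hi) (sq_nonneg _)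
  rw [hs] at hup
  have hpos : 0 < ∑ i, c i ^ 2 := by
    obtain ⟨i, hi⟩ := Function.ne_iff.mp hc0
    exact Finset.sum_pos' (fun i _ => sq_nonneg _) ⟨i, Finset.mem_univ _, by
      have : c i ≠ 0 := hi
      positivity⟩
  exact le_of_mul_le_mul_right (hlow.trans (hx.trans hup)) hpos

theorem orderedEigenvalues_antitone (A : Matrix (Fin p) (Fin p) ℝ) :
    Antitone (orderedEigenvalues A) := by
  unfold orderedEigenvalues
  split_ifs with hA
  · intro i j hij
    exact hA.eigenvalues₀_antitone (by simpa using hij)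
  · exact antitone_const

theorem exists_diagonalization {A : Matrix (Fin p) (Fin p) ℝ} (hA : A.IsHermitian) :
    ∃ U : Matrix (Fin p) (Fin p) ℝ, Uᵀ * U = 1 ∧
      A = U * diagonal (orderedEigenvalues A) * Uᵀ := by
  classical
  -- `eigenvalues` reads the sorted list `eigenvalues₀` through an arbitrary enumeration of the
  -- index type; `e` undoes it, and the eigenvector columns are permuted to match.
  let e : Fin p ≃ Fin p := (finCongr (Fintype.card_fin p).symm).trans
    (Fintype.equivOfCardEq (Fintype.card_fin _))
  let W : Matrix (Fin p) (Fin p) ℝ := hA.eigenvectorUnitary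
  have hW : Wᵀ * W = 1 := by
    simpa [star_eq_conjTranspose] using Unitary.coe_star_mul_self hA.eigenvectorUnitary
  have hd : A = W * diagonal hA.eigenvalues * Wᵀ := by
    have := hA.spectral_theorem
    rw [Unitary.conjStarAlgAut_apply] at this
    simpa [star_eq_conjTranspose] using this
  have he : orderedEigenvalues A = hA.eigenvalues ∘ e := by
    ext j
    rw [orderedEigenvalues, dif_pos hA]
    simp [Matrix.IsHermitian.eigenvalues, e]
  refine ⟨W.submatrix id e, ?_, ?_⟩
  · ext i j
    have := congrFun (congrFun hW (e i)) (e j)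
    simpa [mul_apply, one_apply] using this
  · have h2 : diagonal (orderedEigenvalues A) = (diagonal hA.eigenvalues).submatrix e e := by
      rw [he, submatrix_diagonal_equiv]
    rw [h2, submatrix_mul_equiv, transpose_submatrix, submatrix_mul_equiv, ← hd, submatrix_id_id]

theorem isHermitian_conj_diagonal (U : Matrix (Fin p) (Fin p) ℝ) (α : Fin p → ℝ) :
    (U * diagonal α * Uᵀ).IsHermitian := by
  simp [IsHermitian, mul_assoc, transpose_mul]

/-- Two orthogonal diagonalizations of one matrix have equal quadratic forms, so the comparison
principle applies in both directions. This is the tool for computing every spectrum below. -/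
theorem orderedEigenvalues_conj_diagonal {U : Matrix (Fin p) (Fin p) ℝ} (hU : Uᵀ * U = 1)
    {α : Fin p → ℝ} (hα : Antitone α) : orderedEigenvalues (U * diagonal α * Uᵀ) = α := by
  obtain ⟨V, hV, h⟩ := exists_diagonalization (isHermitian_conj_diagonal U α)
  refine le_antisymm ?_ ?_
  · exact antitone_le_of_quadForm_le hV hU (orderedEigenvalues_antitone _) hα
      fun x => by rw [← h]
  · exact antitone_le_of_quadForm_le hU hV hα (orderedEigenvalues_antitone _)
      fun x => by rw [← h]

theorem orderedEigenvalues_mono {A B : Matrix (Fin p) (Fin p) ℝ} (hA : A.IsHermitian)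
    (hB : B.IsHermitian) (h : ∀ x : Fin p → ℝ, x ⬝ᵥ (A *ᵥ x) ≤ x ⬝ᵥ (B *ᵥ x)) :
    orderedEigenvalues A ≤ orderedEigenvalues B := by
  obtain ⟨U, hU, hA'⟩ := exists_diagonalization hA
  obtain ⟨V, hV, hB'⟩ := exists_diagonalization hB
  refine antitone_le_of_quadForm_le hU hV (orderedEigenvalues_antitone _)
    (orderedEigenvalues_antitone _) fun x => ?_
  rw [← hA', ← hB']
  exact h x

theorem orderedEigenvalues_smul_add {A : Matrix (Fin p) (Fin p) ℝ} (hA : A.IsHermitian)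
    {a : ℝ} (ha : 0 ≤ a) (c : ℝ) :
    orderedEigenvalues (a • A + c • 1) = fun j => a * orderedEigenvalues A j + c := by
  obtain ⟨U, hU, hA'⟩ := exists_diagonalization hA
  have h : a • A + c • 1 = U * diagonal (fun j => a * orderedEigenvalues A j + c) * Uᵀ := by
    have : diagonal (fun j => a * orderedEigenvalues A j + c) =
        a • diagonal (orderedEigenvalues A) + c • (1 : Matrix (Fin p) (Fin p) ℝ) := by
      ext i j
      by_cases hij : i = j <;> simp [hij]
    rw [this, mul_add, add_mul, Matrix.mul_smul, Matrix.smul_mul, ← hA', Matrix.mul_smul, mul_one,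
      Matrix.smul_mul, mul_eq_one_comm.mp hU]
  rw [h]
  refine orderedEigenvalues_conj_diagonal hU fun i j hij => ?_
  have := orderedEigenvalues_antitone A hij
  gcongr

theorem orderedEigenvalues_conj {A U : Matrix (Fin p) (Fin p) ℝ} (hA : A.IsHermitian)
    (hU : Uᵀ * U = 1) : orderedEigenvalues (U * A * Uᵀ) = orderedEigenvalues A := by
  obtain ⟨V, hV, hA'⟩ := exists_diagonalization hA
  have h : U * A * Uᵀ = (U * V) * diagonal (orderedEigenvalues A) * (U * V)ᵀ := by
    conv_lhs => rw [hA']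
    simp only [transpose_mul, mul_assoc]
  rw [h]
  refine orderedEigenvalues_conj_diagonal ?_ (orderedEigenvalues_antitone A)
  rw [transpose_mul, mul_assoc, ← mul_assoc Uᵀ, hU, one_mul, hV]

theorem abs_quadForm_le (M : Matrix (Fin p) (Fin p) ℝ) (x : Fin p → ℝ) :
    |x ⬝ᵥ (M *ᵥ x)| ≤ (∑ i, ∑ j, |M i j|) * (x ⬝ᵥ x) := by
  have hx : ∀ i, x i ^ 2 ≤ x ⬝ᵥ x := fun i => by
    rw [dotProduct]
    simp only [← pow_two]
    exact Finset.single_le_sum (f := fun i => x i ^ 2) (fun _ _ => sq_nonneg _)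
      (Finset.mem_univ i)
  have hij : ∀ i j, |x i * x j| ≤ x ⬝ᵥ x := fun i j => by
    have := hx i
    have := hx j
    rw [abs_le]
    constructor <;> nlinarith [sq_nonneg (x i - x j), sq_nonneg (x i + x j)]
  have he : x ⬝ᵥ (M *ᵥ x) = ∑ i, ∑ j, M i j * (x i * x j) := by
    simp only [dotProduct, mulVec, Finset.mul_sum]
    exact Finset.sum_congr rfl fun i _ => Finset.sum_congr rfl fun j _ => by ring
  rw [he, Finset.sum_mul]
  refine (Finset.abs_sum_le_sum_abs _ _).trans (Finset.sum_le_sum fun i _ => ?_)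
  rw [Finset.sum_mul]
  refine (Finset.abs_sum_le_sum_abs _ _).trans (Finset.sum_le_sum fun j _ => ?_)
  rw [abs_mul]
  exact mul_le_mul_of_nonneg_left (hij i j) (abs_nonneg _)

/-- A crude Weyl inequality: as quadratic forms `A ≤ B + s`, where `s` is the sum of the absolute
entries of `A - B`. -/
theorem orderedEigenvalues_le_add {A B : Matrix (Fin p) (Fin p) ℝ} (hA : A.IsHermitian)
    (hB : B.IsHermitian) (j : Fin p) :
    orderedEigenvalues A j ≤ orderedEigenvalues B j + ∑ i, ∑ j, |A i j - B i j| := by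
  set s := ∑ i, ∑ j, |A i j - B i j|
  have h := orderedEigenvalues_smul_add hB zero_le_one s
  have hB' : ((1 : ℝ) • B + s • (1 : Matrix (Fin p) (Fin p) ℝ)).IsHermitian := by
    have : Bᵀ = B := by simpa using hB.eq
    simp [IsHermitian, this]
  have hle := orderedEigenvalues_mono hA hB' fun x => ?_
  · have := hle j
    rw [h] at this
    simpa using this
  · have h1 := abs_quadForm_le (A - B) x
    rw [sub_mulVec, dotProduct_sub] at h1
    have h2 := (le_abs_self _).trans h1
    rw [add_mulVec, dotProduct_add, one_smul, smul_mulVec, one_mulVec, dotProduct_smul, smul_eq_mul]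
    simp only [Matrix.sub_apply] at h2
    linarith

theorem tendsto_orderedEigenvalues {ι : Type*} {l : Filter ι}
    {A : ι → Matrix (Fin p) (Fin p) ℝ} {B : Matrix (Fin p) (Fin p) ℝ}
    (hA : ∀ n, (A n).IsHermitian) (hB : B.IsHermitian) (h : Tendsto A l (𝓝 B)) :
    Tendsto (fun n => orderedEigenvalues (A n)) l (𝓝 (orderedEigenvalues B)) := by
  have hs : Tendsto (fun n => ∑ i, ∑ j, |A n i j - B i j|) l (𝓝 0) := by
    have h0 : Tendsto (fun n => ∑ i, ∑ j, |A n i j - B i j|) l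
        (𝓝 (∑ i, ∑ j, |B i j - B i j|)) := by
      refine tendsto_finsetSum _ fun i _ => tendsto_finsetSum _ fun j _ => ?_
      exact ((tendsto_pi_nhds.mp (tendsto_pi_nhds.mp h i) j).sub_const _).abs
    simpa using h0
  refine tendsto_pi_nhds.mpr fun j => ?_
  rw [tendsto_iff_dist_tendsto_zero]
  refine squeeze_zero (fun _ => dist_nonneg) (fun n => ?_) hs
  rw [Real.dist_eq, abs_le]
  have h1 := orderedEigenvalues_le_add (hA n) hB j
  have h2 := orderedEigenvalues_le_add hB (hA n) j
  simp only [abs_sub_comm (B _ _)] at h2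
  constructor <;> linarith

end Eigenvalues

/-! ### Block diagonal matrices and perturbation by a large corner entry. -/

section Corner

variable {m : ℕ}

/-- The block diagonal matrix with blocks `a` and `B`. -/
def corner (a : ℝ) (B : Matrix (Fin m) (Fin m) ℝ) : Matrix (Fin (m + 1)) (Fin (m + 1)) ℝ :=
  Matrix.of (Fin.cons (Fin.cons a 0) fun i => Fin.cons 0 (B i))

@[simp] theorem corner_zero_zero (a : ℝ) (B : Matrix (Fin m) (Fin m) ℝ) : corner a B 0 0 = a := rfl

@[simp] theorem corner_zero_succ (a : ℝ) (B : Matrix (Fin m) (Fin m) ℝ) (j : Fin m) :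
    corner a B 0 j.succ = 0 := rfl

@[simp] theorem corner_succ_zero (a : ℝ) (B : Matrix (Fin m) (Fin m) ℝ) (i : Fin m) :
    corner a B i.succ 0 = 0 := rfl

@[simp] theorem corner_succ_succ (a : ℝ) (B : Matrix (Fin m) (Fin m) ℝ) (i j : Fin m) :
    corner a B i.succ j.succ = B i j := rfl

theorem corner_mul_corner (a b : ℝ) (A B : Matrix (Fin m) (Fin m) ℝ) :
    corner a A * corner b B = corner (a * b) (A * B) := by
  ext i j
  refine Fin.cases ?_ (fun i => ?_) i <;> refine Fin.cases ?_ (fun j => ?_) j <;>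
    simp [mul_apply, Fin.sum_univ_succ]

theorem corner_transpose (a : ℝ) (B : Matrix (Fin m) (Fin m) ℝ) :
    (corner a B)ᵀ = corner a Bᵀ := by
  ext i j
  refine Fin.cases ?_ (fun i => ?_) i <;> refine Fin.cases ?_ (fun j => ?_) j <;> simp

theorem corner_diagonal (a : ℝ) (β : Fin m → ℝ) :
    corner a (diagonal β) = diagonal (Fin.cons a β) := by
  ext i j
  refine Fin.cases ?_ (fun i => ?_) i <;> refine Fin.cases ?_ (fun j => ?_) j <;>
    simp [diagonal_apply, Fin.succ_ne_zero, (Fin.succ_ne_zero _).symm]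

theorem corner_one_one : corner 1 (1 : Matrix (Fin m) (Fin m) ℝ) = 1 := by
  rw [← diagonal_one, corner_diagonal, ← diagonal_one]
  congr 1
  ext i
  refine Fin.cases ?_ (fun i => ?_) i <;> simp

theorem corner_isHermitian (a : ℝ) {B : Matrix (Fin m) (Fin m) ℝ} (hB : B.IsHermitian) :
    (corner a B).IsHermitian := by
  have : Bᵀ = B := by simpa using hB.eq
  simp [IsHermitian, corner_transpose, this]

theorem orderedEigenvalues_corner {a : ℝ} {B : Matrix (Fin m) (Fin m) ℝ} (hB : B.IsHermitian)
    (h : ∀ j, orderedEigenvalues B j ≤ a) :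
    orderedEigenvalues (corner a B) = Fin.cons a (orderedEigenvalues B) := by
  obtain ⟨U, hU, hB'⟩ := exists_diagonalization hB
  have hc : corner a B = corner 1 U * diagonal (Fin.cons a (orderedEigenvalues B)) *
      (corner 1 U)ᵀ := by
    rw [← corner_diagonal, corner_transpose, corner_mul_corner, corner_mul_corner, ← hB']
    simp
  rw [hc]
  refine orderedEigenvalues_conj_diagonal ?_ ?_
  · rw [corner_transpose, corner_mul_corner, hU, one_mul, corner_one_one]
  · intro i j hij
    induction i using Fin.cases with
    | zero => induction j using Fin.cases with
      | zero => rfl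
      | succ j => simpa using h j
    | succ i => induction j using Fin.cases with
      | zero => simp at hij
      | succ j => simpa using orderedEigenvalues_antitone B (Fin.succ_le_succ_iff.mp hij)

theorem lowerBlock_isHermitian {A : Matrix (Fin (m + 1)) (Fin (m + 1)) ℝ} (hA : A.IsHermitian) :
    (lowerBlock A).IsHermitian := hA.submatrix _

theorem quadForm_corner (a : ℝ) (B : Matrix (Fin m) (Fin m) ℝ) (x : Fin (m + 1) → ℝ) :
    x ⬝ᵥ (corner a B *ᵥ x) = a * x 0 ^ 2 + Fin.tail x ⬝ᵥ (B *ᵥ Fin.tail x) := by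
  simp only [dotProduct, mulVec, Fin.sum_univ_succ, corner_zero_zero, corner_zero_succ,
    corner_succ_zero, corner_succ_succ, Fin.tail]
  simp
  ring

theorem quadForm_succ {A : Matrix (Fin (m + 1)) (Fin (m + 1)) ℝ} (hA : A.IsHermitian)
    (x : Fin (m + 1) → ℝ) :
    x ⬝ᵥ (A *ᵥ x) = A 0 0 * x 0 ^ 2 + 2 * x 0 * ∑ j : Fin m, A 0 j.succ * x j.succ +
      Fin.tail x ⬝ᵥ (lowerBlock A *ᵥ Fin.tail x) := by
  have h : ∀ j : Fin m, A j.succ 0 = A 0 j.succ := fun j => by simpa using hA.apply 0 j.succ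
  simp only [dotProduct, mulVec, Fin.sum_univ_succ, Fin.tail, lowerBlock, submatrix_apply, h,
    mul_add, Finset.sum_add_distrib]
  have : ∑ j : Fin m, x j.succ * (A 0 j.succ * x 0) = x 0 * ∑ j : Fin m, A 0 j.succ * x j.succ := by
    rw [Finset.mul_sum]
    exact Finset.sum_congr rfl fun j _ => by ring
  rw [this]
  ring

/-- Cauchy–Schwarz followed by a weighted arithmetic–geometric inequality. The weights are left
unequal so that either one can later be made small at the expense of the other. -/
theorem abs_cross_le {b y : Fin m → ℝ} {t δ δ' : ℝ} (hδ : 0 < δ)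
    (hb : ∑ j, b j ^ 2 ≤ δ * δ') :
    |2 * t * ∑ j, b j * y j| ≤ δ * t ^ 2 + δ' * (y ⬝ᵥ y) := by
  have hcs := Finset.sum_mul_sq_le_sq_mul_sq Finset.univ b y
  set s := ∑ j, b j * y j
  have hy : ∑ j, y j ^ 2 = y ⬝ᵥ y := by
    rw [dotProduct]
    exact Finset.sum_congr rfl fun j _ => pow_two (y j)
  rw [hy] at hcs
  have hy0 : 0 ≤ y ⬝ᵥ y := by
    rw [← hy]
    positivity
  have h1 : s ^ 2 ≤ δ * (δ' * (y ⬝ᵥ y)) := by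
    rw [← mul_assoc]
    exact hcs.trans (mul_le_mul_of_nonneg_right hb hy0)
  rw [abs_le]
  constructor
  · have h2 : 0 ≤ δ * (δ * t ^ 2 + δ' * (y ⬝ᵥ y) + 2 * t * s) := by
      nlinarith [sq_nonneg (δ * t + s)]
    have := nonneg_of_mul_nonneg_right h2 hδ
    linarith
  · have h2 : 0 ≤ δ * (δ * t ^ 2 + δ' * (y ⬝ᵥ y) - 2 * t * s) := by
      nlinarith [sq_nonneg (δ * t - s)]
    have := nonneg_of_mul_nonneg_right h2 hδ
    linarith

/-- Absorbing the cross terms sandwiches the matrix between two block diagonal ones, with corner `a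
+ B 0 0 ± δ` and lower block shifted by `±δ'`. Hypothesis `ha` keeps the corner on top of both
spectra. -/
theorem orderedEigenvalues_corner_add_bounds {B : Matrix (Fin (m + 1)) (Fin (m + 1)) ℝ}
    (hB : B.IsHermitian) {a δ δ' : ℝ} (hδ : 0 < δ) (hδ' : 0 < δ')
    (hb : ∑ j : Fin m, B 0 j.succ ^ 2 ≤ δ * δ')
    (ha : ∀ j, orderedEigenvalues (lowerBlock B) j + δ' ≤ a + B 0 0 - δ) :
    |orderedEigenvalues (corner a 0 + B) 0 - a - B 0 0| ≤ δ ∧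
      ∀ j : Fin m, |orderedEigenvalues (corner a 0 + B) j.succ -
        orderedEigenvalues (lowerBlock B) j| ≤ δ' := by
  have hL := lowerBlock_isHermitian hB
  have hN : (corner a (0 : Matrix (Fin m) (Fin m) ℝ) + B).IsHermitian :=
    (corner_isHermitian a (by simp [IsHermitian])).add hB
  have hH : ∀ c : ℝ, ((1 : ℝ) • lowerBlock B + c • (1 : Matrix (Fin m) (Fin m) ℝ)).IsHermitian := by
    intro c
    have : (lowerBlock B)ᵀ = lowerBlock B := by simpa using hL.eq
    simp [IsHermitian, this]
  have hq : ∀ x : Fin (m + 1) → ℝ, x ⬝ᵥ ((corner a 0 + B) *ᵥ x) =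
      (a + B 0 0) * x 0 ^ 2 + 2 * x 0 * ∑ j : Fin m, B 0 j.succ * Fin.tail x j +
      Fin.tail x ⬝ᵥ (lowerBlock B *ᵥ Fin.tail x) := by
    intro x
    rw [add_mulVec, dotProduct_add, quadForm_corner, quadForm_succ hB]
    simp [Fin.tail]
    ring
  have hc : ∀ (c d : ℝ) (x : Fin (m + 1) → ℝ),
      x ⬝ᵥ (corner c ((1 : ℝ) • lowerBlock B + d • (1 : Matrix (Fin m) (Fin m) ℝ)) *ᵥ x) =
      c * x 0 ^ 2 + Fin.tail x ⬝ᵥ (lowerBlock B *ᵥ Fin.tail x) +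
        d * (Fin.tail x ⬝ᵥ Fin.tail x) := by
    intro c d x
    rw [quadForm_corner, add_mulVec, dotProduct_add, one_smul, smul_mulVec, one_mulVec,
      dotProduct_smul, smul_eq_mul]
    ring
  have hup := orderedEigenvalues_mono hN (corner_isHermitian (a + B 0 0 + δ) (hH δ')) fun x => by
    rw [hq, hc]
    have := (abs_le.mp (abs_cross_le (y := Fin.tail x) (t := x 0) hδ hb)).2
    linarith
  have hlo := orderedEigenvalues_mono (corner_isHermitian (a + B 0 0 - δ) (hH (-δ'))) hN
    fun x => by
      rw [hq, hc]
      have := (abs_le.mp (abs_cross_le (y := Fin.tail x) (t := x 0) hδ hb)).1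
      linarith
  have e : ∀ c : ℝ, orderedEigenvalues
      ((1 : ℝ) • lowerBlock B + c • (1 : Matrix (Fin m) (Fin m) ℝ)) =
      fun j => 1 * orderedEigenvalues (lowerBlock B) j + c :=
    fun c => orderedEigenvalues_smul_add hL zero_le_one c
  rw [orderedEigenvalues_corner (hH _) (fun j => by
    rw [e]; have := ha j; dsimp only; linarith), e] at hup
  rw [orderedEigenvalues_corner (hH _) (fun j => by
    rw [e]; have := ha j; dsimp only; linarith), e] at hlo
  refine ⟨?_, fun j => ?_⟩
  · have h1 := hup 0
    have h2 := hlo 0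
    simp only [Fin.cons_zero] at h1 h2
    rw [abs_le]
    constructor <;> linarith
  · have h1 := hup j.succ
    have h2 := hlo j.succ
    simp only [Fin.cons_succ] at h1 h2
    rw [abs_le]
    constructor <;> linarith

/-- The eigenvalues of a symmetric matrix to which a diverging spike is added. -/
theorem tendsto_orderedEigenvalues_corner_add {ι : Type*} {l : Filter ι} {a : ι → ℝ}
    (ha : Tendsto a l atTop) {B : ι → Matrix (Fin (m + 1)) (Fin (m + 1)) ℝ}
    (hB : ∀ n, (B n).IsHermitian) {C : Matrix (Fin (m + 1)) (Fin (m + 1)) ℝ}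
    (hC : C.IsHermitian) (h : Tendsto B l (𝓝 C)) :
    Tendsto (fun n => orderedEigenvalues (corner (a n) 0 + B n) 0 - a n) l (𝓝 (C 0 0)) ∧
      ∀ j : Fin m, Tendsto (fun n => orderedEigenvalues (corner (a n) 0 + B n) j.succ) l
        (𝓝 (orderedEigenvalues (lowerBlock C) j)) := by
  have hent : ∀ i j, Tendsto (fun n => B n i j) l (𝓝 (C i j)) := fun i j =>
    tendsto_pi_nhds.mp (tendsto_pi_nhds.mp h i) j
  have hlow : Tendsto (fun n => orderedEigenvalues (lowerBlock (B n))) l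
      (𝓝 (orderedEigenvalues (lowerBlock C))) := by
    refine tendsto_orderedEigenvalues (fun n => lowerBlock_isHermitian (hB n))
      (lowerBlock_isHermitian hC) ?_
    exact tendsto_pi_nhds.mpr fun i => tendsto_pi_nhds.mpr fun j => hent _ _
  have hsq : ∀ᶠ n in l, ∑ j : Fin m, B n 0 j.succ ^ 2 ≤ (∑ j : Fin m, C 0 j.succ ^ 2) + 1 := by
    have : Tendsto (fun n => ∑ j : Fin m, B n 0 j.succ ^ 2) l (𝓝 (∑ j : Fin m, C 0 j.succ ^ 2)) :=
      tendsto_finsetSum _ fun j _ => (hent _ _).pow 2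
    exact (this.eventually_lt_const (lt_add_one _)).mono fun n hn => hn.le
  set K := (∑ j : Fin m, C 0 j.succ ^ 2) + 1 with hK
  have hKpos : 0 < K := by positivity
  have key : ∀ δ δ' : ℝ, 0 < δ → 0 < δ' → K ≤ δ * δ' → ∀ᶠ n in l,
      |orderedEigenvalues (corner (a n) 0 + B n) 0 - a n - B n 0 0| ≤ δ ∧
      ∀ j : Fin m, |orderedEigenvalues (corner (a n) 0 + B n) j.succ -
        orderedEigenvalues (lowerBlock (B n)) j| ≤ δ' := by
    intro δ δ' hδ hδ' hK'
    have hall : ∀ᶠ n in l, ∀ j : Fin m,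
        orderedEigenvalues (lowerBlock (B n)) j + δ' ≤ a n + B n 0 0 - δ := by
      refine eventually_all.mpr fun j => ?_
      have h1 : ∀ᶠ n in l, orderedEigenvalues (lowerBlock (B n)) j ≤
          orderedEigenvalues (lowerBlock C) j + 1 :=
        ((tendsto_pi_nhds.mp hlow j).eventually_lt_const (lt_add_one _)).mono fun n hn => hn.le
      have h2 : ∀ᶠ n in l, C 0 0 - 1 ≤ B n 0 0 :=
        ((hent 0 0).eventually_const_lt (sub_one_lt _)).mono fun n hn => hn.le
      filter_upwards [h1, h2, ha.eventually_ge_atTop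
        (orderedEigenvalues (lowerBlock C) j + 1 + δ' + δ - C 0 0 + 1)] with n h1 h2 h3
      linarith
    filter_upwards [hsq, hall] with n hn hn'
    exact orderedEigenvalues_corner_add_bounds (hB n) hδ hδ' (hn.trans hK') hn'
  constructor
  · have : Tendsto (fun n => orderedEigenvalues (corner (a n) 0 + B n) 0 - a n - B n 0 0) l
        (𝓝 0) := by
      rw [Metric.tendsto_nhds]
      intro ε hε
      -- A precise corner costs a large but fixed error on the block, harmless because `a n`
      -- diverges; for the lower eigenvalues the two weights exchange roles.
      filter_upwards [key (ε / 2) (K / (ε / 2)) (by positivity) (by positivity)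
        (by rw [mul_div_cancel₀ _ (by positivity)])] with n hn
      rw [Real.dist_eq, sub_zero]
      exact hn.1.trans_lt (by linarith)
    simpa using this.add (hent 0 0)
  · intro j
    have : Tendsto (fun n => orderedEigenvalues (corner (a n) 0 + B n) j.succ -
        orderedEigenvalues (lowerBlock (B n)) j) l (𝓝 0) := by
      rw [Metric.tendsto_nhds]
      intro ε hε
      filter_upwards [key (K / (ε / 2)) (ε / 2) (by positivity) (by positivity)
        (by rw [div_mul_cancel₀ _ (by positivity)])] with n hn
      rw [Real.dist_eq, sub_zero]
      exact (hn.2 j).trans_lt (by linarith)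
    simpa using this.add (tendsto_pi_nhds.mp hlow j)

end Corner

/-! ### Convergence in distribution: change of space and varying maps. -/

section Convergence

/-- Convergence in distribution only depends on the laws. -/
theorem TendstoInDistribution.of_map_eq {ι E Ω₁' Ω₂' : Type*} {Ω₁ Ω₂ : ι → Type*}
    {mΩ₁ : ∀ i, MeasurableSpace (Ω₁ i)} {mΩ₂ : ∀ i, MeasurableSpace (Ω₂ i)}
    {mΩ₁' : MeasurableSpace Ω₁'} {mΩ₂' : MeasurableSpace Ω₂'}
    {μ₁ : ∀ i, Measure (Ω₁ i)} [∀ i, IsProbabilityMeasure (μ₁ i)]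
    {μ₂ : ∀ i, Measure (Ω₂ i)} [∀ i, IsProbabilityMeasure (μ₂ i)]
    {μ₁' : Measure Ω₁'} [IsProbabilityMeasure μ₁'] {μ₂' : Measure Ω₂'} [IsProbabilityMeasure μ₂']
    [MeasurableSpace E] [TopologicalSpace E] [OpensMeasurableSpace E]
    {X : ∀ i, Ω₁ i → E} {Y : ∀ i, Ω₂ i → E} {Z : Ω₁' → E} {W : Ω₂' → E} {l : Filter ι}
    (h : TendstoInDistribution X l Z μ₁ μ₁') (hY : ∀ i, AEMeasurable (Y i) (μ₂ i))
    (hXY : ∀ i, (μ₂ i).map (Y i) = (μ₁ i).map (X i)) (hW : AEMeasurable W μ₂')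
    (hZW : μ₂'.map W = μ₁'.map Z) : TendstoInDistribution Y l W μ₂ μ₂' where
  forall_aemeasurable := hY
  aemeasurable_limit := hW
  tendsto := by
    have h1 := h.tendsto
    simp only [← hXY, ← hZW] at h1
    exact h1

/-- The extended continuous mapping theorem. -/
theorem TendstoInDistribution.comp_tendsto {E F Ω' : Type*} {Ω : ℕ → Type*}
    {mΩ : ∀ i, MeasurableSpace (Ω i)} {mΩ' : MeasurableSpace Ω'}
    {μ : ∀ i, Measure (Ω i)} [∀ i, IsProbabilityMeasure (μ i)]
    {μ' : Measure Ω'} [IsProbabilityMeasure μ']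
    [MeasurableSpace E] [TopologicalSpace E] [BorelSpace E] [HasOuterApproxClosed E]
    [MeasurableSpace F] [TopologicalSpace F] [BorelSpace F]
    {X : ∀ i, Ω i → E} {Z : Ω' → E} (h : TendstoInDistribution X atTop Z μ μ')
    {g : ℕ → E → F} {g₀ : E → F} (hg : ∀ n, Measurable (g n)) (hg₀ : Measurable g₀)
    (hlim : ∀ x, Tendsto (fun q : ℕ × E => g q.1 q.2) (atTop ×ˢ 𝓝 x) (𝓝 (g₀ x))) :
    TendstoInDistribution (fun n ω => g n (X n ω)) atTop (fun ω => g₀ (Z ω)) μ μ' where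
  forall_aemeasurable n := (hg n).comp_aemeasurable (h.forall_aemeasurable n)
  aemeasurable_limit := hg₀.comp_aemeasurable h.aemeasurable_limit
  tendsto := by
    refine tendsto_of_forall_isClosed_limsup_le' fun F hF => ?_
    -- Decreasing closed sets that contain all late preimages of `F`. The portmanteau inequality
    -- applies to each, and joint convergence of the maps forces their intersection into `g₀ ⁻¹' F`.
    let s : ℕ → Set E := fun m => closure (⋃ k ≥ m, g k ⁻¹' F)
    have hs : Antitone s := fun m m' hmm => closure_mono <|
      Set.biUnion_subset_biUnion_left fun k hk => le_trans hmm hk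
    have hinter : ⋂ m, s m ⊆ g₀ ⁻¹' F := by
      intro x hx
      by_contra hxF
      have hev := (hlim x).eventually (hF.isOpen_compl.mem_nhds hxF)
      obtain ⟨U, hU, V, hV, hUV⟩ := Filter.eventually_prod_iff.mp hev
      obtain ⟨m, hm⟩ := eventually_atTop.mp hU
      have hxm := Set.mem_iInter.mp hx m
      obtain ⟨y, hyV, hy⟩ := mem_closure_iff_nhds.mp hxm _ hV
      obtain ⟨k, hk, hyk⟩ := Set.mem_iUnion₂.mp hy
      exact hUV (hm k hk) hyV hyk
    have hbound : ∀ m, limsup (fun n => ((μ n).map (fun ω => g n (X n ω))) F) atTop ≤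
        μ'.map Z (s m) := by
      intro m
      have h1 := ProbabilityMeasure.limsup_measure_closed_le_of_tendsto h.tendsto
        (isClosed_closure (s := ⋃ k ≥ m, g k ⁻¹' F))
      refine le_trans (limsup_le_limsup ?_) h1
      filter_upwards [eventually_ge_atTop m] with n hn
      have : (μ n).map (fun ω => g n (X n ω)) = ((μ n).map (X n)).map (g n) := by
        rw [AEMeasurable.map_map_of_aemeasurable (hg n).aemeasurable (h.forall_aemeasurable n)]
        rfl
      rw [this, Measure.map_apply (hg n) hF.measurableSet]
      refine measure_mono (Set.Subset.trans ?_ subset_closure)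
      exact Set.subset_biUnion_of_mem (u := fun k => g k ⁻¹' F) hn
    have := Measure.isProbabilityMeasure_map (μ := μ') h.aemeasurable_limit
    have hconv : Tendsto (fun m => μ'.map Z (s m)) atTop (𝓝 (μ'.map Z (⋂ m, s m))) :=
      tendsto_measure_iInter_atTop (fun m => isClosed_closure.measurableSet.nullMeasurableSet) hs
        ⟨0, measure_ne_top _ _⟩
    have hfin : μ'.map Z (⋂ m, s m) ≤ μ'.map (fun ω => g₀ (Z ω)) F := by
      have : μ'.map (fun ω => g₀ (Z ω)) = (μ'.map Z).map g₀ := by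
        rw [AEMeasurable.map_map_of_aemeasurable hg₀.aemeasurable h.aemeasurable_limit]
        rfl
      rw [this, Measure.map_apply hg₀ hF.measurableSet]
      exact measure_mono hinter
    exact (ge_of_tendsto' hconv hbound).trans hfin

end Convergence

/-! ### Linear images and low moments of Gaussian laws. -/

section Gaussian

set_option linter.unusedSectionVars false

variable {ι κ : Type*} [Fintype ι] [Fintype κ] [DecidableEq ι] [DecidableEq κ]

theorem inner_toLp_mulVec (A : Matrix κ ι ℝ) (x : EuclideanSpace ℝ ι) (t : EuclideanSpace ℝ κ) :
    inner ℝ (WithLp.toLp 2 (A *ᵥ x.ofLp)) t = inner ℝ x (WithLp.toLp 2 (Aᵀ *ᵥ t.ofLp)) := by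
  simp only [EuclideanSpace.inner_eq_star_dotProduct, star_trivial]
  rw [mulVec_transpose, ← dotProduct_mulVec]

theorem measurable_toLp_mulVec (A : Matrix κ ι ℝ) :
    Measurable fun x : EuclideanSpace ℝ ι => WithLp.toLp 2 (A *ᵥ x.ofLp) := by
  have : Continuous fun x : EuclideanSpace ℝ ι => WithLp.toLp 2 (A *ᵥ x.ofLp) := by
    fun_prop
  exact this.measurable

theorem posSemidef_conj {S : Matrix ι ι ℝ} (hS : S.PosSemidef) (A : Matrix κ ι ℝ) :
    (A * S * Aᵀ).PosSemidef := by
  simpa using hS.mul_mul_conjTranspose_same A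

theorem multivariateGaussian_map_mulVec {S : Matrix ι ι ℝ} (hS : S.PosSemidef)
    (A : Matrix κ ι ℝ) :
    (multivariateGaussian 0 S).map (fun x => WithLp.toLp 2 (A *ᵥ x.ofLp)) =
      multivariateGaussian 0 (A * S * Aᵀ) := by
  have := Measure.isProbabilityMeasure_map (μ := multivariateGaussian 0 S)
    (measurable_toLp_mulVec A).aemeasurable
  refine Measure.ext_of_charFun ?_
  ext t
  rw [charFun_apply, integral_map (measurable_toLp_mulVec A).aemeasurable
    (Measurable.aestronglyMeasurable (by fun_prop))]
  simp_rw [inner_toLp_mulVec]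
  rw [← charFun_apply, charFun_multivariateGaussian hS,
    charFun_multivariateGaussian (posSemidef_conj hS A)]
  simp only [inner_zero_right]
  congr 3
  rw [← mulVec_mulVec, ← mulVec_mulVec, dotProduct_mulVec t.ofLp, ← mulVec_transpose]

theorem integral_sq_gaussianReal : ∫ x, x ^ 2 ∂(gaussianReal 0 1) = 1 := by
  have h := variance_id_gaussianReal (μ := 0) (v := 1)
  rw [variance_of_integral_eq_zero aemeasurable_id (by simp)] at h
  simpa using h

theorem integral_pow_four_gaussianReal : ∫ x, x ^ 4 ∂(gaussianReal 0 1) = 3 := by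
  -- The fourth moment is the fourth derivative at zero of `exp (t² / 2)`, computed one derivative
  -- at a time.
  have h := iteratedDeriv_mgf_zero (X := id) (μ := gaussianReal 0 1) (by
    rw [integrableExpSet_id_gaussianReal]; simp) 4
  have h0 : mgf id (gaussianReal 0 1) = fun t => Real.exp (t ^ 2 / 2) := by
    rw [mgf_id_gaussianReal]
    simp
  have e : ∀ t : ℝ, HasDerivAt (fun t : ℝ => Real.exp (t ^ 2 / 2)) (Real.exp (t ^ 2 / 2) * t) t := by
    intro t
    have := ((hasDerivAt_pow 2 t).div_const 2).exp
    simpa using this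
  have d1 : deriv (fun t : ℝ => Real.exp (t ^ 2 / 2)) = fun t => Real.exp (t ^ 2 / 2) * t :=
    funext fun t => (e t).deriv
  have d2 : deriv (fun t : ℝ => Real.exp (t ^ 2 / 2) * t) =
      fun t => Real.exp (t ^ 2 / 2) * (t ^ 2 + 1) := funext fun t => by
    rw [((e t).fun_mul (hasDerivAt_id' t)).deriv]; ring
  have d3 : deriv (fun t : ℝ => Real.exp (t ^ 2 / 2) * (t ^ 2 + 1)) =
      fun t => Real.exp (t ^ 2 / 2) * (t ^ 3 + 3 * t) := funext fun t => by
    rw [((e t).fun_mul ((hasDerivAt_pow 2 t).add_const 1)).deriv]; simp; ring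
  have d4 : deriv (fun t : ℝ => Real.exp (t ^ 2 / 2) * (t ^ 3 + 3 * t)) 0 = 3 := by
    rw [((e 0).fun_mul ((hasDerivAt_pow 3 0).fun_add ((hasDerivAt_id' 0).const_mul 3))).deriv]; simp
  rw [h0, iteratedDeriv_succ, iteratedDeriv_succ, iteratedDeriv_succ, iteratedDeriv_one, d1, d2,
    d3, d4] at h
  simpa using h.symm

theorem memLp_sq_gaussianReal : MemLp (fun x : ℝ => x ^ 2) 2 (gaussianReal 0 1) := by
  have h := memLp_id_gaussianReal (μ := 0) (v := 1) 4
  rw [memLp_two_iff_integrable_sq (by fun_prop)]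
  have := h.integrable_norm_pow (by norm_num)
  refine this.congr (ae_of_all _ fun x => ?_)
  simp [← pow_mul, Even.pow_abs (n := 4) (by decide)]

theorem variance_sq_gaussianReal : Var[fun x : ℝ => x ^ 2; gaussianReal 0 1] = 2 := by
  rw [variance_eq_sub memLp_sq_gaussianReal, integral_sq_gaussianReal]
  have : ((fun x : ℝ => x ^ 2) ^ 2) = fun x : ℝ => x ^ 4 := by
    ext x
    simp [← pow_mul]
  rw [this, integral_pow_four_gaussianReal]
  norm_num

end Gaussian

/-! ### Mean and variance of quadratic forms in a standard Gaussian vector. -/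

section QuadraticForm

variable {p : ℕ}

/-- The vectorization of `y y'`. -/
noncomputable def outerVec (y : EuclideanSpace ℝ (Fin p)) : EuclideanSpace ℝ (Fin p × Fin p) :=
  WithLp.toLp 2 (vecMulVec y.ofLp y.ofLp).vec

/-- The symmetric part of the matrix with vectorization `t`. -/
noncomputable def symMat (t : EuclideanSpace ℝ (Fin p × Fin p)) : Matrix (Fin p) (Fin p) ℝ :=
  Matrix.of fun i j => (t (j, i) + t (i, j)) / 2

theorem symMat_isHermitian (t : EuclideanSpace ℝ (Fin p × Fin p)) : (symMat t).IsHermitian := by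
  ext i j
  simp [symMat, add_comm]

theorem continuous_symMat :
    Continuous (symMat : EuclideanSpace ℝ (Fin p × Fin p) → Matrix (Fin p) (Fin p) ℝ) := by
  refine continuous_pi fun i => continuous_pi fun j => ?_
  simp only [symMat, of_apply]
  fun_prop

theorem symMat_vec {A : Matrix (Fin p) (Fin p) ℝ} (hA : A.IsHermitian) :
    symMat (WithLp.toLp 2 A.vec) = A := by
  ext i j
  have : A j i = A i j := by simpa using hA.apply i j
  simp [symMat, Matrix.vec, this]

/-- Since `y y'` is symmetric, only the symmetric part of `t` is seen. Linear functionals of `y y'`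
thereby become quadratic forms that a rotation diagonalizes. -/
theorem inner_outerVec (y : EuclideanSpace ℝ (Fin p)) (t : EuclideanSpace ℝ (Fin p × Fin p)) :
    inner ℝ t (outerVec y) = y.ofLp ⬝ᵥ (symMat t *ᵥ y.ofLp) := by
  have h1 : inner ℝ t (outerVec y) = ∑ i, ∑ j, y j * y i * t (i, j) := by
    simp only [EuclideanSpace.inner_eq_star_dotProduct, star_trivial, dotProduct,
      Fintype.sum_prod_type, outerVec, Matrix.vec, vecMulVec_apply]
  have h2 : inner ℝ t (outerVec y) = ∑ i, ∑ j, y i * y j * t (j, i) := by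
    rw [h1, Finset.sum_comm]
  have h3 : y.ofLp ⬝ᵥ (symMat t *ᵥ y.ofLp) =
      ((∑ i, ∑ j, y j * y i * t (i, j)) + ∑ i, ∑ j, y i * y j * t (j, i)) / 2 := by
    rw [← Finset.sum_add_distrib, Finset.sum_div]
    simp only [dotProduct, mulVec, Finset.mul_sum]
    refine Finset.sum_congr rfl fun i _ => ?_
    rw [← Finset.sum_add_distrib, Finset.sum_div]
    refine Finset.sum_congr rfl fun j _ => ?_
    simp only [symMat, of_apply]
    ring
  rw [h3, ← h1, ← h2]
  ring

/-- `1 + K` is twice the orthogonal projection onto symmetric matrices. -/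
theorem quadForm_one_add_commutationMatrix (t : EuclideanSpace ℝ (Fin p × Fin p)) :
    t.ofLp ⬝ᵥ ((1 + commutationMatrix p) *ᵥ t.ofLp) = 2 * ∑ i, ∑ j, symMat t i j ^ 2 := by
  have hK : commutationMatrix p *ᵥ t.ofLp = fun a => t a.swap := by
    ext a
    simp [commutationMatrix, mulVec, dotProduct]
  rw [add_mulVec, one_mulVec, hK, dotProduct_add]
  have e1 : t.ofLp ⬝ᵥ t.ofLp = ∑ i, ∑ j, t (i, j) ^ 2 := by
    simp only [dotProduct, Fintype.sum_prod_type, pow_two]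
  have e2 : t.ofLp ⬝ᵥ t.ofLp = ∑ i, ∑ j, t (j, i) ^ 2 := by
    rw [e1, Finset.sum_comm]
  have e3 : (t.ofLp ⬝ᵥ fun a => t a.swap) = ∑ i, ∑ j, t (i, j) * t (j, i) := by
    simp only [dotProduct, Fintype.sum_prod_type, Prod.swap_prod_mk]
  have e4 : 2 * ∑ i, ∑ j, symMat t i j ^ 2 = (t.ofLp ⬝ᵥ t.ofLp + t.ofLp ⬝ᵥ t.ofLp) / 2 +
      (t.ofLp ⬝ᵥ fun a => t a.swap) := by
    conv_rhs => rw [e3]; arg 1; arg 1; arg 2; rw [e1]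
    rw [e2, ← Finset.sum_add_distrib, Finset.sum_div, ← Finset.sum_add_distrib, Finset.mul_sum]
    refine Finset.sum_congr rfl fun i _ => ?_
    rw [← Finset.sum_add_distrib, Finset.sum_div, ← Finset.sum_add_distrib, Finset.mul_sum]
    refine Finset.sum_congr rfl fun j _ => ?_
    simp only [symMat, of_apply]
    ring
  rw [e4]
  ring

theorem posSemidef_one_add_commutationMatrix (p : ℕ) : (1 + commutationMatrix p).PosSemidef := by
  refine PosSemidef.of_dotProduct_mulVec_nonneg ?_ fun x => ?_
  · ext a b
    simp only [commutationMatrix, conjTranspose_apply, Matrix.add_apply, one_apply, of_apply,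
      star_trivial, Prod.ext_iff, Prod.fst_swap, Prod.snd_swap]
    congr 1 <;> simp [eq_comm, and_comm]
  · have := quadForm_one_add_commutationMatrix (WithLp.toLp 2 x)
    simp only [star_trivial]
    rw [this]
    positivity

/-- Both sides are the trace of `A * A`. -/
theorem sum_sq_eigenvalues {A : Matrix (Fin p) (Fin p) ℝ} (hA : A.IsHermitian) :
    ∑ i, orderedEigenvalues A i ^ 2 = ∑ i, ∑ j, A i j ^ 2 := by
  obtain ⟨U, hU, h⟩ := exists_diagonalization hA
  have h1 : (A * A).trace = ∑ i, orderedEigenvalues A i ^ 2 := by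
    have h2 : A * A = U * (diagonal (orderedEigenvalues A) * diagonal (orderedEigenvalues A)) *
        Uᵀ := by
      conv_lhs => rw [h]
      simp only [mul_assoc]
      rw [← mul_assoc Uᵀ U, hU, one_mul]
    rw [h2, trace_mul_comm, ← mul_assoc, hU, one_mul, diagonal_mul_diagonal, trace_diagonal]
    simp only [pow_two]
  rw [← h1]
  simp only [trace, diag, mul_apply]
  refine Finset.sum_congr rfl fun i _ => Finset.sum_congr rfl fun j _ => ?_
  have : A j i = A i j := by simpa using hA.apply i j
  rw [this, pow_two]

theorem hasLaw_transpose_mulVec {U : Matrix (Fin p) (Fin p) ℝ} (hU : Uᵀ * U = 1) :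
    (stdGaussian (EuclideanSpace ℝ (Fin p))).map (fun x => WithLp.toLp 2 (Uᵀ *ᵥ x.ofLp)) =
      (Measure.pi fun _ : Fin p => gaussianReal 0 1).map (WithLp.toLp 2) := by
  rw [map_pi_eq_stdGaussian, ← multivariateGaussian_zero_one,
    multivariateGaussian_map_mulVec PosSemidef.one]
  simp [hU]

/-- By rotation invariance the form becomes `∑ αᵢ zᵢ²` with independent standard normal `zᵢ`. Its
variance is `2 ∑ αᵢ²`, twice the squared Frobenius norm of `symMat t`. -/
theorem variance_inner_outerVec (t : EuclideanSpace ℝ (Fin p × Fin p)) :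
    Var[fun y => inner ℝ t (outerVec y); stdGaussian (EuclideanSpace ℝ (Fin p))] =
      t.ofLp ⬝ᵥ ((1 + commutationMatrix p) *ᵥ t.ofLp) := by
  obtain ⟨U, hU, h⟩ := exists_diagonalization (symMat_isHermitian t)
  set α := orderedEigenvalues (symMat t) with hα
  have h1 : (fun y => inner ℝ t (outerVec y)) =
      (fun z : EuclideanSpace ℝ (Fin p) => ∑ i, α i * z i ^ 2) ∘
        fun x => WithLp.toLp 2 (Uᵀ *ᵥ x.ofLp) := by
    ext y
    rw [inner_outerVec, h, dotProduct_conj_diagonal_mulVec]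
    rfl
  have hm : Measurable (fun z : EuclideanSpace ℝ (Fin p) => ∑ i, α i * z i ^ 2) := by
    fun_prop
  rw [h1, ← variance_map hm.aemeasurable (measurable_toLp_mulVec _).aemeasurable,
    hasLaw_transpose_mulVec hU, variance_map hm.aemeasurable (by fun_prop)]
  have h2 : (fun z : EuclideanSpace ℝ (Fin p) => ∑ i, α i * z i ^ 2) ∘ WithLp.toLp 2 =
      ∑ i, fun z : Fin p → ℝ => α i * (z i) ^ 2 := by
    ext z
    simp
  rw [h2, variance_sum_pi (X := fun i x => α i * x ^ 2)
    fun i => memLp_sq_gaussianReal.const_mul _]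
  simp_rw [variance_const_mul, variance_sq_gaussianReal]
  rw [← Finset.sum_mul, hα, sum_sq_eigenvalues (symMat_isHermitian t),
    quadForm_one_add_commutationMatrix, mul_comm]

theorem continuous_outerVec :
    Continuous (outerVec : EuclideanSpace ℝ (Fin p) → EuclideanSpace ℝ (Fin p × Fin p)) := by
  refine (PiLp.continuous_toLp 2 _).comp (continuous_pi fun a => ?_)
  simp only [Matrix.vec, vecMulVec_apply]
  fun_prop

theorem memLp_eval_stdGaussian (i : Fin p) (q : NNReal) :
    MemLp (fun y : EuclideanSpace ℝ (Fin p) => y i) q (stdGaussian _) := by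
  have h := IsGaussian.memLp_id (stdGaussian (EuclideanSpace ℝ (Fin p))) q (by simp)
  exact (EuclideanSpace.proj (𝕜 := ℝ) i).comp_memLp' h

theorem memLp_inner_outerVec (t : EuclideanSpace ℝ (Fin p × Fin p)) :
    MemLp (fun y => inner ℝ t (outerVec y)) 2 (stdGaussian (EuclideanSpace ℝ (Fin p))) := by
  have h4 : ∀ i, MemLp (fun y : EuclideanSpace ℝ (Fin p) => y i) 4 (stdGaussian _) :=
    fun i => memLp_eval_stdGaussian i 4
  have h1 : (fun y => inner ℝ t (outerVec y)) = fun y : EuclideanSpace ℝ (Fin p) =>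
      ∑ a : Fin p × Fin p, t a * (y a.2 * y a.1) := by
    ext y
    simp only [EuclideanSpace.inner_eq_star_dotProduct, star_trivial, dotProduct, outerVec,
      Matrix.vec, vecMulVec_apply]
    exact Finset.sum_congr rfl fun a _ => by ring
  rw [h1]
  have : ENNReal.HolderTriple 4 4 2 := ⟨by
    rw [← ENNReal.toReal_eq_toReal_iff' (by simp) (by simp)]
    rw [ENNReal.toReal_add (by simp) (by simp)]
    norm_num⟩
  exact memLp_finsetSum _ fun a _ => ((h4 a.1).mul' (h4 a.2)).const_mul _

theorem integral_eval_mul_eval_stdGaussian (i j : Fin p) :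
    ∫ y, y i * y j ∂(stdGaussian (EuclideanSpace ℝ (Fin p))) =
      (1 : Matrix (Fin p) (Fin p) ℝ) i j := by
  have h := covariance_eval_multivariateGaussian (μ := (0 : EuclideanSpace ℝ (Fin p)))
    (PosSemidef.one (n := Fin p) (R := ℝ)) i j
  rw [multivariateGaussian_zero_one, covariance_eq_sub (memLp_eval_stdGaussian i 2)
    (memLp_eval_stdGaussian j 2)] at h
  have h0 : ∀ k : Fin p, ∫ y, y k ∂(stdGaussian (EuclideanSpace ℝ (Fin p))) = 0 := fun k =>
    integral_strongDual_stdGaussian (EuclideanSpace.proj (𝕜 := ℝ) k)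
  rw [h0, h0] at h
  simpa using h

theorem integral_inner_outerVec (t : EuclideanSpace ℝ (Fin p × Fin p)) :
    ∫ y, inner ℝ t (outerVec y) ∂(stdGaussian (EuclideanSpace ℝ (Fin p))) =
      inner ℝ t (WithLp.toLp 2 (1 : Matrix (Fin p) (Fin p) ℝ).vec) := by
  have h1 : (fun y => inner ℝ t (outerVec y)) = fun y : EuclideanSpace ℝ (Fin p) =>
      ∑ a : Fin p × Fin p, t a * (y a.2 * y a.1) := by
    ext y
    simp only [EuclideanSpace.inner_eq_star_dotProduct, star_trivial, dotProduct, outerVec,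
      Matrix.vec, vecMulVec_apply]
    exact Finset.sum_congr rfl fun a _ => by ring
  rw [h1, integral_finsetSum]
  · simp_rw [integral_const_mul, integral_eval_mul_eval_stdGaussian]
    simp only [EuclideanSpace.inner_eq_star_dotProduct, star_trivial, dotProduct, Matrix.vec]
    exact Finset.sum_congr rfl fun a _ => by ring
  · have h2 : ∀ i, MemLp (fun y : EuclideanSpace ℝ (Fin p) => y i) 2 (stdGaussian _) :=
      fun i => memLp_eval_stdGaussian i 2
    exact fun a _ => ((h2 a.2).integrable_mul (h2 a.1)).const_mul _

end QuadraticForm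

/-! ### The multivariate central limit theorem for outer products. -/

section CentralLimit

variable {p : ℕ} {Ω : Type*} [MeasurableSpace Ω] {P : Measure Ω} [IsProbabilityMeasure P]
  {Y : ℕ → Ω → EuclideanSpace ℝ (Fin p)}

/-- The central limit theorem for the second moments of a standard Gaussian sample. -/
theorem tendstoInDistribution_sum_outerVec (hind : iIndepFun Y P)
    (hY : ∀ k, HasLaw (Y k) (stdGaussian _) P) :
    TendstoInDistribution (fun (n : ℕ) ω => (√n)⁻¹ • ((∑ k ∈ Finset.range n, outerVec (Y k ω)) -
        (n : ℝ) • WithLp.toLp 2 (1 : Matrix (Fin p) (Fin p) ℝ).vec)) atTop id (fun _ => P)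
      (multivariateGaussian 0 (1 + commutationMatrix p)) where
  forall_aemeasurable n := by
    have : ∀ k, AEMeasurable (fun ω => outerVec (Y k ω)) P := fun k =>
      continuous_outerVec.measurable.comp_aemeasurable (hY k).aemeasurable
    fun_prop
  aemeasurable_limit := aemeasurable_id
  tendsto := by
    have hm : ∀ k, AEMeasurable (fun ω => outerVec (Y k ω)) P := fun k =>
      continuous_outerVec.measurable.comp_aemeasurable (hY k).aemeasurable
    refine ProbabilityMeasure.tendsto_iff_tendsto_charFun.2 fun t => ?_
    -- Cramér–Wold: the characteristic function at `t` is that of the scalar sum of the `W k` at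
    -- frequency `1`, to which the one-dimensional theorem applies.
    let W : ℕ → Ω → ℝ := fun k ω => inner ℝ t (outerVec (Y k ω))
    have hmeas : Measurable fun y : EuclideanSpace ℝ (Fin p) => inner ℝ t (outerVec y) :=
      measurable_const.inner continuous_outerVec.measurable
    have hW : ∀ k, W k = (fun y => inner ℝ t (outerVec y)) ∘ Y k := fun k => rfl
    have hvar : Var[W 0; P] = t.ofLp ⬝ᵥ ((1 + commutationMatrix p) *ᵥ t.ofLp) := by
      rw [hW, ← variance_map hmeas.aemeasurable (hY 0).aemeasurable, (hY 0).map_eq,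
        variance_inner_outerVec]
    have hint : P[W 0] = inner ℝ t (WithLp.toLp 2 (1 : Matrix (Fin p) (Fin p) ℝ).vec) := by
      rw [hW, (hY 0).integral_comp hmeas.aestronglyMeasurable, integral_inner_outerVec]
    have hclt := tendstoInDistribution_inv_sqrt_mul_sum_sub (P := P) (X := W)
      (HasLaw.id (μ := gaussianReal 0 Var[W 0; P].toNNReal))
      (by
        rw [hW, ← memLp_map_measure_iff hmeas.aestronglyMeasurable (hY 0).aemeasurable,
          (hY 0).map_eq]
        exact memLp_inner_outerVec t)
      (hind.comp _ fun _ => hmeas)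
      (fun k => (IdentDistrib.mk (hY k).aemeasurable (hY 0).aemeasurable (by
        rw [(hY k).map_eq, (hY 0).map_eq]) : IdentDistrib (Y k) (Y 0) P P).comp hmeas)
    have hlim := (ProbabilityMeasure.tendsto_iff_tendsto_charFun.1 hclt.tendsto) 1
    convert! hlim using 2 with n
    · simp only [ProbabilityMeasure.coe_mk]
      rw [charFun_apply, charFun_apply, integral_map (by fun_prop) (by fun_prop),
        integral_map (hclt.forall_aemeasurable n) (by fun_prop)]
      congr 1
      ext ω
      congr 3
      rw [real_inner_comm, inner_smul_right, inner_sub_right, inner_sum, inner_smul_right, hint]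
      simp [W]
    · simp only [ProbabilityMeasure.coe_mk, Measure.map_id]
      rw [charFun_multivariateGaussian (posSemidef_one_add_commutationMatrix p),
        charFun_gaussianReal, hvar]
      have h0 : 0 ≤ t.ofLp ⬝ᵥ ((1 + commutationMatrix p) *ᵥ t.ofLp) := by
        rw [quadForm_one_add_commutationMatrix]
        positivity
      simp only [inner_zero_right, Real.coe_toNNReal _ h0]
      simp

end CentralLimit

/-! ### Kronecker products as conjugations, and almost sure symmetry. -/

section Conjugation

variable {p : ℕ}

theorem symMat_toLp_vec (A : Matrix (Fin p) (Fin p) ℝ) :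
    symMat (WithLp.toLp 2 A.vec) = (2⁻¹ : ℝ) • (A + Aᵀ) := by
  ext i j
  simp [symMat, Matrix.vec]
  ring

theorem exists_vec_eq (t : EuclideanSpace ℝ (Fin p × Fin p)) :
    ∃ A : Matrix (Fin p) (Fin p) ℝ, t = WithLp.toLp 2 A.vec :=
  ⟨Matrix.of fun i j => t (j, i), rfl⟩

theorem symMat_kronecker_mulVec (D : Matrix (Fin p) (Fin p) ℝ)
    (t : EuclideanSpace ℝ (Fin p × Fin p)) :
    symMat (WithLp.toLp 2 ((D ⊗ₖ D) *ᵥ t.ofLp)) = D * symMat t * Dᵀ := by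
  obtain ⟨A, rfl⟩ := exists_vec_eq t
  rw [kronecker_mulVec_vec, symMat_toLp_vec, symMat_toLp_vec]
  simp [transpose_mul, mul_add, add_mul, mul_assoc]

theorem commutationMatrix_mul_kronecker (D : Matrix (Fin p) (Fin p) ℝ) :
    commutationMatrix p * (D ⊗ₖ D) = (D ⊗ₖ D) * commutationMatrix p := by
  refine Matrix.toLin'.injective (LinearMap.ext fun x => ?_)
  obtain ⟨A, hA⟩ := exists_vec_eq (WithLp.toLp 2 x)
  have hx : x = A.vec := congrArg WithLp.ofLp hA
  simp only [toLin'_apply, ← mulVec_mulVec, hx]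
  rw [kronecker_mulVec_vec, commutationMatrix_mulVec_vec, commutationMatrix_mulVec_vec,
    kronecker_mulVec_vec]
  simp [transpose_mul, mul_assoc]

theorem kronecker_conj_one_add_commutationMatrix (D : Matrix (Fin p) (Fin p) ℝ) :
    (D ⊗ₖ D) * (1 + commutationMatrix p) * (D ⊗ₖ D)ᵀ =
      (1 + commutationMatrix p) * ((D * Dᵀ) ⊗ₖ (D * Dᵀ)) := by
  rw [mul_add, ← commutationMatrix_mul_kronecker, add_mul, add_mul, ← kroneckerMap_transpose,
    mul_one, one_mul, mul_assoc, ← mul_kronecker_mul]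

theorem commutationMatrix_mul_self : commutationMatrix p * commutationMatrix p = 1 := by
  refine Matrix.toLin'.injective (LinearMap.ext fun x => ?_)
  obtain ⟨A, hA⟩ := exists_vec_eq (WithLp.toLp 2 x)
  have hx : x = A.vec := congrArg WithLp.ofLp hA
  simp only [toLin'_apply, ← mulVec_mulVec, hx]
  rw [commutationMatrix_mulVec_vec, commutationMatrix_mulVec_vec]
  simp

theorem commutationMatrix_transpose : (commutationMatrix p)ᵀ = commutationMatrix p := by
  have h := (posSemidef_one_add_commutationMatrix p).isHermitian.eq
  simpa using h

/-- A random vector with covariance `I + K` is almost surely the vectorization of a symmetric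
matrix. -/
theorem ae_symmetric (p : ℕ) : ∀ᵐ t ∂(multivariateGaussian 0 (1 + commutationMatrix p)),
    t = WithLp.toLp 2 (symMat t).vec := by
  -- As `K * K = 1`, the matrix `(1 + K) / √2` is a symmetric square root of `1 + K`. The law is
  -- thus the image of a standard Gaussian under a map with symmetric values.
  have h : (1 + commutationMatrix p : Matrix (Fin p × Fin p) (Fin p × Fin p) ℝ) =
      ((√2)⁻¹ • (1 + commutationMatrix p)) * 1 * ((√2)⁻¹ • (1 + commutationMatrix p))ᵀ := by
    rw [transpose_smul, transpose_add, transpose_one, commutationMatrix_transpose, mul_one,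
      Matrix.smul_mul, Matrix.mul_smul, smul_smul, ← mul_inv, Real.mul_self_sqrt (by norm_num),
      add_mul, mul_add, mul_add, commutationMatrix_mul_self, one_mul, one_mul, mul_one]
    rw [add_comm (commutationMatrix p) 1, ← two_smul ℝ, smul_smul]
    norm_num
  have hc1 : Continuous fun t : EuclideanSpace ℝ (Fin p × Fin p) =>
      WithLp.toLp 2 (symMat t).vec := by
    refine (PiLp.continuous_toLp 2 _).comp (continuous_pi fun a => ?_)
    simp only [Matrix.vec, symMat, of_apply]
    fun_prop
  have hs : MeasurableSet {t : EuclideanSpace ℝ (Fin p × Fin p) |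
      t = WithLp.toLp 2 (symMat t).vec} := (isClosed_eq continuous_id hc1).measurableSet
  rw [h, ← multivariateGaussian_map_mulVec PosSemidef.one,
    ae_map_iff (measurable_toLp_mulVec _).aemeasurable hs]
  refine ae_of_all _ fun t => ?_
  obtain ⟨A, rfl⟩ := exists_vec_eq t
  have e : ((√2)⁻¹ • (1 + commutationMatrix p)) *ᵥ A.vec = ((√2)⁻¹ • (A + Aᵀ)).vec := by
    rw [smul_mulVec, add_mulVec, one_mulVec, commutationMatrix_mulVec_vec]
    rfl
  have hA : ((√2)⁻¹ • (A + Aᵀ)).IsHermitian := by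
    simp [IsHermitian, add_comm]
  simp only [e]
  rw [symMat_vec hA]

theorem continuous_orderedEigenvalues_comp {E : Type*} [TopologicalSpace E]
    {f : E → Matrix (Fin p) (Fin p) ℝ} (hf : Continuous f) (h : ∀ x, (f x).IsHermitian) :
    Continuous fun x => orderedEigenvalues (f x) :=
  continuous_iff_continuousAt.mpr fun x => tendsto_orderedEigenvalues h (h x) (hf.tendsto x)

theorem isHermitian_conj {A : Matrix (Fin p) (Fin p) ℝ} (hA : A.IsHermitian)
    (D : Matrix (Fin p) (Fin p) ℝ) : (D * A * Dᵀ).IsHermitian := by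
  simpa using isHermitian_mul_mul_conjTranspose D hA

end Conjugation

/-! ### The limiting Gaussian matrix. -/

section LimitLaw

variable {m : ℕ} {Ω : Type*} [MeasurableSpace Ω] {Q : Measure Ω} {u : ℝ}
  {Z : Ω → Matrix (Fin (m + 1)) (Fin (m + 1)) ℝ}

/-- A square root of `spikeDiag m u`. -/
noncomputable def spikeRoot (m : ℕ) (u : ℝ) : Matrix (Fin (m + 1)) (Fin (m + 1)) ℝ :=
  corner (√(1 + u)) 1

theorem spikeRoot_transpose (u : ℝ) : (spikeRoot m u)ᵀ = spikeRoot m u := by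
  rw [spikeRoot, corner_transpose, transpose_one]

theorem spikeDiag_eq_corner (u : ℝ) : spikeDiag m u = corner (1 + u) 1 := by
  rw [spikeDiag, ← diagonal_one, corner_diagonal]

theorem spikeRoot_mul_self (hu : 0 ≤ 1 + u) : spikeRoot m u * spikeRoot m u = spikeDiag m u := by
  rw [spikeRoot, corner_mul_corner, Real.mul_self_sqrt hu, mul_one, spikeDiag_eq_corner]

theorem spikeRoot_zero : spikeRoot m 0 = 1 := by
  rw [spikeRoot, add_zero, Real.sqrt_one, corner_one_one]

/-- `Z(u)` therefore has the law of `D Z(0) D'` with `D = spikeRoot m u`, which ties the limit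
matrix to the limit of `√n (S - 1)`. -/
theorem limitCov_eq_conj (hu : 0 ≤ 1 + u) :
    limitCov m u = (spikeRoot m u ⊗ₖ spikeRoot m u) * (1 + commutationMatrix (m + 1)) *
      (spikeRoot m u ⊗ₖ spikeRoot m u)ᵀ := by
  rw [kronecker_conj_one_add_commutationMatrix, spikeRoot_transpose, spikeRoot_mul_self hu,
    limitCov]

theorem limitCov_posSemidef (hu : 0 ≤ 1 + u) : (limitCov m u).PosSemidef := by
  rw [limitCov_eq_conj hu]
  exact posSemidef_conj (posSemidef_one_add_commutationMatrix _) _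

theorem multivariateGaussian_limitCov (hu : 0 ≤ 1 + u) :
    multivariateGaussian 0 (limitCov m u) =
      (multivariateGaussian 0 (1 + commutationMatrix (m + 1))).map fun t =>
        WithLp.toLp 2 ((spikeRoot m u ⊗ₖ spikeRoot m u) *ᵥ t.ofLp) := by
  rw [multivariateGaussian_map_mulVec (posSemidef_one_add_commutationMatrix _), limitCov_eq_conj hu]

theorem HasLimitLaw.ae_eq_symMat (hu : 0 ≤ 1 + u) (hZ : HasLimitLaw u Z Q) :
    ∀ᵐ ω ∂Q, Z ω = symMat (WithLp.toLp 2 (Z ω).vec) := by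
  have hc1 : Continuous fun t : EuclideanSpace ℝ (Fin (m + 1) × Fin (m + 1)) =>
      WithLp.toLp 2 (symMat t).vec := by
    refine (PiLp.continuous_toLp 2 _).comp (continuous_pi fun a => ?_)
    simp only [Matrix.vec, symMat, of_apply]
    fun_prop
  have hs : MeasurableSet {t : EuclideanSpace ℝ (Fin (m + 1) × Fin (m + 1)) |
      t = WithLp.toLp 2 (symMat t).vec} := (isClosed_eq continuous_id hc1).measurableSet
  have h1 : ∀ᵐ t ∂(multivariateGaussian 0 (limitCov m u)), t = WithLp.toLp 2 (symMat t).vec := by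
    rw [multivariateGaussian_limitCov hu, ae_map_iff (measurable_toLp_mulVec _).aemeasurable hs]
    filter_upwards [ae_symmetric (m + 1)] with t ht
    rw [symMat_kronecker_mulVec, ← kronecker_mulVec_vec]
    conv_lhs => rw [ht]
  rw [← hZ.map_eq] at h1
  have h2 := ae_of_ae_map hZ.aemeasurable h1
  filter_upwards [h2] with ω hω
  have := congrArg WithLp.ofLp hω
  simpa using Matrix.vec_inj.mp this

/-- Continuous functions of `Z` have the law of the corresponding functions of the vector with
covariance `I + K`. -/
theorem HasLimitLaw.map_eq_map {F : Type*} [MeasurableSpace F] (hu : 0 ≤ 1 + u)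
    (hZ : HasLimitLaw u Z Q) {f : Matrix (Fin (m + 1)) (Fin (m + 1)) ℝ → F}
    (hf : Measurable fun t => f (symMat t)) :
    AEMeasurable (fun ω => f (Z ω)) Q ∧
    Q.map (fun ω => f (Z ω)) = (multivariateGaussian 0 (1 + commutationMatrix (m + 1))).map
      fun t => f (spikeRoot m u * symMat t * (spikeRoot m u)ᵀ) := by
  have hae : (fun ω => f (Z ω)) =ᵐ[Q] fun ω => f (symMat (WithLp.toLp 2 (Z ω).vec)) := by
    filter_upwards [hZ.ae_eq_symMat hu] with ω hω
    rw [← hω]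
  refine ⟨(hf.comp_aemeasurable hZ.aemeasurable).congr hae.symm, ?_⟩
  rw [Measure.map_congr hae]
  have : Q.map (fun ω => f (symMat (WithLp.toLp 2 (Z ω).vec))) =
      (Q.map fun ω => WithLp.toLp 2 (Z ω).vec).map fun t => f (symMat t) := by
    rw [AEMeasurable.map_map_of_aemeasurable hf.aemeasurable hZ.aemeasurable]
    rfl
  rw [this, hZ.map_eq, multivariateGaussian_limitCov hu,
    Measure.map_map hf (measurable_toLp_mulVec _)]
  congr 1
  ext t
  simp only [Function.comp_apply, symMat_kronecker_mulVec]

theorem limitCov_apply (u : ℝ) (a b : Fin (m + 1) × Fin (m + 1)) :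
    limitCov m u a b = spikeDiag m u a.1 b.1 * spikeDiag m u a.2 b.2 +
      spikeDiag m u a.2 b.1 * spikeDiag m u a.1 b.2 := by
  have h : ∀ M : Matrix (Fin (m + 1) × Fin (m + 1)) (Fin (m + 1) × Fin (m + 1)) ℝ,
      (commutationMatrix (m + 1) * M) a b = M a.swap b := by
    intro M
    simp [commutationMatrix, mul_apply]
  rw [limitCov, add_mul, one_mul, Matrix.add_apply, h]
  rfl

theorem limitCov_zero_zero (u : ℝ) : limitCov m u (0, 0) (0, 0) = 2 * (1 + u) ^ 2 := by
  rw [limitCov_apply, spikeDiag]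
  simp
  ring

theorem limitCov_zero_succ (u : ℝ) (i j : Fin m) :
    limitCov m u (0, 0) (j.succ, i.succ) = 0 := by
  simp [limitCov_apply, spikeDiag_eq_corner]

theorem HasLimitLaw.hasLaw_zero_zero (hu : 0 ≤ 1 + u) (hZ : HasLimitLaw u Z Q) :
    HasLaw (fun ω => Z ω 0 0) (gaussianReal 0 (2 * (1 + u) ^ 2).toNNReal) Q := by
  have h := measurePreserving_eval_multivariateGaussian (μ := 0) (limitCov_posSemidef (m := m) hu)
    (i := (0, 0))
  rw [limitCov_zero_zero] at h
  exact h.fun_comp_hasLaw hZ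

/-- The corner entry and the entries of the lower block are jointly Gaussian with zero
cross-covariances, hence independent; the eigenvalues are a function of the block. -/
theorem HasLimitLaw.indepFun (hu : 0 ≤ 1 + u) (hZ : HasLimitLaw u Z Q) :
    IndepFun (fun ω => Z ω 0 0) (fun ω => orderedEigenvalues (lowerBlock (Z ω))) Q := by
  have hG : HasGaussianLaw (fun ω => WithLp.toLp 2 (Z ω).vec) Q := ⟨by
    rw [hZ.map_eq]
    infer_instance⟩
  let L : EuclideanSpace ℝ (Fin (m + 1) × Fin (m + 1)) →L[ℝ]
      (Unit → ℝ) × (Fin m × Fin m → ℝ) :=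
    (ContinuousLinearMap.pi fun _ => EuclideanSpace.proj (0, 0)).prod
      (ContinuousLinearMap.pi fun a => EuclideanSpace.proj (a.1.succ, a.2.succ))
  have hpair : HasGaussianLaw (fun ω => (fun _ : Unit => Z ω 0 0,
      fun a : Fin m × Fin m => Z ω a.2.succ a.1.succ)) Q := hG.map_fun L
  have hind := hpair.indepFun_of_covariance_eval
    (X := fun (_ : Unit) ω => Z ω 0 0)
    (Y := fun (a : Fin m × Fin m) ω => Z ω a.2.succ a.1.succ) fun _ a => by
      have h1 := hZ.covariance_fun_comp (f := fun t => t (0, 0))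
        (g := fun t : EuclideanSpace ℝ (Fin (m + 1) × Fin (m + 1)) => t (a.1.succ, a.2.succ))
        (by fun_prop) (by fun_prop)
      rw [covariance_eval_multivariateGaussian (limitCov_posSemidef hu), limitCov_zero_succ] at h1
      exact h1
  -- Symmetrizing gives a function of the entries that is Hermitian everywhere, so its eigenvalues
  -- are continuous; it agrees with the block almost surely.
  let S : (Fin m × Fin m → ℝ) → Matrix (Fin m) (Fin m) ℝ := fun y =>
    symMat (WithLp.toLp 2 y)
  have hS : Measurable fun y => orderedEigenvalues (S y) :=
    (continuous_orderedEigenvalues_comp (continuous_symMat.comp (PiLp.continuous_toLp 2 _))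
      fun y => symMat_isHermitian _).measurable
  have hφ : Measurable fun x : Unit → ℝ => x () := measurable_pi_apply ()
  have hfin := hind.comp hφ hS
  refine hfin.congr (ae_of_all _ fun ω => rfl) ?_
  filter_upwards [hZ.ae_eq_symMat hu] with ω hω
  have hH : (lowerBlock (Z ω)).IsHermitian := by
    rw [hω]
    exact lowerBlock_isHermitian (symMat_isHermitian _)
  have : S (fun a => Z ω a.2.succ a.1.succ) = lowerBlock (Z ω) := symMat_vec hH
  simp only [Function.comp_apply, this]

end LimitLaw

/-! ### Reduction of the spiked sample to a standard one. -/

section Sample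

variable {m : ℕ}

theorem sampleCov_eq {p n : ℕ} (x : Fin n → EuclideanSpace ℝ (Fin p)) :
    sampleCov x = (1 / (n : ℝ)) • ∑ i, vecMulVec (x i).ofLp (x i).ofLp -
      vecMulVec (sampleMean x).ofLp (sampleMean x).ofLp := by
  rcases Nat.eq_zero_or_pos n with rfl | hn
  · ext i j
    simp [sampleCov, sampleMean]
  have hn' : (n : ℝ) ≠ 0 := by positivity
  ext i j
  have hs : ∀ k, ∑ l, (x l).ofLp k = n * (sampleMean x).ofLp k := by
    intro k
    simp [sampleMean, hn']
  simp only [sampleCov, Matrix.smul_apply, Matrix.sum_apply, Matrix.sub_apply, vecMulVec_apply,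
    WithLp.ofLp_sub, Pi.sub_apply, smul_eq_mul]
  have : ∑ l, ((x l).ofLp i - (sampleMean x).ofLp i) * ((x l).ofLp j - (sampleMean x).ofLp j) =
      ∑ l, (x l).ofLp i * (x l).ofLp j - n * ((sampleMean x).ofLp i * (sampleMean x).ofLp j) := by
    simp only [sub_mul, mul_sub, Finset.sum_sub_distrib, ← Finset.mul_sum, ← Finset.sum_mul, hs]
    simp
    ring
  rw [this]
  field_simp

theorem sampleCov_mulVec {p n : ℕ} (A : Matrix (Fin p) (Fin p) ℝ)
    (x : Fin n → EuclideanSpace ℝ (Fin p)) :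
    sampleCov (fun i => WithLp.toLp 2 (A *ᵥ (x i).ofLp)) = A * sampleCov x * Aᵀ := by
  have hmean : sampleMean (fun i => WithLp.toLp 2 (A *ᵥ (x i).ofLp)) =
      WithLp.toLp 2 (A *ᵥ (sampleMean x).ofLp) := by
    have : ∑ i, WithLp.toLp 2 (A *ᵥ (x i).ofLp) = WithLp.toLp 2 (A *ᵥ (∑ i, x i).ofLp) := by
      rw [WithLp.ofLp_sum, mulVec_sum, WithLp.toLp_sum]
    rw [sampleMean, this, sampleMean, WithLp.ofLp_smul, mulVec_smul, WithLp.toLp_smul]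
  have hv : ∀ y : Fin p → ℝ, vecMulVec (A *ᵥ y) (A *ᵥ y) = A * vecMulVec y y * Aᵀ := by
    intro y
    rw [mul_vecMulVec, vecMulVec_mul, vecMul_transpose]
  rw [sampleCov, sampleCov, hmean]
  simp only [← WithLp.toLp_sub, ← mulVec_sub, hv]
  rw [Matrix.mul_smul, Matrix.smul_mul, Finset.mul_sum, Finset.sum_mul]
  rfl

theorem sampleCov_isHermitian {p n : ℕ} (x : Fin n → EuclideanSpace ℝ (Fin p)) :
    (sampleCov x).IsHermitian := by
  ext i j
  simp [sampleCov, Matrix.sum_apply, vecMulVec_apply, mul_comm]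

/-- The vectorization of `√n (S - I)`. -/
noncomputable def centeredCov {p n : ℕ} (x : Fin n → EuclideanSpace ℝ (Fin p)) :
    EuclideanSpace ℝ (Fin p × Fin p) :=
  WithLp.toLp 2 (√(n : ℝ) • (sampleCov x - 1)).vec

/-- The normalized eigenvalues as a function of the vectorization of `√n (S - I)`. -/
noncomputable def eigenvalueMap (m n : ℕ) (ρ : ℝ)
    (t : EuclideanSpace ℝ (Fin (m + 1) × Fin (m + 1))) : Fin (m + 1) → ℝ :=
  let M := corner (√(n : ℝ) * ρ) 0 + spikeRoot m ρ * symMat t * (spikeRoot m ρ)ᵀ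
  Fin.cons (orderedEigenvalues M 0 - √(n : ℝ) * ρ) (Fin.tail (orderedEigenvalues M))

/-- The rotation `R` does not change the spectrum, and since `D D' - 1 = corner ρ 0`, the matrix `√n
(D S D' - 1)` is the sum of the deterministic spike `corner (√n ρ) 0` and the noise `D √n (S - 1)
D'`. -/
theorem normalizedEigenvalues_mulVec {n : ℕ} {ρ : ℝ} (hρ : 1 ≤ n → 0 ≤ 1 + ρ)
    {R : Matrix (Fin (m + 1)) (Fin (m + 1)) ℝ} (hR : Rᵀ * R = 1)
    (y : Fin n → EuclideanSpace ℝ (Fin (m + 1))) :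
    normalizedEigenvalues ρ (fun i => WithLp.toLp 2 ((R * spikeRoot m ρ) *ᵥ (y i).ofLp)) =
      eigenvalueMap m n ρ (centeredCov y) := by
  have hS := sampleCov_isHermitian y
  have hc : symMat (centeredCov y) = √(n : ℝ) • (sampleCov y - 1) := symMat_vec (by
    have : (sampleCov y)ᵀ = sampleCov y := by simpa using hS.eq
    simp [IsHermitian, this])
  set D := spikeRoot m ρ with hD
  have hDSD := isHermitian_conj hS D
  have hcov : orderedEigenvalues (sampleCov fun i =>
      WithLp.toLp 2 ((R * D) *ᵥ (y i).ofLp)) = orderedEigenvalues (D * sampleCov y * Dᵀ) := by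
    rw [sampleCov_mulVec, ← orderedEigenvalues_conj hDSD hR]
    simp only [transpose_mul, mul_assoc]
  have hM : corner (√(n : ℝ) * ρ) 0 + D * symMat (centeredCov y) * Dᵀ =
      √(n : ℝ) • (D * sampleCov y * Dᵀ) + (-√(n : ℝ)) • 1 := by
    -- At `n = 0` nothing is known about the sign of `1 + ρ`, but the factor `√0` annihilates both
    -- sides.
    rcases Nat.eq_zero_or_pos n with rfl | hn
    · rw [hc]
      simp
      ext i j
      refine Fin.cases ?_ (fun i => ?_) i <;> refine Fin.cases ?_ (fun j => ?_) j <;> simp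
    · have hDD : D * Dᵀ = corner (1 + ρ) 1 := by
        rw [hD, spikeRoot_transpose, spikeRoot_mul_self (hρ hn), spikeDiag_eq_corner]
      rw [hc, Matrix.mul_smul, Matrix.smul_mul, mul_sub, sub_mul, mul_one, hDD, smul_sub]
      have : corner (√(n : ℝ) * ρ) 0 =
          √(n : ℝ) • corner (1 + ρ) (1 : Matrix (Fin m) (Fin m) ℝ) + (-√(n : ℝ)) • 1 := by
        rw [← corner_one_one]
        ext i j
        refine Fin.cases ?_ (fun i => ?_) i <;> refine Fin.cases ?_ (fun j => ?_) j <;> simp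
        ring
      rw [this]
      abel
  rw [normalizedEigenvalues, eigenvalueMap, hcov]
  simp only [← hD, hM]
  rw [orderedEigenvalues_smul_add hDSD (Real.sqrt_nonneg _)]
  congr 1
  · ring
  · ext j
    simp only [Fin.tail]
    ring

theorem continuous_eigenvalueMap (n : ℕ) (ρ : ℝ) : Continuous (eigenvalueMap m n ρ) := by
  have hM : Continuous fun t : EuclideanSpace ℝ (Fin (m + 1) × Fin (m + 1)) =>
      orderedEigenvalues (corner (√(n : ℝ) * ρ) 0 +
        spikeRoot m ρ * symMat t * (spikeRoot m ρ)ᵀ) := by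
    refine continuous_orderedEigenvalues_comp ?_ fun t => ?_
    · exact continuous_const.add
        ((continuous_const.matrix_mul continuous_symMat).matrix_mul continuous_const)
    · exact (corner_isHermitian _ (by simp [IsHermitian])).add
        (isHermitian_conj (symMat_isHermitian t) _)
  refine continuous_pi fun j => ?_
  refine Fin.cases ?_ (fun j => ?_) j
  · exact ((continuous_apply 0).comp hM).sub continuous_const
  · exact continuous_pi_iff.mp hM j.succ

theorem exists_orthogonal_col {θ : EuclideanSpace ℝ (Fin (m + 1))} (hθ : ‖θ‖ = 1) :
    ∃ R : Matrix (Fin (m + 1)) (Fin (m + 1)) ℝ, Rᵀ * R = 1 ∧ ∀ i, R i 0 = θ i := by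
  have hv : Orthonormal ℝ (({0} : Set (Fin (m + 1))).domRestrict fun _ => θ) := by
    refine ⟨fun _ => hθ, fun i j hij => ?_⟩
    exact absurd (Subsingleton.elim i j) hij
  obtain ⟨b, hb⟩ := hv.exists_orthonormalBasis_extension_of_card_eq (by simp)
  refine ⟨Matrix.of fun i j => b j i, ?_, fun i => by simp [hb 0 rfl]⟩
  ext i j
  have := orthonormal_iff_ite.mp b.orthonormal j i
  simp only [EuclideanSpace.inner_eq_star_dotProduct, star_trivial, dotProduct] at this
  simp only [mul_apply, transpose_apply, of_apply, one_apply, this, eq_comm]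

/-- `R` fixes the identity under conjugation and carries the first basis vector to `θ`, so it
carries `diag(1 + ρ, 1, …, 1)` to the spiked covariance. -/
theorem spikedCov_eq {θ : EuclideanSpace ℝ (Fin (m + 1))} {ρ : ℝ} (hρ : 0 ≤ 1 + ρ)
    {R : Matrix (Fin (m + 1)) (Fin (m + 1)) ℝ} (hR : Rᵀ * R = 1) (hR0 : ∀ i, R i 0 = θ i) :
    spikedCov θ ρ = (R * spikeRoot m ρ) * 1 * (R * spikeRoot m ρ)ᵀ := by
  have h : spikeDiag m ρ = 1 + ρ • vecMulVec (Pi.single 0 1) (Pi.single 0 1) := by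
    rw [spikeDiag_eq_corner, ← corner_one_one]
    ext i j
    refine Fin.cases ?_ (fun i => ?_) i <;> refine Fin.cases ?_ (fun j => ?_) j <;>
      simp [vecMulVec_apply]
  have hcol : R *ᵥ Pi.single 0 1 = θ.ofLp := by
    rw [mulVec_single_one]
    exact funext hR0
  rw [mul_one, transpose_mul, mul_assoc, ← mul_assoc (spikeRoot m ρ), spikeRoot_transpose,
    spikeRoot_mul_self hρ, h, add_mul, mul_add, one_mul, mul_eq_one_comm.mp hR, Matrix.smul_mul,
    Matrix.mul_smul, vecMulVec_mul, mul_vecMulVec, vecMul_transpose, hcol, spikedCov]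

end Sample

/-! ### Centering at the sample mean is negligible. -/

section StandardSample

variable {p : ℕ} {Ω : Type*} [MeasurableSpace Ω] {P : Measure Ω} [IsProbabilityMeasure P]
  {Y : ℕ → Ω → EuclideanSpace ℝ (Fin p)}

theorem centeredCov_eq {n : ℕ} (y : ℕ → EuclideanSpace ℝ (Fin p)) :
    centeredCov (fun i : Fin n => y i) = (√n)⁻¹ • ((∑ k ∈ Finset.range n, outerVec (y k)) -
        (n : ℝ) • WithLp.toLp 2 (1 : Matrix (Fin p) (Fin p) ℝ).vec) -
      √(n : ℝ) • outerVec (sampleMean fun i : Fin n => y i) := by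
  rcases Nat.eq_zero_or_pos n with rfl | hn
  · ext a
    simp [centeredCov]
  have hn' : (0 : ℝ) < n := by exact_mod_cast hn
  have h1 : √(n : ℝ) * (n : ℝ)⁻¹ = (√(n : ℝ))⁻¹ := by
    rw [← div_eq_mul_inv, Real.sqrt_div_self]
  have h2 : (√(n : ℝ))⁻¹ * n = √(n : ℝ) := by
    rw [inv_mul_eq_div, Real.div_sqrt]
  ext a
  have hs : (∑ k ∈ Finset.range n, outerVec (y k)).ofLp a =
      ∑ i : Fin n, (y i).ofLp a.2 * (y i).ofLp a.1 := by
    rw [Finset.sum_range, WithLp.ofLp_sum, Finset.sum_apply]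
    rfl
  have hL : (centeredCov fun i : Fin n => y i).ofLp a = √(n : ℝ) * ((n : ℝ)⁻¹ *
      (∑ i : Fin n, (y i).ofLp a.2 * (y i).ofLp a.1) -
        (sampleMean fun i : Fin n => y i).ofLp a.2 * (sampleMean fun i : Fin n => y i).ofLp a.1 -
      (1 : Matrix (Fin p) (Fin p) ℝ) a.2 a.1) := by
    simp [centeredCov, sampleCov_eq, Matrix.vec, Matrix.sum_apply, vecMulVec_apply]
  have ho : ∀ z : EuclideanSpace ℝ (Fin p), (outerVec z).ofLp a = z a.2 * z a.1 := fun z => rfl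
  have hv : (1 : Matrix (Fin p) (Fin p) ℝ).vec a = (1 : Matrix (Fin p) (Fin p) ℝ) a.2 a.1 := rfl
  rw [hL]
  simp only [PiLp.sub_apply, PiLp.smul_apply, hs, ho, hv, smul_eq_mul]
  generalize (1 : Matrix (Fin p) (Fin p) ℝ) a.2 a.1 = d
  linear_combination (∑ i : Fin n, (y i).ofLp a.2 * (y i).ofLp a.1) * h1 + d * h2

theorem integral_sampleMean_sq (hind : iIndepFun Y P) (hY : ∀ k, HasLaw (Y k) (stdGaussian _) P)
    {n : ℕ} (hn : 0 < n) (j : Fin p) :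
    Integrable (fun ω => (sampleMean fun i : Fin n => Y i ω).ofLp j ^ 2) P ∧
    ∫ ω, (sampleMean fun i : Fin n => Y i ω).ofLp j ^ 2 ∂P = (n : ℝ)⁻¹ := by
  have hm : Measurable fun y : EuclideanSpace ℝ (Fin p) => y j := by fun_prop
  let W : ℕ → Ω → ℝ := fun k ω => Y k ω j
  have hL : ∀ k, MemLp (W k) 2 P := by
    intro k
    have := memLp_eval_stdGaussian j 2
    rw [← (hY k).map_eq, memLp_map_measure_iff hm.aestronglyMeasurable (hY k).aemeasurable] at this
    exact this
  have hvar : ∀ k, Var[W k; P] = 1 := by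
    intro k
    have h := (hY k).covariance_fun_comp hm.aemeasurable hm.aemeasurable
    rw [← multivariateGaussian_zero_one, covariance_eval_multivariateGaussian PosSemidef.one] at h
    rw [covariance_self (hL k).aemeasurable] at h
    simpa using h
  have hmean : ∀ k, P[W k] = 0 := by
    intro k
    have := (hY k).integral_comp hm.aestronglyMeasurable
    rw [show (fun y : EuclideanSpace ℝ (Fin p) => y j) ∘ Y k = W k from rfl] at this
    rw [this]
    exact integral_strongDual_stdGaussian (EuclideanSpace.proj (𝕜 := ℝ) j)
  have hsum : Var[∑ k ∈ Finset.range n, W k; P] = n := by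
    rw [IndepFun.variance_sum (fun k _ => hL k)]
    · simp [hvar]
    · intro a _ b _ hab
      exact (hind.indepFun hab).comp hm hm
  have hLs : MemLp (∑ k ∈ Finset.range n, W k) 2 P := memLp_finsetSum' _ fun k _ => hL k
  have hms : P[∑ k ∈ Finset.range n, W k] = 0 := by
    simp only [Finset.sum_apply]
    rw [integral_finsetSum _ fun k _ => (hL k).integrable (by norm_num)]
    simp [hmean]
  rw [variance_of_integral_eq_zero hLs.aemeasurable hms] at hsum
  have he : (fun ω => (sampleMean fun i : Fin n => Y i ω).ofLp j ^ 2) =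
      fun ω => ((n : ℝ)⁻¹) ^ 2 * (∑ k ∈ Finset.range n, W k) ω ^ 2 := by
    ext ω
    have : (sampleMean fun i : Fin n => Y i ω).ofLp j =
        (n : ℝ)⁻¹ * (∑ k ∈ Finset.range n, W k) ω := by
      rw [Finset.sum_apply, Finset.sum_range]
      simp [sampleMean, W]
    rw [this, mul_pow]
  rw [he]
  refine ⟨hLs.integrable_sq.const_mul _, ?_⟩
  rw [integral_const_mul, hsum]
  have : (n : ℝ) ≠ 0 := by positivity
  field_simp

theorem norm_outerVec (y : EuclideanSpace ℝ (Fin p)) : ‖outerVec y‖ = ∑ j, y j ^ 2 := by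
  have h : ‖outerVec y‖ ^ 2 = (∑ j, y j ^ 2) ^ 2 := by
    rw [EuclideanSpace.real_norm_sq_eq, Fintype.sum_prod_type, pow_two, Finset.sum_mul_sum]
    refine Finset.sum_congr rfl fun i _ => Finset.sum_congr rfl fun j _ => ?_
    simp only [outerVec, Matrix.vec, vecMulVec_apply]
    ring
  exact (sq_eq_sq₀ (norm_nonneg _) (by positivity)).mp h

/-- The norm of the outer product is the squared norm of the mean, whose expectation is `p / n`. So
the `L¹` norm of the correction is `p / √n`. -/
theorem tendstoInMeasure_outerVec_sampleMean (hind : iIndepFun Y P)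
    (hY : ∀ k, HasLaw (Y k) (stdGaussian _) P) :
    TendstoInMeasure P (fun (n : ℕ) ω => -(√(n : ℝ) • outerVec (sampleMean fun i : Fin n => Y i ω)))
      atTop 0 := by
  have hmeas : ∀ n : ℕ, AEMeasurable (fun ω =>
      -(√(n : ℝ) • outerVec (sampleMean fun i : Fin n => Y i ω))) P := by
    intro n
    have h1 : AEMeasurable (fun ω => sampleMean fun i : Fin n => Y i ω) P := by
      have : ∀ k, AEMeasurable (Y k) P := fun k => (hY k).aemeasurable
      unfold sampleMean
      fun_prop
    exact (continuous_outerVec.const_smul (√(n : ℝ))).neg.measurable.comp_aemeasurable h1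
  refine tendstoInMeasure_of_tendsto_eLpNorm (p := 1) one_ne_zero
    (fun n => (hmeas n).aestronglyMeasurable) aestronglyMeasurable_const ?_
  have hlim : Tendsto (fun n : ℕ => ENNReal.ofReal (p * (√(n : ℝ))⁻¹)) atTop (𝓝 0) := by
    rw [← ENNReal.ofReal_zero]
    refine ENNReal.tendsto_ofReal ?_
    rw [← mul_zero (p : ℝ)]
    exact (tendsto_inv_atTop_zero.comp
      (Real.tendsto_sqrt_atTop.comp tendsto_natCast_atTop_atTop)).const_mul _
  refine hlim.congr' ?_
  filter_upwards [eventually_gt_atTop 0] with n hn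
  have hint := fun j => integral_sampleMean_sq hind hY hn j
  have hnorm : ∀ ω, ‖-(√(n : ℝ) • outerVec (sampleMean fun i : Fin n => Y i ω))‖ =
      √(n : ℝ) * ∑ j, (sampleMean fun i : Fin n => Y i ω).ofLp j ^ 2 := by
    intro ω
    rw [norm_neg, norm_smul, norm_outerVec, Real.norm_of_nonneg (Real.sqrt_nonneg _)]
  have hI : Integrable (fun ω =>
      -(√(n : ℝ) • outerVec (sampleMean fun i : Fin n => Y i ω))) P := by
    rw [← integrable_norm_iff (hmeas n).aestronglyMeasurable]
    simp only [hnorm]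
    exact (integrable_finsetSum _ fun j _ => (hint j).1).const_mul _
  rw [sub_zero, eLpNorm_one_eq_lintegral_enorm, ← ofReal_integral_norm_eq_lintegral_enorm hI]
  simp only [hnorm]
  rw [integral_const_mul, integral_finsetSum _ fun j _ => (hint j).1]
  simp only [(hint _).2]
  congr 1
  have h1 : √(n : ℝ) * (n : ℝ)⁻¹ = (√(n : ℝ))⁻¹ := by
    rw [← div_eq_mul_inv, Real.sqrt_div_self]
  simp only [Finset.sum_const, Finset.card_univ, Fintype.card_fin, nsmul_eq_mul]
  rw [← h1]
  ring

/-- The central limit theorem for the sample covariance of a standard Gaussian sample. -/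
theorem tendstoInDistribution_centeredCov (hind : iIndepFun Y P)
    (hY : ∀ k, HasLaw (Y k) (stdGaussian _) P) :
    TendstoInDistribution (fun (n : ℕ) ω => centeredCov fun i : Fin n => Y i ω) atTop id
      (fun _ => P) (multivariateGaussian 0 (1 + commutationMatrix p)) := by
  have h := (tendstoInDistribution_sum_outerVec hind hY).add_of_tendstoInMeasure_const
    (c := 0)
    (tendstoInMeasure_outerVec_sampleMean hind hY) (fun n => by
      have h1 : AEMeasurable (fun ω => sampleMean fun i : Fin n => Y i ω) P := by
        have : ∀ k, AEMeasurable (Y k) P := fun k => (hY k).aemeasurable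
        unfold sampleMean
        fun_prop
      exact (continuous_outerVec.const_smul (√(n : ℝ))).neg.measurable.comp_aemeasurable h1)
  simp only [id, add_zero] at h
  change TendstoInDistribution _ _ (fun ω => ω) _ _
  convert! h using 2 with n
  ext1 ω
  rw [centeredCov_eq fun k => Y k ω, sub_eq_add_neg]
  rfl

end StandardSample

/-! ### Limits of the eigenvalue maps and transfer to the triangular array. -/

section Regimes

variable {m : ℕ}

theorem continuous_spikeRoot : Continuous (spikeRoot m) := by
  refine continuous_pi fun i => continuous_pi fun j => ?_
  refine Fin.cases ?_ (fun i => ?_) i <;> refine Fin.cases ?_ (fun j => ?_) j <;>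
    simp only [spikeRoot, corner_zero_zero, corner_zero_succ, corner_succ_zero,
      corner_succ_succ] <;> fun_prop

theorem tendsto_conj_symMat {ρ : ℕ → ℝ} {c : ℝ} (hρ : Tendsto ρ atTop (𝓝 c))
    (x : EuclideanSpace ℝ (Fin (m + 1) × Fin (m + 1))) :
    Tendsto (fun q : ℕ × EuclideanSpace ℝ (Fin (m + 1) × Fin (m + 1)) =>
        spikeRoot m (ρ q.1) * symMat q.2 * (spikeRoot m (ρ q.1))ᵀ) (atTop ×ˢ 𝓝 x)
      (𝓝 (spikeRoot m c * symMat x * (spikeRoot m c)ᵀ)) := by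
  have h1 : Tendsto (fun q : ℕ × EuclideanSpace ℝ (Fin (m + 1) × Fin (m + 1)) =>
      spikeRoot m (ρ q.1)) (atTop ×ˢ 𝓝 x) (𝓝 (spikeRoot m c)) :=
    (continuous_spikeRoot.tendsto c).comp (hρ.comp tendsto_fst)
  have h2 : Tendsto (fun q : ℕ × EuclideanSpace ℝ (Fin (m + 1) × Fin (m + 1)) =>
      symMat q.2) (atTop ×ˢ 𝓝 x) (𝓝 (symMat x)) :=
    (continuous_symMat.tendsto x).comp tendsto_snd
  have h3 : Tendsto (fun q : ℕ × EuclideanSpace ℝ (Fin (m + 1) × Fin (m + 1)) =>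
      (spikeRoot m (ρ q.1))ᵀ) (atTop ×ˢ 𝓝 x) (𝓝 (spikeRoot m c)ᵀ) := by
    simpa only [spikeRoot_transpose] using h1
  exact (h1.mul h2).mul h3

theorem tendsto_eigenvalueMap_of_atTop {ρ : ℕ → ℝ} {c : ℝ} (hρ : Tendsto ρ atTop (𝓝 c))
    (ha : Tendsto (fun n : ℕ => √(n : ℝ) * ρ n) atTop atTop)
    (x : EuclideanSpace ℝ (Fin (m + 1) × Fin (m + 1))) :
    Tendsto (fun q : ℕ × EuclideanSpace ℝ (Fin (m + 1) × Fin (m + 1)) =>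
        eigenvalueMap m q.1 (ρ q.1) q.2) (atTop ×ˢ 𝓝 x)
      (𝓝 (Fin.cons ((spikeRoot m c * symMat x * (spikeRoot m c)ᵀ) 0 0)
        (orderedEigenvalues (lowerBlock (spikeRoot m c * symMat x * (spikeRoot m c)ᵀ))))) := by
  have h := tendsto_orderedEigenvalues_corner_add (l := atTop ×ˢ 𝓝 x)
    (ha.comp tendsto_fst)
    (B := fun q : ℕ × EuclideanSpace ℝ (Fin (m + 1) × Fin (m + 1)) =>
      spikeRoot m (ρ q.1) * symMat q.2 * (spikeRoot m (ρ q.1))ᵀ)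
    (fun q => isHermitian_conj (symMat_isHermitian _) _)
    (isHermitian_conj (symMat_isHermitian x) _) (tendsto_conj_symMat hρ x)
  refine tendsto_pi_nhds.mpr fun j => ?_
  refine Fin.cases ?_ (fun j => ?_) j
  · exact h.1
  · exact h.2 j

/-- Convergence of `√n ρ` forces `ρ → 0`, so the scaling `spikeRoot` tends to the identity and the
spike survives only as the additive corner `a`. -/
theorem tendsto_eigenvalueMap_of_nhds {ρ : ℕ → ℝ} {a : ℝ}
    (ha : Tendsto (fun n : ℕ => √(n : ℝ) * ρ n) atTop (𝓝 a))
    (x : EuclideanSpace ℝ (Fin (m + 1) × Fin (m + 1))) :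
    Tendsto (fun q : ℕ × EuclideanSpace ℝ (Fin (m + 1) × Fin (m + 1)) =>
        eigenvalueMap m q.1 (ρ q.1) q.2) (atTop ×ˢ 𝓝 x)
      (𝓝 (Fin.cons (orderedEigenvalues (corner a 0 + symMat x) 0 - a)
        (Fin.tail (orderedEigenvalues (corner a 0 + symMat x))))) := by
  have hinv : Tendsto (fun n : ℕ => (√(n : ℝ))⁻¹) atTop (𝓝 0) :=
    tendsto_inv_atTop_zero.comp (Real.tendsto_sqrt_atTop.comp tendsto_natCast_atTop_atTop)
  have hρ : Tendsto ρ atTop (𝓝 0) := by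
    have h := hinv.mul ha
    rw [zero_mul] at h
    refine h.congr' ?_
    filter_upwards [eventually_gt_atTop 0] with n hn
    have : √(n : ℝ) ≠ 0 := by positivity
    field_simp
  have hc : Continuous fun b : ℝ => corner b (0 : Matrix (Fin m) (Fin m) ℝ) := by
    refine continuous_pi fun i => continuous_pi fun j => ?_
    refine Fin.cases ?_ (fun i => ?_) i <;> refine Fin.cases ?_ (fun j => ?_) j <;>
      simp only [corner_zero_zero, corner_zero_succ, corner_succ_zero,
        corner_succ_succ] <;> fun_prop
  have h1 : Tendsto (fun q : ℕ × EuclideanSpace ℝ (Fin (m + 1) × Fin (m + 1)) =>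
      √(q.1 : ℝ) * ρ q.1) (atTop ×ˢ 𝓝 x) (𝓝 a) := ha.comp tendsto_fst
  have h2 := tendsto_conj_symMat (m := m) hρ x
  rw [spikeRoot_zero, one_mul, transpose_one, mul_one] at h2
  have h0 : (corner (m := m) a 0).IsHermitian := corner_isHermitian _ (by simp [IsHermitian])
  have h := tendsto_orderedEigenvalues
    (fun q : ℕ × EuclideanSpace ℝ (Fin (m + 1) × Fin (m + 1)) =>
      (corner_isHermitian (√(q.1 : ℝ) * ρ q.1) (by simp [IsHermitian])).add
        (isHermitian_conj (symMat_isHermitian q.2) (spikeRoot m (ρ q.1))))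
    (h0.add (symMat_isHermitian x)) (((hc.tendsto a).comp h1).add h2)
  refine tendsto_pi_nhds.mpr fun j => ?_
  refine Fin.cases ?_ (fun j => ?_) j
  · exact (tendsto_pi_nhds.mp h 0).sub h1
  · exact tendsto_pi_nhds.mp h j.succ

theorem continuous_sampleCov (p n : ℕ) :
    Continuous (sampleCov : (Fin n → EuclideanSpace ℝ (Fin p)) → Matrix (Fin p) (Fin p) ℝ) := by
  refine continuous_pi fun i => continuous_pi fun j => ?_
  simp only [sampleCov, sampleMean, Matrix.smul_apply, Matrix.sum_apply, vecMulVec_apply]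
  fun_prop

theorem continuous_normalizedEigenvalues (n : ℕ) (ρ : ℝ) :
    Continuous (normalizedEigenvalues ρ :
      (Fin n → EuclideanSpace ℝ (Fin (m + 1))) → Fin (m + 1) → ℝ) := by
  have h := continuous_orderedEigenvalues_comp (continuous_sampleCov (m + 1) n)
    sampleCov_isHermitian
  refine continuous_pi fun j => ?_
  refine Fin.cases ?_ (fun j => ?_) j
  · exact ((continuous_pi_iff.mp h 0).sub continuous_const).const_mul _
  · exact ((continuous_pi_iff.mp h j.succ).sub continuous_const).const_mul _

/-- The rows of the array may live on unrelated spaces. Only their laws matter, so each is replaced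
by a linear image of the first `n` terms of one standard Gaussian sequence. The identity `hS` is
needed only when there is a sample vector. -/
theorem map_sample_eq {p n : ℕ} {Ω Ω' : Type*} [MeasurableSpace Ω] [MeasurableSpace Ω']
    {P : Measure Ω} {P' : Measure Ω'} [IsProbabilityMeasure P] [IsProbabilityMeasure P']
    {X : Fin n → Ω → EuclideanSpace ℝ (Fin p)} (hX : iIndepFun X P)
    {S A : Matrix (Fin p) (Fin p) ℝ} (hS : 1 ≤ n → S = A * 1 * Aᵀ)
    (hXlaw : ∀ i, HasLaw (X i) (multivariateGaussian 0 S) P)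
    {Y : ℕ → Ω' → EuclideanSpace ℝ (Fin p)} (hY : iIndepFun Y P')
    (hYlaw : ∀ k, HasLaw (Y k) (stdGaussian _) P') :
    P.map (fun ω i => X i ω) = P'.map fun ω (i : Fin n) => WithLp.toLp 2 (A *ᵥ (Y i ω).ofLp) := by
  have h1 := hX.hasLaw_pi hXlaw
  have hind : iIndepFun (fun (i : Fin n) ω => WithLp.toLp 2 (A *ᵥ (Y i ω).ofLp)) P' :=
    (hY.precomp Fin.val_injective).comp (fun _ y => WithLp.toLp 2 (A *ᵥ y.ofLp))
      fun _ => measurable_toLp_mulVec A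
  have h2 := hind.hasLaw_pi (μ := fun _ => multivariateGaussian 0 S) fun i => by
    have hmp : MeasurePreserving (fun y : EuclideanSpace ℝ (Fin p) =>
        WithLp.toLp 2 (A *ᵥ y.ofLp)) (stdGaussian _) (multivariateGaussian 0 S) := by
      refine ⟨measurable_toLp_mulVec A, ?_⟩
      rw [← multivariateGaussian_zero_one, multivariateGaussian_map_mulVec PosSemidef.one,
        ← hS (Nat.one_le_of_lt i.2)]
    exact hmp.fun_comp_hasLaw (hYlaw i)
  rw [h1.map_eq, h2.map_eq]

/-- Convergence of the normalized eigenvalues, given the pointwise behaviour of the eigenvalue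
maps and the law of the limit. -/
theorem tendstoInDistribution_normalizedEigenvalues
    {θ : EuclideanSpace ℝ (Fin (m + 1))} (hθ : ‖θ‖ = 1) {ρ : ℕ → ℝ} (hρ : ∀ n, 1 ≤ n → 0 ≤ 1 + ρ n)
    {Ω : ℕ → Type*} [∀ n, MeasurableSpace (Ω n)]
    {P : ∀ n, Measure (Ω n)} [∀ n, IsProbabilityMeasure (P n)]
    {X : ∀ n, Fin n → Ω n → EuclideanSpace ℝ (Fin (m + 1))}
    (hX : ∀ n, iIndepFun (X n) (P n))
    (hXlaw : ∀ n i, HasLaw (X n i) (multivariateGaussian 0 (spikedCov θ (ρ n))) (P n))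
    {Ω' : Type*} [MeasurableSpace Ω'] {Q : Measure Ω'} [IsProbabilityMeasure Q]
    {g : EuclideanSpace ℝ (Fin (m + 1) × Fin (m + 1)) → Fin (m + 1) → ℝ} (hg : Measurable g)
    (hlim : ∀ x, Tendsto (fun q : ℕ × EuclideanSpace ℝ (Fin (m + 1) × Fin (m + 1)) =>
        eigenvalueMap m q.1 (ρ q.1) q.2) (atTop ×ˢ 𝓝 x) (𝓝 (g x)))
    {ℓ : Ω' → Fin (m + 1) → ℝ} (hℓ : AEMeasurable ℓ Q)
    (hlaw : Q.map ℓ = (multivariateGaussian 0 (1 + commutationMatrix (m + 1))).map g) :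
    TendstoInDistribution (fun n ω => normalizedEigenvalues (ρ n) fun i => X n i ω) atTop ℓ P Q := by
  obtain ⟨R, hR, hR0⟩ := exists_orthogonal_col hθ
  let P' : Measure (ℕ → EuclideanSpace ℝ (Fin (m + 1))) :=
    Measure.infinitePi fun _ => stdGaussian _
  let Y : ℕ → (ℕ → EuclideanSpace ℝ (Fin (m + 1))) → EuclideanSpace ℝ (Fin (m + 1)) :=
    fun k ω => ω k
  have hY : iIndepFun Y P' := iIndepFun_infinitePi (X := fun _ y => y) fun _ => measurable_id
  have hYlaw : ∀ k, HasLaw (Y k) (stdGaussian _) P' := fun k =>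
    ⟨(measurable_pi_apply k).aemeasurable, Measure.infinitePi_map_eval _ k⟩
  have h1 := TendstoInDistribution.comp_tendsto (tendstoInDistribution_centeredCov hY hYlaw)
    (g := fun n => eigenvalueMap m n (ρ n)) (fun n => (continuous_eigenvalueMap n _).measurable)
    hg hlim
  have hXm : ∀ n, AEMeasurable (fun ω i => X n i ω) (P n) := fun n =>
    aemeasurable_pi_lambda _ fun i => (hXlaw n i).aemeasurable
  have hN : ∀ n, Measurable (normalizedEigenvalues (ρ n) :
      (Fin n → EuclideanSpace ℝ (Fin (m + 1))) → Fin (m + 1) → ℝ) := fun n =>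
    (continuous_normalizedEigenvalues n _).measurable
  refine TendstoInDistribution.of_map_eq h1
    (fun n => (hN n).comp_aemeasurable (hXm n)) (fun n => ?_) hℓ ?_
  · have e1 : (P n).map (fun ω => normalizedEigenvalues (ρ n) fun i => X n i ω) =
        ((P n).map fun ω i => X n i ω).map (normalizedEigenvalues (ρ n)) := by
      rw [AEMeasurable.map_map_of_aemeasurable (hN n).aemeasurable (hXm n)]
      rfl
    have hm2 : Measurable fun (ω : ℕ → EuclideanSpace ℝ (Fin (m + 1))) (i : Fin n) =>
        WithLp.toLp 2 ((R * spikeRoot m (ρ n)) *ᵥ (Y i ω).ofLp) :=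
      measurable_pi_lambda _ fun i => (measurable_toLp_mulVec _).comp (measurable_pi_apply _)
    rw [e1, map_sample_eq (hX n) (fun hn => spikedCov_eq (hρ n hn) hR hR0) (hXlaw n) hY hYlaw,
      Measure.map_map (hN n) hm2]
    congr 1
    ext1 ω
    exact normalizedEigenvalues_mulVec (hρ n) hR fun i : Fin n => Y i ω
  · exact hlaw

end Regimes

/-! ### The limit laws for diverging and for bounded `√n ρ`. -/

section Limits

variable {m : ℕ}

theorem corner_zero_zero_eq : corner 0 (0 : Matrix (Fin m) (Fin m) ℝ) = 0 := by
  ext i j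
  refine Fin.cases ?_ (fun i => ?_) i <;> refine Fin.cases ?_ (fun j => ?_) j <;> simp

theorem measurable_cons_lowerBlock :
    Measurable fun t : EuclideanSpace ℝ (Fin (m + 1) × Fin (m + 1)) =>
      (Fin.cons (symMat t 0 0) (orderedEigenvalues (lowerBlock (symMat t))) :
        Fin (m + 1) → ℝ) := by
  have h : Continuous fun t : EuclideanSpace ℝ (Fin (m + 1) × Fin (m + 1)) =>
      orderedEigenvalues (lowerBlock (symMat t)) :=
    continuous_orderedEigenvalues_comp
      (continuous_symMat.matrix_submatrix Fin.succ Fin.succ)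
      fun t => lowerBlock_isHermitian (symMat_isHermitian t)
  refine (continuous_pi fun j => ?_ : Continuous _).measurable
  refine Fin.cases ?_ (fun j => ?_) j
  · exact (continuous_symMat.matrix_elem 0 0)
  · exact continuous_pi_iff.mp h j

/-- The limit when the spike dominates the sampling error. -/
theorem tendstoInDistribution_of_spike_atTop
    {θ : EuclideanSpace ℝ (Fin (m + 1))} (hθ : ‖θ‖ = 1) {ρ : ℕ → ℝ} (hρ : ∀ n, 1 ≤ n → 0 ≤ 1 + ρ n)
    {Ω : ℕ → Type*} [∀ n, MeasurableSpace (Ω n)]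
    {P : ∀ n, Measure (Ω n)} [∀ n, IsProbabilityMeasure (P n)]
    {X : ∀ n, Fin n → Ω n → EuclideanSpace ℝ (Fin (m + 1))}
    (hX : ∀ n, iIndepFun (X n) (P n))
    (hXlaw : ∀ n i, HasLaw (X n i) (multivariateGaussian 0 (spikedCov θ (ρ n))) (P n))
    {Ω' : Type*} [MeasurableSpace Ω'] {Q : Measure Ω'} [IsProbabilityMeasure Q]
    {u : ℝ} (hu : 0 ≤ 1 + u) {Z : Ω' → Matrix (Fin (m + 1)) (Fin (m + 1)) ℝ}
    (hZ : HasLimitLaw u Z Q) (hρu : Tendsto ρ atTop (𝓝 u))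
    (hρ' : Tendsto (fun n : ℕ => √(n : ℝ) * ρ n) atTop atTop) :
    ∃ ℓ : Ω' → Fin (m + 1) → ℝ,
      TendstoInDistribution (fun n ω => normalizedEigenvalues (ρ n) fun i => X n i ω)
        atTop ℓ P Q ∧
      IndepFun (fun ω => ℓ ω 0) (fun ω => Fin.tail (ℓ ω)) Q ∧
      HasLaw (fun ω => ℓ ω 0) (gaussianReal 0 (2 * (1 + u) ^ 2).toNNReal) Q ∧
      ∀ ω, Fin.tail (ℓ ω) = orderedEigenvalues (lowerBlock (Z ω)) := by
  obtain ⟨h1, h2⟩ := hZ.map_eq_map hu measurable_cons_lowerBlock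
    (f := fun M => (Fin.cons (M 0 0) (orderedEigenvalues (lowerBlock M)) : Fin (m + 1) → ℝ))
  refine ⟨fun ω => Fin.cons (Z ω 0 0) (orderedEigenvalues (lowerBlock (Z ω))), ?_,
    hZ.indepFun hu, hZ.hasLaw_zero_zero hu, fun ω => rfl⟩
  refine tendstoInDistribution_normalizedEigenvalues hθ hρ hX hXlaw ?_
    (tendsto_eigenvalueMap_of_atTop hρu hρ') h1 h2
  have hm : Measurable fun t : EuclideanSpace ℝ (Fin (m + 1) × Fin (m + 1)) =>
      WithLp.toLp 2 ((spikeRoot m u ⊗ₖ spikeRoot m u) *ᵥ t.ofLp) := measurable_toLp_mulVec _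
  have := measurable_cons_lowerBlock.comp hm
  simpa only [Function.comp_def, symMat_kronecker_mulVec] using this

/-- The limit when the spike is of the order of the sampling error, or smaller. -/
theorem tendstoInDistribution_of_spike_nhds
    {θ : EuclideanSpace ℝ (Fin (m + 1))} (hθ : ‖θ‖ = 1) {ρ : ℕ → ℝ} (hρ : ∀ n, 1 ≤ n → 0 ≤ 1 + ρ n)
    {Ω : ℕ → Type*} [∀ n, MeasurableSpace (Ω n)]
    {P : ∀ n, Measure (Ω n)} [∀ n, IsProbabilityMeasure (P n)]
    {X : ∀ n, Fin n → Ω n → EuclideanSpace ℝ (Fin (m + 1))}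
    (hX : ∀ n, iIndepFun (X n) (P n))
    (hXlaw : ∀ n i, HasLaw (X n i) (multivariateGaussian 0 (spikedCov θ (ρ n))) (P n))
    {Ω' : Type*} [MeasurableSpace Ω'] {Q : Measure Ω'} [IsProbabilityMeasure Q]
    {Z : Ω' → Matrix (Fin (m + 1)) (Fin (m + 1)) ℝ} (hZ : HasLimitLaw 0 Z Q) {a : ℝ}
    (ha : Tendsto (fun n : ℕ => √(n : ℝ) * ρ n) atTop (𝓝 a)) :
    TendstoInDistribution (fun n ω => normalizedEigenvalues (ρ n) fun i => X n i ω) atTop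
      (fun ω => (Fin.cons (orderedEigenvalues (corner a 0 + Z ω) 0 - a)
        (Fin.tail (orderedEigenvalues (corner a 0 + Z ω))) : Fin (m + 1) → ℝ)) P Q := by
  have hm : Measurable fun t : EuclideanSpace ℝ (Fin (m + 1) × Fin (m + 1)) =>
      (Fin.cons (orderedEigenvalues (corner a 0 + symMat t) 0 - a)
        (Fin.tail (orderedEigenvalues (corner a 0 + symMat t))) : Fin (m + 1) → ℝ) := by
    have h : Continuous fun t : EuclideanSpace ℝ (Fin (m + 1) × Fin (m + 1)) =>
        orderedEigenvalues (corner a 0 + symMat t) :=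
      continuous_orderedEigenvalues_comp (continuous_const.add continuous_symMat)
        fun t => (corner_isHermitian _ (by simp [IsHermitian])).add (symMat_isHermitian t)
    refine (continuous_pi fun j => ?_ : Continuous _).measurable
    refine Fin.cases ?_ (fun j => ?_) j
    · exact (continuous_pi_iff.mp h 0).sub continuous_const
    · exact continuous_pi_iff.mp h j.succ
  obtain ⟨h1, h2⟩ := hZ.map_eq_map (by norm_num) hm
    (f := fun M => (Fin.cons (orderedEigenvalues (corner a 0 + M) 0 - a)
      (Fin.tail (orderedEigenvalues (corner a 0 + M))) : Fin (m + 1) → ℝ))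
  simp only [spikeRoot_zero, one_mul, transpose_one, mul_one] at h2
  exact tendstoInDistribution_normalizedEigenvalues hθ hρ hX hXlaw hm
    (tendsto_eigenvalueMap_of_nhds ha) h1 h2

end Limits

/-! ### Linear coordinates on symmetric matrices. -/

section SymmetricCoordinates

variable {p : ℕ}

/-- The positions above the diagonal. -/
abbrev UpperIndex (p : ℕ) := {a : Fin p × Fin p // a.1 < a.2}

/-- The coordinates of a symmetric matrix: diagonal part and part above the diagonal. -/
abbrev SymCoord (p : ℕ) := (Fin p → ℝ) × (UpperIndex p → ℝ)

/-- The matrix with zero diagonal, entries `e` above it and `σ` times the mirrored entries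
below it. -/
def mirror (σ : ℝ) (e : UpperIndex p → ℝ) : Matrix (Fin p) (Fin p) ℝ :=
  Matrix.of fun i j => if h : i < j then e ⟨(i, j), h⟩ else
    if h : j < i then σ * e ⟨(j, i), h⟩ else 0

@[simp] theorem mirror_upper (σ : ℝ) (e : UpperIndex p → ℝ) (a : UpperIndex p) :
    mirror σ e a.1.1 a.1.2 = e a := by
  simp [mirror, a.2]

@[simp] theorem mirror_lower (σ : ℝ) (e : UpperIndex p → ℝ) (a : UpperIndex p) :
    mirror σ e a.1.2 a.1.1 = σ * e a := by
  simp [mirror, a.2, a.2.le]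

@[simp] theorem mirror_diag (σ : ℝ) (e : UpperIndex p → ℝ) (i : Fin p) : mirror σ e i i = 0 := by
  simp [mirror]

theorem ext_of_upper {M N : Matrix (Fin p) (Fin p) ℝ} (hd : ∀ i, M i i = N i i)
    (hu : ∀ a : UpperIndex p, M a.1.1 a.1.2 = N a.1.1 a.1.2)
    (hl : ∀ a : UpperIndex p, M a.1.2 a.1.1 = N a.1.2 a.1.1) : M = N := by
  ext i j
  rcases lt_trichotomy i j with h | rfl | h
  · exact hu ⟨(i, j), h⟩
  · exact hd i
  · exact hl ⟨(j, i), h⟩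

theorem mirror_add (σ : ℝ) (e e' : UpperIndex p → ℝ) :
    mirror σ (e + e') = mirror σ e + mirror σ e' :=
  ext_of_upper (by simp) (by simp) (by simp [mul_add])

theorem mirror_smul (σ c : ℝ) (e : UpperIndex p → ℝ) : mirror σ (c • e) = c • mirror σ e :=
  ext_of_upper (by simp) (by simp) (by simp [mul_left_comm])

theorem mirror_transpose {σ : ℝ} (hσ : σ * σ = 1) (e : UpperIndex p → ℝ) :
    (mirror σ e)ᵀ = σ • mirror σ e :=
  ext_of_upper (by simp) (by simp) (by simp [← mul_assoc, hσ])

/-- The symmetric matrix with given coordinates, scaled so that standard Gaussian coordinates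
give the law of `Z`. -/
noncomputable def symOf : SymCoord p →ₗ[ℝ] Matrix (Fin p) (Fin p) ℝ where
  toFun z := diagonal (√2 • z.1) + mirror 1 z.2
  map_add' z z' := by
    have h : diagonal (√2 • z.1 + √2 • z'.1) = diagonal (√2 • z.1) + diagonal (√2 • z'.1) :=
      (diagonal_add _ _).symm
    rw [Prod.fst_add, Prod.snd_add, mirror_add, smul_add, h]
    abel
  map_smul' c z := by
    rw [Prod.smul_fst, Prod.smul_snd, mirror_smul, smul_comm, diagonal_smul, RingHom.id_apply,
      smul_add]

theorem symOf_apply (z : SymCoord p) : symOf z = diagonal (√2 • z.1) + mirror 1 z.2 := rfl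

/-- The coordinates of a symmetric matrix. -/
noncomputable def coordOf : Matrix (Fin p) (Fin p) ℝ →ₗ[ℝ] SymCoord p where
  toFun M := (fun i => (√2)⁻¹ * M i i, fun a => M a.1.1 a.1.2)
  map_add' M N := by
    ext <;> simp [mul_add]
  map_smul' c M := by
    ext <;> simp [mul_left_comm]

theorem coordOf_fst (M : Matrix (Fin p) (Fin p) ℝ) (i : Fin p) :
    (coordOf M).1 i = (√2)⁻¹ * M i i := rfl

theorem coordOf_snd (M : Matrix (Fin p) (Fin p) ℝ) (a : UpperIndex p) :
    (coordOf M).2 a = M a.1.1 a.1.2 := rfl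

theorem symOf_diag (z : SymCoord p) (i : Fin p) : symOf z i i = √2 * z.1 i := by
  simp [symOf_apply]

theorem symOf_upper (z : SymCoord p) (a : UpperIndex p) : symOf z a.1.1 a.1.2 = z.2 a := by
  simp [symOf_apply, a.2.ne]

theorem symOf_lower (z : SymCoord p) (a : UpperIndex p) : symOf z a.1.2 a.1.1 = z.2 a := by
  simp [symOf_apply, a.2.ne']

theorem symOf_isHermitian (z : SymCoord p) : (symOf z).IsHermitian := by
  rw [IsHermitian, conjTranspose_eq_transpose_of_trivial, symOf_apply, transpose_add,
    diagonal_transpose, mirror_transpose (by norm_num), one_smul]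

theorem coordOf_symOf (z : SymCoord p) : coordOf (symOf z) = z := by
  ext k
  · rw [coordOf_fst, symOf_diag, inv_mul_cancel_left₀ (by positivity)]
  · rw [coordOf_snd, symOf_upper]

theorem symOf_coordOf {M : Matrix (Fin p) (Fin p) ℝ} (hM : M.IsHermitian) :
    symOf (coordOf M) = M := by
  have h : ∀ i j, M i j = M j i := fun i j => by simpa using hM.apply j i
  refine ext_of_upper (fun i => ?_) (fun a => ?_) fun a => ?_
  · rw [symOf_diag, coordOf_fst, mul_inv_cancel_left₀ (by positivity)]
  · rw [symOf_upper, coordOf_snd]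
  · rw [symOf_lower, coordOf_snd, h]

theorem sum_eq_diag_add_upper (g : Fin p → Fin p → ℝ) :
    ∑ i, ∑ j, g i j = ∑ i, g i i + ∑ a : UpperIndex p, (g a.1.1 a.1.2 + g a.1.2 a.1.1) := by
  have hu : ∀ f : Fin p → Fin p → ℝ, ∑ a : UpperIndex p, f a.1.1 a.1.2 =
      ∑ i, ∑ j, if i < j then f i j else 0 := by
    intro f
    rw [← Fintype.sum_prod_type' (f := fun i j => if i < j then f i j else 0),
      ← Finset.sum_filter]
    exact (Finset.sum_subtype (f := fun a : Fin p × Fin p => f a.1 a.2) _ (by simp)).symm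
  have hd : ∑ i, g i i = ∑ i, ∑ j, if i = j then g i j else 0 := by simp
  rw [Finset.sum_add_distrib, hu g, hu fun i j => g j i,
    Finset.sum_comm (f := fun i j => if i < j then g j i else 0), hd, ← Finset.sum_add_distrib,
    ← Finset.sum_add_distrib]
  refine Finset.sum_congr rfl fun i _ => ?_
  rw [← Finset.sum_add_distrib, ← Finset.sum_add_distrib]
  refine Finset.sum_congr rfl fun j _ => ?_
  rcases lt_trichotomy i j with h | rfl | h
  · simp [h, h.ne, h.not_gt]
  · simp
  · simp [h, h.ne', h.not_gt]

/-- Off-diagonal entries occur twice, and the factor `√2` on the diagonal compensates. The Frobenius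
norm is then proportional to the Euclidean norm of the coordinates, so the Gaussian weight is
invariant under rotations. -/
theorem sum_sq_symOf (z : SymCoord p) :
    ∑ i, ∑ j, symOf z i j ^ 2 = 2 * (∑ i, z.1 i ^ 2 + ∑ a, z.2 a ^ 2) := by
  rw [sum_eq_diag_add_upper]
  simp only [symOf_diag, symOf_upper, symOf_lower, mul_pow, Real.sq_sqrt (zero_le_two (α := ℝ))]
  rw [mul_add, Finset.mul_sum, Finset.mul_sum]
  simp only [two_mul]

theorem inner_vec_symOf (z : SymCoord p) (t : EuclideanSpace ℝ (Fin p × Fin p)) :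
    inner ℝ (WithLp.toLp 2 (symOf z).vec) t =
      ∑ i, z.1 i * (√2 * symMat t i i) + ∑ a : UpperIndex p, z.2 a * (2 * symMat t a.1.1 a.1.2) := by
  have h : inner ℝ (WithLp.toLp 2 (symOf z).vec) t = ∑ i, ∑ j, symOf z j i * t (i, j) := by
    simp only [EuclideanSpace.inner_eq_star_dotProduct, star_trivial, dotProduct,
      Fintype.sum_prod_type, Matrix.vec]
    exact Finset.sum_congr rfl fun i _ => Finset.sum_congr rfl fun j _ => mul_comm _ _
  rw [h, sum_eq_diag_add_upper]
  congr 1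
  · refine Finset.sum_congr rfl fun i _ => ?_
    rw [symOf_diag]
    simp only [symMat, of_apply]
    ring
  · refine Finset.sum_congr rfl fun a _ => ?_
    rw [symOf_upper, symOf_lower]
    simp only [symMat, of_apply]
    ring

theorem continuous_symOf : Continuous (symOf : SymCoord p → Matrix (Fin p) (Fin p) ℝ) :=
  symOf.continuous_of_finiteDimensional

end SymmetricCoordinates

/-! ### The density of `Z` in these coordinates. -/

section GaussianDensity

theorem pi_gaussianReal_eq_withDensity (ι : Type*) [Fintype ι] :
    Measure.pi (fun _ : ι => gaussianReal 0 1) = volume.withDensity fun x : ι → ℝ =>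
      ENNReal.ofReal ((√(2 * Real.pi))⁻¹ ^ Fintype.card ι * Real.exp (-(1 / 2) * ∑ i, x i ^ 2)) := by
  have hpdf : ∀ x : ι → ℝ, (√(2 * Real.pi))⁻¹ ^ Fintype.card ι *
      Real.exp (-(1 / 2) * ∑ i, x i ^ 2) = ∏ i, gaussianPDFReal 0 1 (x i) := by
    intro x
    simp only [gaussianPDFReal, Finset.prod_mul_distrib, Finset.prod_const, ← Real.exp_sum,
      Finset.card_univ, Finset.mul_sum]
    congr 2
    · simp
    · refine Finset.sum_congr rfl fun i _ => ?_
      simp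
      ring
  simp only [hpdf]
  refine Measure.pi_eq fun s hs => ?_
  have hS : MeasurableSet (Set.univ.pi s) := MeasurableSet.univ_pi hs
  have hint : ∀ i, Integrable ((s i).indicator (gaussianPDFReal 0 1)) :=
    fun i => (integrable_gaussianPDFReal 0 1).indicator (hs i)
  have hnn : ∀ i x, 0 ≤ (s i).indicator (gaussianPDFReal 0 1) x := fun i x =>
    Set.indicator_nonneg (fun _ _ => gaussianPDFReal_nonneg _ _ _) _
  have hind : ∀ x : ι → ℝ, (Set.univ.pi s).indicator
      (fun x => ENNReal.ofReal (∏ i, gaussianPDFReal 0 1 (x i))) x =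
      ENNReal.ofReal (∏ i, (s i).indicator (gaussianPDFReal 0 1) (x i)) := by
    intro x
    by_cases hx : x ∈ Set.univ.pi s
    · rw [Set.indicator_of_mem hx]
      congr 1
      exact Finset.prod_congr rfl fun i _ => (Set.indicator_of_mem (hx i (Set.mem_univ i)) _).symm
    · rw [Set.indicator_of_notMem hx]
      obtain ⟨i, hi⟩ : ∃ i, x i ∉ s i := by simpa [Set.mem_pi] using hx
      rw [Finset.prod_eq_zero (Finset.mem_univ i) (Set.indicator_of_notMem hi _),
        ENNReal.ofReal_zero]
  rw [withDensity_apply _ hS, ← lintegral_indicator hS]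
  simp only [hind]
  rw [volume_pi, ← ofReal_integral_eq_lintegral_ofReal (Integrable.fintype_prod hint)
    (ae_of_all _ fun x => Finset.prod_nonneg fun i _ => hnn i (x i)),
    integral_fintype_prod_eq_prod, ENNReal.ofReal_prod_of_nonneg
      (fun i _ => integral_nonneg (hnn i))]
  refine Finset.prod_congr rfl fun i _ => ?_
  rw [ofReal_integral_eq_lintegral_ofReal (hint i) (ae_of_all _ (hnn i)),
    gaussianReal_of_var_ne_zero _ one_ne_zero, withDensity_apply _ (hs i),
    ← lintegral_indicator (hs i)]
  refine lintegral_congr fun x => ?_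
  by_cases hx : x ∈ s i <;> simp [hx, gaussianPDF]

variable {p : ℕ}

/-- The standard Gaussian law on the coordinates of symmetric matrices. -/
noncomputable def symGaussian (p : ℕ) : Measure (SymCoord p) :=
  (Measure.pi fun _ => gaussianReal 0 1).prod (Measure.pi fun _ => gaussianReal 0 1)

instance : IsProbabilityMeasure (symGaussian p) := by
  unfold symGaussian
  infer_instance

theorem exists_symGaussian_eq_withDensity (p : ℕ) : ∃ c : ℝ, 0 < c ∧
    symGaussian p = volume.withDensity fun z : SymCoord p =>
      ENNReal.ofReal (c * Real.exp (-(1 / 4) * ∑ i, ∑ j, symOf z i j ^ 2)) := by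
  refine ⟨(√(2 * Real.pi))⁻¹ ^ Fintype.card (Fin p) *
    (√(2 * Real.pi))⁻¹ ^ Fintype.card (UpperIndex p), by positivity, ?_⟩
  rw [symGaussian, pi_gaussianReal_eq_withDensity, pi_gaussianReal_eq_withDensity,
    prod_withDensity (by fun_prop) (by fun_prop)]
  congr 1
  ext z
  rw [← ENNReal.ofReal_mul (by positivity), sum_sq_symOf]
  congr 1
  rw [mul_mul_mul_comm, ← Real.exp_add]
  congr 2
  ring

theorem continuous_vec_symOf : Continuous fun z : SymCoord p => WithLp.toLp 2 (symOf z).vec := by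
  refine (PiLp.continuous_toLp 2 _).comp (continuous_pi fun a => ?_)
  exact continuous_symOf.matrix_elem a.2 a.1

/-- The characteristic function factors over the diagonal and the upper coordinates; the exponents
add up to the Frobenius norm of `symMat t`, which is the quadratic form of `1 + K`. -/
theorem multivariateGaussian_eq_map_symGaussian (p : ℕ) :
    multivariateGaussian 0 (1 + commutationMatrix p) =
      (symGaussian p).map fun z => WithLp.toLp 2 (symOf z).vec := by
  have := Measure.isProbabilityMeasure_map (μ := symGaussian p)
    continuous_vec_symOf.measurable.aemeasurable
  refine Measure.ext_of_charFun ?_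
  ext t
  have hc : ∀ (ι : Type) [Fintype ι] (u : ι → ℝ),
      ∫ x : ι → ℝ, Complex.exp ((∑ i, x i * u i : ℝ) * Complex.I)
        ∂(Measure.pi fun _ => gaussianReal 0 1) =
      Complex.exp (-((∑ i, u i ^ 2 : ℝ) : ℂ) / 2) := by
    intro ι _ u
    have h := charFun_stdGaussian (WithLp.toLp 2 u : EuclideanSpace ℝ ι)
    rw [← map_pi_eq_stdGaussian, charFun_apply, integral_map (by fun_prop)
      (Measurable.aestronglyMeasurable (by fun_prop)), ← Complex.ofReal_pow,
      EuclideanSpace.real_norm_sq_eq] at h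
    rw [← h]
    congr 1
    ext x
    congr 3
    simp only [EuclideanSpace.inner_eq_star_dotProduct, star_trivial, dotProduct]
    exact Finset.sum_congr rfl fun i _ => mul_comm _ _
  rw [charFun_multivariateGaussian (posSemidef_one_add_commutationMatrix p),
    quadForm_one_add_commutationMatrix, charFun_apply,
    integral_map continuous_vec_symOf.measurable.aemeasurable
      (Measurable.aestronglyMeasurable (by fun_prop))]
  simp only [inner_vec_symOf, Complex.ofReal_add, add_mul, Complex.exp_add]
  rw [symGaussian, integral_prod_mul
    (fun d : Fin p → ℝ => Complex.exp (((∑ i, d i * (√2 * symMat t i i) : ℝ) : ℂ) * Complex.I))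
    (fun e : UpperIndex p → ℝ =>
      Complex.exp (((∑ a, e a * (2 * symMat t a.1.1 a.1.2) : ℝ) : ℂ) * Complex.I)),
    hc, hc, ← Complex.exp_add]
  congr 1
  have hs : ∀ i j, symMat t i j = symMat t j i := fun i j => by
    simpa using (symMat_isHermitian t).apply j i
  have : 2 * ∑ i, ∑ j, symMat t i j ^ 2 = ∑ i, (√2 * symMat t i i) ^ 2 +
      ∑ a : UpperIndex p, (2 * symMat t a.1.1 a.1.2) ^ 2 := by
    rw [sum_eq_diag_add_upper, mul_add, Finset.mul_sum, Finset.mul_sum]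
    congr 1
    · refine Finset.sum_congr rfl fun i _ => ?_
      rw [mul_pow, Real.sq_sqrt zero_le_two]
    · refine Finset.sum_congr rfl fun a _ => ?_
      rw [hs a.1.2 a.1.1]
      ring
  rw [this, inner_zero_right]
  push_cast
  ring

end GaussianDensity

/-! ### The Cayley transform as a chart on orthogonal matrices. -/

section Cayley

variable {p : ℕ}

/-- The skew-symmetric matrix with given entries above the diagonal. -/
def skewOf : (UpperIndex p → ℝ) →ₗ[ℝ] Matrix (Fin p) (Fin p) ℝ where
  toFun := mirror (-1)
  map_add' := mirror_add (-1)
  map_smul' := mirror_smul (-1)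

theorem skewOf_apply (a : UpperIndex p → ℝ) : skewOf a = mirror (-1) a := rfl

theorem skewOf_transpose (a : UpperIndex p → ℝ) : (skewOf a)ᵀ = -skewOf a := by
  rw [skewOf_apply, mirror_transpose (by norm_num), neg_one_smul]

theorem skewOf_upper {A : Matrix (Fin p) (Fin p) ℝ} (hA : Aᵀ = -A) :
    skewOf (fun a => A a.1.1 a.1.2) = A := by
  have h : ∀ i j, A j i = -A i j := fun i j => congrFun (congrFun hA i) j
  refine ext_of_upper (fun i => ?_) (fun a => ?_) fun a => ?_
  · have := h i i
    rw [skewOf_apply, mirror_diag]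
    linarith
  · rw [skewOf_apply, mirror_upper]
  · rw [skewOf_apply, mirror_lower, h a.1.1 a.1.2]
    ring

theorem skewOf_injective : Function.Injective (skewOf : _ → Matrix (Fin p) (Fin p) ℝ) := by
  intro a b h
  ext k
  have := congrFun (congrFun h k.1.1) k.1.2
  simpa only [skewOf_apply, mirror_upper] using this

theorem continuous_skewOf : Continuous (skewOf : _ → Matrix (Fin p) (Fin p) ℝ) :=
  skewOf.continuous_of_finiteDimensional

/-- If `x = A x` with `A` skew, then `x ⬝ᵥ x = x ⬝ᵥ A x = 0`. -/
theorem isUnit_one_sub_of_skew {A : Matrix (Fin p) (Fin p) ℝ} (hA : Aᵀ = -A) :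
    IsUnit (1 - A) := by
  rw [← mulVec_injective_iff_isUnit]
  refine (injective_iff_map_eq_zero (1 - A).mulVecLin).mpr fun x hx => ?_
  have hx' : x = A *ᵥ x := by
    rw [mulVecLin_apply, sub_mulVec, one_mulVec, sub_eq_zero] at hx
    exact hx
  have h1 : x ⬝ᵥ A *ᵥ x = -(x ⬝ᵥ A *ᵥ x) := by
    conv_lhs => rw [dotProduct_mulVec, ← mulVec_transpose, hA, neg_mulVec, neg_dotProduct,
      dotProduct_comm]
  have h2 : x ⬝ᵥ x = 0 := by
    conv_lhs => rw [hx', ← hx']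
    rw [← hx'] at h1
    linarith
  exact dotProduct_self_eq_zero.mp h2

/-- The Cayley transform `(1 - A)⁻¹ (1 + A)`. -/
noncomputable def cayley (A : Matrix (Fin p) (Fin p) ℝ) : Matrix (Fin p) (Fin p) ℝ :=
  (1 - A)⁻¹ * (1 + A)

theorem one_sub_mul_cayley {A : Matrix (Fin p) (Fin p) ℝ} (hA : Aᵀ = -A) :
    (1 - A) * cayley A = 1 + A := by
  rw [cayley, mul_nonsing_inv_cancel_left _ _
    ((isUnit_iff_isUnit_det _).mp (isUnit_one_sub_of_skew hA))]

/-- Isolating a single inverse makes both injectivity and the derivative of the transform immediate.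
-/
theorem cayley_add_one {A : Matrix (Fin p) (Fin p) ℝ} (hA : Aᵀ = -A) :
    cayley A + 1 = (2 : ℝ) • (1 - A)⁻¹ := by
  have hu := (isUnit_iff_isUnit_det _).mp (isUnit_one_sub_of_skew hA)
  have h : (1 - A) * (cayley A + 1) = (1 - A) * ((2 : ℝ) • (1 - A)⁻¹) := by
    rw [mul_add, one_sub_mul_cayley hA, mul_one, mul_smul_comm, mul_nonsing_inv _ hu, two_smul]
    abel
  exact (isUnit_one_sub_of_skew hA).mul_left_cancel h

theorem inv_one_sub_transpose {A : Matrix (Fin p) (Fin p) ℝ} (hA : Aᵀ = -A) :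
    ((1 - A)⁻¹)ᵀ = (1 + A)⁻¹ := by
  rw [transpose_nonsing_inv, transpose_sub, transpose_one, hA, sub_neg_eq_add]

theorem isUnit_one_add_of_skew {A : Matrix (Fin p) (Fin p) ℝ} (hA : Aᵀ = -A) :
    IsUnit (1 + A) := by
  have := isUnit_one_sub_of_skew (A := -A) (by rw [transpose_neg, hA])
  rwa [sub_neg_eq_add] at this

theorem cayley_transpose_mul_inv {A : Matrix (Fin p) (Fin p) ℝ} (hA : Aᵀ = -A) :
    (cayley A)ᵀ * (1 - A)⁻¹ = ((1 - A)⁻¹)ᵀ := by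
  have hu := (isUnit_iff_isUnit_det _).mp (isUnit_one_sub_of_skew hA)
  have hu' := (isUnit_iff_isUnit_det _).mp (isUnit_one_add_of_skew hA)
  have hc : (1 - A) * (1 + A)⁻¹ = (1 + A)⁻¹ * (1 - A) := by
    have : (1 + A) * ((1 - A) * (1 + A)⁻¹) = (1 + A) * ((1 + A)⁻¹ * (1 - A)) := by
      rw [mul_nonsing_inv_cancel_left _ _ hu', ← mul_assoc,
        show (1 + A) * (1 - A) = (1 - A) * (1 + A) by noncomm_ring, mul_assoc,
        mul_nonsing_inv _ hu', mul_one]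
    exact (isUnit_one_add_of_skew hA).mul_left_cancel this
  rw [cayley, transpose_mul, inv_one_sub_transpose hA, transpose_add, transpose_one, hA,
    ← sub_eq_add_neg, hc, mul_assoc, mul_nonsing_inv _ hu, mul_one]

theorem cayley_transpose_mul_self {A : Matrix (Fin p) (Fin p) ℝ} (hA : Aᵀ = -A) :
    (cayley A)ᵀ * cayley A = 1 := by
  have hu' := (isUnit_iff_isUnit_det _).mp (isUnit_one_add_of_skew hA)
  conv_lhs => rw [cayley.eq_def A, ← mul_assoc]
  rw [← cayley, cayley_transpose_mul_inv hA, inv_one_sub_transpose hA, nonsing_inv_mul _ hu']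

theorem cayley_injOn {A B : Matrix (Fin p) (Fin p) ℝ} (hA : Aᵀ = -A) (hB : Bᵀ = -B)
    (h : cayley A = cayley B) : A = B := by
  have h1 := cayley_add_one hA
  rw [h, cayley_add_one hB] at h1
  have h2 : (1 - B)⁻¹ = (1 - A)⁻¹ := smul_right_injective _ (two_ne_zero' ℝ) h1
  have h3 : 1 - A = 1 - B := by
    rw [← nonsing_inv_nonsing_inv _ ((isUnit_iff_isUnit_det _).mp (isUnit_one_sub_of_skew hA)), ← h2,
      nonsing_inv_nonsing_inv _ ((isUnit_iff_isUnit_det _).mp (isUnit_one_sub_of_skew hB))]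
  exact sub_right_injective h3

/-- The inverse Cayley transform `(Q - 1) (Q + 1)⁻¹`. -/
noncomputable def invCayley (Q : Matrix (Fin p) (Fin p) ℝ) : Matrix (Fin p) (Fin p) ℝ :=
  (Q - 1) * (Q + 1)⁻¹

theorem invCayley_skew {Q : Matrix (Fin p) (Fin p) ℝ} (hQ : Qᵀ * Q = 1) (hu : IsUnit (Q + 1)) :
    (invCayley Q)ᵀ = -invCayley Q := by
  have hd := (isUnit_iff_isUnit_det _).mp hu
  have h1 : invCayley Q * (Q + 1) = Q - 1 := by
    rw [invCayley, mul_assoc, nonsing_inv_mul _ hd, mul_one]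
  have h2 : (Q + 1)ᵀ * (invCayley Q)ᵀ = Qᵀ - 1 := by
    rw [← transpose_mul, h1, transpose_sub, transpose_one]
  -- Congruence by the invertible `Q + 1` clears the inverses, leaving `2 (QᵀQ - 1)`.
  have h3 : (Q + 1)ᵀ * ((invCayley Q)ᵀ + invCayley Q) * (Q + 1) = 0 := by
    rw [mul_add _ (invCayley Q)ᵀ, h2, add_mul, mul_assoc _ (invCayley Q), h1, transpose_add, transpose_one,
      sub_mul, mul_add, hQ, add_mul, mul_sub, hQ]
    noncomm_ring
  have hut : IsUnit (Q + 1)ᵀ := by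
    rw [isUnit_iff_isUnit_det, det_transpose]
    exact hd
  have h4 := hu.mul_right_cancel (h3.trans (zero_mul _).symm)
  exact eq_neg_of_add_eq_zero_left (hut.mul_left_cancel (h4.trans (mul_zero _).symm))

theorem cayley_invCayley {Q : Matrix (Fin p) (Fin p) ℝ} (hQ : Qᵀ * Q = 1) (hu : IsUnit (Q + 1)) :
    cayley (invCayley Q) = Q := by
  have hd := (isUnit_iff_isUnit_det _).mp hu
  have hA := invCayley_skew hQ hu
  have h1 : (1 - invCayley Q) * (Q + 1) = (2 : ℝ) • 1 := by
    rw [sub_mul, one_mul, invCayley, mul_assoc, nonsing_inv_mul _ hd, mul_one, two_smul]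
    abel
  have h2 : (1 - invCayley Q) * ((cayley (invCayley Q) + 1)) = (1 - invCayley Q) * (Q + 1) := by
    rw [h1, cayley_add_one hA, mul_smul_comm,
      mul_nonsing_inv _ ((isUnit_iff_isUnit_det _).mp (isUnit_one_sub_of_skew hA))]
  exact add_right_cancel ((isUnit_one_sub_of_skew hA).mul_left_cancel h2)

/-- The coordinates of the inverse Cayley transform. -/
noncomputable def frameCoord (Q : Matrix (Fin p) (Fin p) ℝ) (a : UpperIndex p) : ℝ :=
  invCayley Q a.1.1 a.1.2

theorem cayley_frameCoord {Q : Matrix (Fin p) (Fin p) ℝ} (hQ : Qᵀ * Q = 1) (hu : IsUnit (Q + 1)) :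
    cayley (skewOf (frameCoord Q)) = Q := by
  have : skewOf (frameCoord Q) = invCayley Q := skewOf_upper (invCayley_skew hQ hu)
  rw [this, cayley_invCayley hQ hu]

/-- The sign vectors. -/
noncomputable def signs (p : ℕ) : Finset (Fin p → ℝ) := Fintype.piFinset fun _ => {1, -1}

theorem mem_signs {ε : Fin p → ℝ} : ε ∈ signs p ↔ ∀ i, ε i = 1 ∨ ε i = -1 := by
  simp [signs]

theorem mul_self_of_mem_signs {ε : Fin p → ℝ} (h : ε ∈ signs p) (i : Fin p) : ε i * ε i = 1 := by
  rcases mem_signs.mp h i with h | h <;> simp [h]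

theorem diagonal_mul_self_of_mem_signs {ε : Fin p → ℝ} (h : ε ∈ signs p) :
    diagonal ε * diagonal ε = 1 := by
  rw [diagonal_mul_diagonal, ← diagonal_one]
  congr 1
  ext i
  exact mul_self_of_mem_signs h i

/-- In the Leibniz expansion, a permutation moving some `i` contributes a factor linear in `ε i`,
which cancels over the two signs; each index of the identity contributes `2`. The sum being nonzero,
some choice of signs gives a nonzero determinant. -/
theorem sum_signs_det (Q : Matrix (Fin p) (Fin p) ℝ) :
    ∑ ε ∈ signs p, (∏ i, ε i) * (Q + diagonal ε).det = 2 ^ p := by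
  have h : ∀ σ : Equiv.Perm (Fin p), ∑ ε ∈ signs p, ∏ i, ε i * (Q + diagonal ε) (σ i) i =
      if σ = 1 then 2 ^ p else 0 := by
    intro σ
    have h1 : ∀ ε ∈ signs p, ∏ i, ε i * (Q + diagonal ε) (σ i) i =
        ∏ i, (fun i (x : ℝ) => x * Q (σ i) i + if σ i = i then 1 else 0) i (ε i) := by
      intro ε hε
      refine Finset.prod_congr rfl fun i _ => ?_
      by_cases hi : σ i = i
      · simp [hi, mul_add, mul_self_of_mem_signs hε]
      · simp [hi]
    rw [Finset.sum_congr rfl h1, signs,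
      ← Finset.prod_univ_sum (fun _ : Fin p => ({1, -1} : Finset ℝ))
        fun i (x : ℝ) => x * Q (σ i) i + if σ i = i then 1 else 0]
    have h2 : ∀ i, ∑ x ∈ ({1, -1} : Finset ℝ), (x * Q (σ i) i + if σ i = i then 1 else 0) =
        if σ i = i then 2 else 0 := by
      intro i
      rw [Finset.sum_pair (by norm_num)]
      split_ifs <;> ring
    simp only [h2]
    split_ifs with hσ
    · simp [hσ]
    · obtain ⟨i, hi⟩ : ∃ i, σ i ≠ i := by
        by_contra! hc
        exact hσ (Equiv.ext hc)
      exact Finset.prod_eq_zero (Finset.mem_univ i) (if_neg hi)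
  simp only [det_apply', Finset.mul_sum]
  rw [Finset.sum_comm]
  have h3 : ∀ σ : Equiv.Perm (Fin p), ∑ ε ∈ signs p, (∏ i, ε i) *
      (((Equiv.Perm.sign σ : ℤ) : ℝ) * ∏ i, (Q + diagonal ε) (σ i) i) =
      if σ = 1 then 2 ^ p else 0 := by
    intro σ
    have h4 : ∀ ε ∈ signs p, (∏ i, ε i) * (((Equiv.Perm.sign σ : ℤ) : ℝ) *
        ∏ i, (Q + diagonal ε) (σ i) i) =
        ((Equiv.Perm.sign σ : ℤ) : ℝ) * ∏ i, ε i * (Q + diagonal ε) (σ i) i := by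
      intro ε _
      rw [mul_left_comm, Finset.prod_mul_distrib]
    rw [Finset.sum_congr rfl h4, ← Finset.mul_sum, h]
    split_ifs with hσ <;> simp [hσ]
  simp only [h3, Finset.sum_ite_eq', Finset.mem_univ, if_true]

/-- Flipping signs of columns brings any matrix into the domain of the inverse Cayley transform, so
for eigenvector matrices no exceptional set has to be discarded. -/
theorem exists_signs_isUnit (Q : Matrix (Fin p) (Fin p) ℝ) :
    ∃ ε ∈ signs p, IsUnit (Q * diagonal ε + 1) := by
  obtain ⟨ε, hε, h⟩ := Finset.exists_ne_zero_of_sum_ne_zero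
    ((sum_signs_det Q).trans_ne (by positivity))
  refine ⟨ε, hε, ?_⟩
  have h1 : Q * diagonal ε + 1 = (Q + diagonal ε) * diagonal ε := by
    rw [add_mul, diagonal_mul_self_of_mem_signs hε]
  rw [h1, isUnit_iff_isUnit_det, det_mul, isUnit_iff_ne_zero, det_diagonal, mul_comm]
  exact h

end Cayley

/-! ### The spectral parametrization and its Jacobian. -/

section SpectralMap

variable {p : ℕ}

/-- The coordinates of the symmetric matrix with eigenvalues `z.1` and eigenvectors given by the
Cayley transform of the skew-symmetric matrix with entries `z.2`. -/
noncomputable def spectralMap (z : SymCoord p) : SymCoord p :=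
  coordOf (cayley (skewOf z.2) * diagonal z.1 * (cayley (skewOf z.2))ᵀ)

theorem symOf_spectralMap (z : SymCoord p) :
    symOf (spectralMap z) = cayley (skewOf z.2) * diagonal z.1 * (cayley (skewOf z.2))ᵀ :=
  symOf_coordOf (isHermitian_conj_diagonal _ _)

section NormedAlgebra

variable {E R : Type*} [NormedAddCommGroup E] [NormedSpace ℝ E] [NormedRing R] [NormedAlgebra ℝ R]

/-- Stated existentially so that a derivative is used only through its values. -/
theorem exists_hasFDerivAt_mul {M N : E → R} {M' N' : E →L[ℝ] R} {z : E}
    (hM : HasFDerivAt M M' z) (hN : HasFDerivAt N N' z) :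
    ∃ L : E →L[ℝ] R, HasFDerivAt (fun w => M w * N w) L z ∧
      ∀ y, L y = M z * N' y + M' y * N z :=
  ⟨_, hM.mul' hN, fun y => by simp⟩

theorem exists_hasFDerivAt_ringInverse [HasSummableGeomSeries R] {M : E → R} {M' : E →L[ℝ] R}
    {z : E} (hM : HasFDerivAt M M' z) (hu : IsUnit (M z)) :
    ∃ L : E →L[ℝ] R, HasFDerivAt (fun w => Ring.inverse (M w)) L z ∧
      ∀ y, L y = -(Ring.inverse (M z) * M' y * Ring.inverse (M z)) := by
  obtain ⟨u, hu⟩ := hu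
  have hI := hasFDerivAt_ringInverse (𝕜 := ℝ) u
  rw [hu] at hI
  refine ⟨_, hI.comp z hM, fun y => ?_⟩
  simp [← hu]

end NormedAlgebra

section Derivative

open scoped Matrix.Norms.Operator

theorem hasFDerivAt_inv_one_sub_skewOf (z : SymCoord p) :
    ∃ L : SymCoord p →L[ℝ] Matrix (Fin p) (Fin p) ℝ,
      HasFDerivAt (fun w : SymCoord p => (1 - skewOf w.2)⁻¹) L z ∧
      ∀ y, L y = (1 - skewOf z.2)⁻¹ * skewOf y.2 * (1 - skewOf z.2)⁻¹ := by
  have hA : HasFDerivAt (fun w : SymCoord p => 1 - skewOf w.2)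
      (-(skewOf ∘ₗ LinearMap.snd ℝ (Fin p → ℝ) (UpperIndex p → ℝ)).toContinuousLinearMap) z :=
    ((skewOf ∘ₗ LinearMap.snd ℝ (Fin p → ℝ)
      (UpperIndex p → ℝ)).toContinuousLinearMap.hasFDerivAt).const_sub 1
  obtain ⟨L, hL, hL'⟩ := exists_hasFDerivAt_ringInverse hA
    (isUnit_one_sub_of_skew (skewOf_transpose z.2))
  simp only [← nonsing_inv_eq_ringInverse] at hL hL'
  refine ⟨L, hL, fun y => ?_⟩
  refine (hL' y).trans ?_
  change -((1 - skewOf z.2)⁻¹ * -skewOf y.2 * (1 - skewOf z.2)⁻¹) = _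
  rw [mul_neg, neg_mul, neg_neg]

theorem hasFDerivAt_cayley_skewOf (z : SymCoord p) :
    ∃ L : SymCoord p →L[ℝ] Matrix (Fin p) (Fin p) ℝ,
      HasFDerivAt (fun w : SymCoord p => cayley (skewOf w.2)) L z ∧
      ∀ y, L y = (2 : ℝ) • ((1 - skewOf z.2)⁻¹ * skewOf y.2 * (1 - skewOf z.2)⁻¹) := by
  obtain ⟨L, hL, hL'⟩ := hasFDerivAt_inv_one_sub_skewOf z
  have h := (hL.const_smul (2 : ℝ)).sub_const 1
  have he : (fun w : SymCoord p => (2 : ℝ) • (1 - skewOf w.2)⁻¹ - 1) =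
      fun w => cayley (skewOf w.2) := by
    ext1 w
    rw [← cayley_add_one (skewOf_transpose w.2), add_sub_cancel_right]
  refine ⟨(2 : ℝ) • L, he ▸ h, fun y => ?_⟩
  rw [← hL' y]
  rfl

/-- Writing `dC = C Ω` with `Ω` skew, the product rule gives `d(C Λ C') = C (Ω Λ - Λ Ω + dΛ) C'`.
Here `Ω = 2 B' dA B` with `B = (1 - A)⁻¹`, by `cayley_transpose_mul_inv`. -/
theorem exists_hasFDerivAt_spectralMap (z : SymCoord p) :
    ∃ L : SymCoord p →L[ℝ] SymCoord p, HasFDerivAt spectralMap L z ∧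
      ∀ y, L y = coordOf (cayley (skewOf z.2) *
        ((2 : ℝ) • (((1 - skewOf z.2)⁻¹)ᵀ * skewOf y.2 * (1 - skewOf z.2)⁻¹) * diagonal z.1 -
          diagonal z.1 * (2 : ℝ) • (((1 - skewOf z.2)⁻¹)ᵀ * skewOf y.2 * (1 - skewOf z.2)⁻¹) +
          diagonal y.1) * (cayley (skewOf z.2))ᵀ) := by
  obtain ⟨C, hC, hC'⟩ := hasFDerivAt_cayley_skewOf z
  have hD : HasFDerivAt (fun w : SymCoord p => diagonal w.1)
      (diagonalLinearMap (Fin p) ℝ ℝ ∘ₗ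
        LinearMap.fst ℝ (Fin p → ℝ) (UpperIndex p → ℝ)).toContinuousLinearMap z :=
    (diagonalLinearMap (Fin p) ℝ ℝ ∘ₗ
      LinearMap.fst ℝ (Fin p → ℝ) (UpperIndex p → ℝ)).toContinuousLinearMap.hasFDerivAt
  have hT : HasFDerivAt (fun w : SymCoord p => (cayley (skewOf w.2))ᵀ)
      ((transposeLinearEquiv (Fin p) (Fin p) ℝ ℝ).toLinearMap.toContinuousLinearMap.comp C) z :=
    (transposeLinearEquiv (Fin p) (Fin p) ℝ
      ℝ).toLinearMap.toContinuousLinearMap.hasFDerivAt.comp z hC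
  obtain ⟨L₁, hL₁, hL₁'⟩ := exists_hasFDerivAt_mul hC hD
  obtain ⟨L₂, hL₂, hL₂'⟩ := exists_hasFDerivAt_mul hL₁ hT
  refine ⟨(coordOf (p := p)).toContinuousLinearMap.comp L₂,
    (coordOf (p := p)).toContinuousLinearMap.hasFDerivAt.comp z hL₂, fun y => ?_⟩
  have hskew := skewOf_transpose z.2
  have hO : cayley (skewOf z.2) * (cayley (skewOf z.2))ᵀ = 1 :=
    mul_eq_one_comm.mp (cayley_transpose_mul_self hskew)
  have hΩ : C y = cayley (skewOf z.2) *
      (2 : ℝ) • (((1 - skewOf z.2)⁻¹)ᵀ * skewOf y.2 * (1 - skewOf z.2)⁻¹) := by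
    rw [hC', mul_smul_comm, ← cayley_transpose_mul_inv hskew, ← mul_assoc, ← mul_assoc,
      ← mul_assoc, hO, one_mul]
  have hΩt : (C y)ᵀ = -((2 : ℝ) • (((1 - skewOf z.2)⁻¹)ᵀ * skewOf y.2 * (1 - skewOf z.2)⁻¹) *
      (cayley (skewOf z.2))ᵀ) := by
    rw [hΩ, transpose_mul, transpose_smul, transpose_mul, transpose_mul, transpose_transpose,
      skewOf_transpose, ← neg_mul]
    congr 1
    rw [← smul_neg, mul_assoc, neg_mul, mul_neg]
  set Ω := (2 : ℝ) • (((1 - skewOf z.2)⁻¹)ᵀ * skewOf y.2 * (1 - skewOf z.2)⁻¹)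
  have h1 : L₂ y = cayley (skewOf z.2) * (Ω * diagonal z.1 - diagonal z.1 * Ω + diagonal y.1) *
      (cayley (skewOf z.2))ᵀ := by
    have h2 : L₂ y = cayley (skewOf z.2) * diagonal z.1 * (C y)ᵀ +
        (cayley (skewOf z.2) * diagonal y.1 + C y * diagonal z.1) * (cayley (skewOf z.2))ᵀ :=
      (hL₂' y).trans (congrArg (fun K => cayley (skewOf z.2) * diagonal z.1 * (C y)ᵀ +
        K * (cayley (skewOf z.2))ᵀ) (hL₁' y))
    refine h2.trans ?_
    rw [hΩt, hΩ]
    noncomm_ring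
  exact congrArg coordOf h1

end Derivative

/-- Conjugation of symmetric matrices, in coordinates. -/
noncomputable def conjCoord (O : Matrix (Fin p) (Fin p) ℝ) : SymCoord p →ₗ[ℝ] SymCoord p :=
  coordOf ∘ₗ LinearMap.mulRight ℝ Oᵀ ∘ₗ LinearMap.mulLeft ℝ O ∘ₗ symOf

/-- Multiplication of the entries above the diagonal by the eigenvalue gaps. -/
noncomputable def gapMap (α : Fin p → ℝ) : SymCoord p →ₗ[ℝ] SymCoord p :=
  LinearMap.id.prodMap (toLin' (diagonal fun a : UpperIndex p => α a.1.2 - α a.1.1))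

/-- The infinitesimal motion of the eigenvalues and of the eigenvector frame. -/
noncomputable def frameMap (B : Matrix (Fin p) (Fin p) ℝ) : SymCoord p →ₗ[ℝ] SymCoord p :=
  ((√2)⁻¹ • LinearMap.id).prodMap ((LinearMap.snd ℝ (Fin p → ℝ) (UpperIndex p → ℝ) ∘ₗ coordOf) ∘ₗ
    ((2 : ℝ) • (LinearMap.mulRight ℝ B ∘ₗ LinearMap.mulLeft ℝ Bᵀ ∘ₗ skewOf)))

theorem det_gapMap (α : Fin p → ℝ) :
    LinearMap.det (gapMap α) = ∏ a : UpperIndex p, (α a.1.2 - α a.1.1) := by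
  rw [gapMap, LinearMap.det_prodMap, LinearMap.det_id, one_mul, LinearMap.det_toLin', det_diagonal]

/-- The commutator of `Ω` with `diagonal α` has entries `(α j - α i) Ω i j`: zero on the diagonal,
gaps times `Ω` off it. This factors the derivative into three maps, of which only `gapMap` involves
the eigenvalues. -/
theorem conjCoord_gapMap_frameMap (O B : Matrix (Fin p) (Fin p) ℝ) (α : Fin p → ℝ)
    (y : SymCoord p) : conjCoord O (gapMap α (frameMap B y)) =
      coordOf (O * ((2 : ℝ) • (Bᵀ * skewOf y.2 * B) * diagonal α -
        diagonal α * (2 : ℝ) • (Bᵀ * skewOf y.2 * B) + diagonal y.1) * Oᵀ) := by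
  set Ω := (2 : ℝ) • (Bᵀ * skewOf y.2 * B) with hΩ
  have hskew : ∀ i j, Ω j i = -Ω i j := fun i j => by
    have : Ωᵀ = -Ω := by
      rw [hΩ, transpose_smul, transpose_mul, transpose_mul, skewOf_transpose, transpose_transpose,
        ← smul_neg, neg_mul, mul_neg, mul_assoc]
    exact congrFun (congrFun this i) j
  have h1 : (gapMap α (frameMap B y)).1 = (√2)⁻¹ • y.1 := rfl
  have h2 : ∀ a, (gapMap α (frameMap B y)).2 a = (α a.1.2 - α a.1.1) * Ω a.1.1 a.1.2 := by
    intro a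
    have : (gapMap α (frameMap B y)).2 = toLin' (diagonal fun a : UpperIndex p =>
        α a.1.2 - α a.1.1) (coordOf Ω).2 := rfl
    rw [this, toLin'_apply, mulVec_diagonal, coordOf_snd]
  have h3 : symOf (gapMap α (frameMap B y)) = Ω * diagonal α - diagonal α * Ω + diagonal y.1 := by
    refine ext_of_upper (fun i => ?_) (fun a => ?_) fun a => ?_
    · rw [symOf_diag, h1]
      simp [mul_comm]
    · rw [symOf_upper, h2]
      simp [a.2.ne]
      ring
    · rw [symOf_lower, h2]
      simp [a.2.ne', hskew a.1.1 a.1.2]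
      ring
  rw [← h3]
  rfl

theorem exists_measurable_abs_det_fderiv (p : ℕ) :
    ∃ h : (UpperIndex p → ℝ) → ℝ, Measurable h ∧ (∀ a, 0 ≤ h a) ∧ ∀ z : SymCoord p,
      |(fderiv ℝ spectralMap z).det| = |∏ a : UpperIndex p, (z.1 a.1.2 - z.1 a.1.1)| * h z.2 := by
  have hdet : ∀ z : SymCoord p, |(fderiv ℝ spectralMap z).det| =
      |∏ a : UpperIndex p, (z.1 a.1.2 - z.1 a.1.1)| *
        (|LinearMap.det (conjCoord (cayley (skewOf z.2)))| *
          |LinearMap.det (frameMap (1 - skewOf z.2)⁻¹)|) := by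
    intro z
    obtain ⟨L, hL, hL'⟩ := exists_hasFDerivAt_spectralMap z
    have : (L : SymCoord p →ₗ[ℝ] SymCoord p) = conjCoord (cayley (skewOf z.2)) ∘ₗ gapMap z.1 ∘ₗ
        frameMap (1 - skewOf z.2)⁻¹ := by
      refine LinearMap.ext fun y => ?_
      rw [ContinuousLinearMap.coe_coe, hL', LinearMap.comp_apply, LinearMap.comp_apply,
        conjCoord_gapMap_frameMap]
    rw [hL.fderiv, ContinuousLinearMap.det, this, LinearMap.det_comp, LinearMap.det_comp,
      det_gapMap, abs_mul, abs_mul]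
    ring
  -- The frame factor is recovered by dividing the Jacobian at one fixed `α` with distinct entries
  -- by its gap product; its measurability then follows from that of `fderiv`.
  let α : Fin p → ℝ := fun i => (i : ℕ)
  have hα : |∏ a : UpperIndex p, (α a.1.2 - α a.1.1)| ≠ 0 := by
    rw [abs_ne_zero, Finset.prod_ne_zero_iff]
    intro a _
    rw [sub_ne_zero]
    simpa [α, Fin.ext_iff] using a.2.ne'
  refine ⟨fun a => |(fderiv ℝ spectralMap ((α, a) : SymCoord p)).det| /
    |∏ a : UpperIndex p, (α a.1.2 - α a.1.1)|, ?_, fun a => by positivity, fun z => ?_⟩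
  · refine Measurable.div_const (Measurable.abs ?_) _
    exact ContinuousLinearMap.continuous_det.measurable.comp
      ((measurable_fderiv ℝ spectralMap).comp measurable_prodMk_left)
  · dsimp only
    rw [hdet, hdet, mul_div_cancel_left₀ _ hα]

end SpectralMap

/-! ### A fundamental domain for the signs of the eigenvectors. -/

section FrameDomain

variable {p : ℕ}

theorem orderedEigenvalues_symOf_spectralMap {z : SymCoord p} (hz : Antitone z.1) :
    orderedEigenvalues (symOf (spectralMap z)) = z.1 := by
  rw [symOf_spectralMap,
    orderedEigenvalues_conj_diagonal (cayley_transpose_mul_self (skewOf_transpose _)) hz]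

theorem isUnit_cayley_skewOf_add_one (a : UpperIndex p → ℝ) :
    IsUnit (cayley (skewOf a) + 1) := by
  have hA := skewOf_transpose a
  have hu := (isUnit_iff_isUnit_det _).mp (isUnit_one_sub_of_skew hA)
  rw [cayley_add_one hA]
  exact .of_mul_eq_one ((2 : ℝ)⁻¹ • (1 - skewOf a)) (by
    rw [smul_mul_smul_comm, nonsing_inv_mul _ hu, mul_inv_cancel₀ two_ne_zero, one_smul])

theorem frameCoord_cayley_skewOf (a : UpperIndex p → ℝ) : frameCoord (cayley (skewOf a)) = a :=
  skewOf_injective <| cayley_injOn (skewOf_transpose _) (skewOf_transpose _) <|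
    cayley_frameCoord (cayley_transpose_mul_self (skewOf_transpose a))
      (isUnit_cayley_skewOf_add_one a)

/-- `Oᵀ O'` commutes with a diagonal matrix with distinct entries, so it is diagonal; being
orthogonal, its entries are signs. -/
theorem exists_signs_of_conj_diagonal_eq {O O' : Matrix (Fin p) (Fin p) ℝ} (hO : Oᵀ * O = 1)
    (hO' : O'ᵀ * O' = 1) {α : Fin p → ℝ} (hα : StrictAnti α)
    (h : O * diagonal α * Oᵀ = O' * diagonal α * O'ᵀ) :
    ∃ ε ∈ signs p, O' = O * diagonal ε := by
  have hW : (Oᵀ * O') * diagonal α = diagonal α * (Oᵀ * O') := by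
    calc (Oᵀ * O') * diagonal α = Oᵀ * (O' * diagonal α * O'ᵀ) * O' := by
          simp only [mul_assoc, hO', mul_one]
      _ = (Oᵀ * O) * diagonal α * (Oᵀ * O') := by
          rw [← h]
          simp only [mul_assoc]
      _ = _ := by rw [hO, one_mul]
  have hd : Oᵀ * O' = diagonal fun i => (Oᵀ * O') i i := by
    ext i j
    by_cases hij : i = j
    · simp [hij]
    · have := congrFun (congrFun hW i) j
      rw [mul_diagonal, diagonal_mul, mul_comm, ← sub_eq_zero, ← sub_mul, mul_eq_zero,
        sub_eq_zero] at this
      rw [diagonal_apply_ne _ hij]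
      exact this.resolve_left fun h => hij (hα.injective h).symm
  refine ⟨fun i => (Oᵀ * O') i i, mem_signs.mpr fun i => ?_, ?_⟩
  · have h1 : (Oᵀ * O')ᵀ * (Oᵀ * O') = 1 := by
      rw [transpose_mul, transpose_transpose, mul_assoc, ← mul_assoc O, mul_eq_one_comm.mp hO,
        one_mul, hO']
    rw [hd, diagonal_transpose, diagonal_mul_diagonal] at h1
    have h2 := congrFun (congrFun h1 i) i
    rw [diagonal_apply_eq, one_apply_eq] at h2
    exact mul_self_eq_one_iff.mp h2
  · rw [← hd, ← mul_assoc, mul_eq_one_comm.mp hO, one_mul]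

/-- A set of Cayley coordinates containing exactly one representative of every orthogonal matrix
up to signs of the columns. -/
def frameDomain (p : ℕ) : Set (UpperIndex p → ℝ) :=
  {a | ∀ ε ∈ signs p, (cayley (skewOf a) * diagonal ε + 1).det ≠ 0 →
    embeddingReal _ a ≤ embeddingReal _ (frameCoord (cayley (skewOf a) * diagonal ε))}

theorem exists_mem_frameDomain (w : SymCoord p) :
    ∃ a ∈ frameDomain p, spectralMap (orderedEigenvalues (symOf w), a) = w := by
  classical
  obtain ⟨Q, hQ, hw⟩ := exists_diagonalization (symOf_isHermitian w)
  have horth : ∀ ε ∈ signs p, (Q * diagonal ε)ᵀ * (Q * diagonal ε) = 1 := by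
    intro ε hε
    rw [transpose_mul, diagonal_transpose, mul_assoc, ← mul_assoc Qᵀ, hQ, one_mul,
      diagonal_mul_self_of_mem_signs hε]
  obtain ⟨ε₁, hε₁, hu₁⟩ := exists_signs_isUnit Q
  -- Among the finitely many admissible sign changes, take the one whose coordinates have the least
  -- code under the measurable injection `embeddingReal` into `ℝ`.
  obtain ⟨ε, hε, hmin⟩ := Finset.exists_min_image
    ((signs p).filter fun ε => (Q * diagonal ε + 1).det ≠ 0)
    (fun ε => embeddingReal _ (frameCoord (Q * diagonal ε)))
    ⟨ε₁, Finset.mem_filter.mpr ⟨hε₁, ((isUnit_iff_isUnit_det _).mp hu₁).ne_zero⟩⟩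
  obtain ⟨hεs, hεu⟩ := Finset.mem_filter.mp hε
  have hu : IsUnit (Q * diagonal ε + 1) :=
    (isUnit_iff_isUnit_det _).mpr (isUnit_iff_ne_zero.mpr hεu)
  have hc := cayley_frameCoord (horth ε hεs) hu
  refine ⟨frameCoord (Q * diagonal ε), fun ε' hε' hu' => ?_, ?_⟩
  · rw [hc, mul_assoc, diagonal_mul_diagonal] at hu' ⊢
    refine hmin _ (Finset.mem_filter.mpr ⟨mem_signs.mpr fun i => ?_, hu'⟩)
    rw [← mul_self_eq_one_iff, mul_mul_mul_comm, mul_self_of_mem_signs hεs,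
      mul_self_of_mem_signs hε', one_mul]
  · have h1 : Q * diagonal ε * diagonal (orderedEigenvalues (symOf w)) * (Q * diagonal ε)ᵀ =
        symOf w := by
      conv_rhs => rw [hw]
      have : diagonal ε * diagonal (orderedEigenvalues (symOf w)) * diagonal ε =
          diagonal (orderedEigenvalues (symOf w)) := by
        rw [diagonal_mul_diagonal, diagonal_mul_diagonal]
        congr 1
        ext i
        rw [mul_right_comm, mul_self_of_mem_signs hεs, one_mul]
      rw [transpose_mul, diagonal_transpose, ← mul_assoc, mul_assoc Q, mul_assoc Q, this]
    rw [spectralMap, hc, h1, coordOf_symOf]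

theorem injOn_spectralMap :
    Set.InjOn spectralMap ({α : Fin p → ℝ | StrictAnti α} ×ˢ frameDomain p) := by
  rintro ⟨α, a⟩ ⟨hα, ha⟩ ⟨β, b⟩ ⟨hβ, hb⟩ h
  have hα' : StrictAnti α := hα
  have hβ' : StrictAnti β := hβ
  have hαβ : α = β := by
    have h1 := orderedEigenvalues_symOf_spectralMap (z := (α, a)) hα'.antitone
    rw [h, orderedEigenvalues_symOf_spectralMap (z := (β, b)) hβ'.antitone] at h1
    exact h1.symm
  subst hαβ
  -- Two frames of one matrix with simple spectrum differ by signs, so each is a competitor in the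
  -- minimality of the other; equal codes then give equal coordinates.
  have hle : ∀ {a b : UpperIndex p → ℝ}, a ∈ frameDomain p →
      spectralMap (α, a) = spectralMap (α, b) → embeddingReal _ a ≤ embeddingReal _ b := by
    intro a b ha hab
    have h1 := congrArg symOf hab
    rw [symOf_spectralMap, symOf_spectralMap] at h1
    obtain ⟨ε, hε, hOε⟩ := exists_signs_of_conj_diagonal_eq
      (cayley_transpose_mul_self (skewOf_transpose a))
      (cayley_transpose_mul_self (skewOf_transpose b)) hα' h1
    have h2 := ha ε hε
    rw [← hOε, frameCoord_cayley_skewOf] at h2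
    exact h2 ((isUnit_iff_isUnit_det _).mp (isUnit_cayley_skewOf_add_one b)).ne_zero
  exact congrArg (Prod.mk α)
    ((measurableEmbedding_embeddingReal _).injective (le_antisymm (hle ha h) (hle hb h.symm)))

section Measurability

variable {E : Type*} [MeasurableSpace E] {M N : E → Matrix (Fin p) (Fin p) ℝ}

theorem measurable_matrix_mul (hM : ∀ i j, Measurable fun x => M x i j)
    (hN : ∀ i j, Measurable fun x => N x i j) (i j : Fin p) :
    Measurable fun x => (M x * N x) i j := by
  simp only [mul_apply]
  exact Finset.measurable_sum _ fun k _ => (hM i k).mul (hN k j)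

theorem measurable_matrix_det (hM : ∀ i j, Measurable fun x => M x i j) :
    Measurable fun x => (M x).det := by
  simp only [det_apply']
  exact Finset.measurable_sum _ fun σ _ =>
    (Finset.measurable_prod _ fun i _ => hM (σ i) i).const_mul _

/-- By Cramer's rule the entries of the inverse are quotients of determinants, also for singular
matrices since the inverse of `0` is `0`. -/
theorem measurable_matrix_inv (hM : ∀ i j, Measurable fun x => M x i j) (i j : Fin p) :
    Measurable fun x => (M x)⁻¹ i j := by
  have h : ∀ x, (M x)⁻¹ i j = (M x).det⁻¹ * ((M x).updateRow j (Pi.single i 1)).det := fun x => by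
    rw [inv_def, Ring.inverse_eq_inv', Matrix.smul_apply, smul_eq_mul, adjugate_apply]
  simp only [h]
  refine (measurable_matrix_det hM).inv.mul (measurable_matrix_det fun k l => ?_)
  simp only [updateRow_apply]
  split_ifs
  · exact measurable_const
  · exact hM k l

theorem measurable_cayley (hM : ∀ i j, Measurable fun x => M x i j) (i j : Fin p) :
    Measurable fun x => cayley (M x) i j :=
  measurable_matrix_mul (measurable_matrix_inv fun i j => measurable_const.sub (hM i j))
    (fun i j => measurable_const.add (hM i j)) i j

theorem measurable_frameCoord (hM : ∀ i j, Measurable fun x => M x i j) :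
    Measurable fun x => frameCoord (M x) :=
  measurable_pi_lambda _ fun a => measurable_matrix_mul
    (fun i j => (hM i j).sub measurable_const)
    (measurable_matrix_inv fun i j => (hM i j).add measurable_const) a.1.1 a.1.2

end Measurability

theorem measurableSet_frameDomain : MeasurableSet (frameDomain p) := by
  have hM : ∀ (ε : Fin p → ℝ) (i j : Fin p), Measurable fun a : UpperIndex p → ℝ =>
      (cayley (skewOf a) * diagonal ε) i j := fun ε =>
    measurable_matrix_mul (measurable_cayley fun i j =>
      (continuous_skewOf.matrix_elem i j).measurable) fun i j => measurable_const
  simp only [frameDomain, Set.ofPred_forall]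
  refine Finset.measurableSet_biInter _ fun ε _ => ?_
  have h1 : MeasurableSet {a : UpperIndex p → ℝ | (cayley (skewOf a) * diagonal ε + 1).det ≠ 0} :=
    measurable_matrix_det (fun i j => (hM ε i j).add measurable_const)
      (measurableSet_singleton (0 : ℝ)).compl
  have h2 : MeasurableSet {a : UpperIndex p → ℝ |
      embeddingReal _ a ≤ embeddingReal _ (frameCoord (cayley (skewOf a) * diagonal ε))} :=
    measurableSet_le (measurable_embeddingReal _)
      ((measurable_embeddingReal _).comp (measurable_frameCoord (hM ε)))
  convert h1.compl.union h2 using 1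
  ext a
  simp [imp_iff_not_or]

end FrameDomain

/-! ### The joint density of the eigenvalues. -/

section EigenvalueDensity

variable {p : ℕ}

theorem measurable_orderedEigenvalues_symOf :
    Measurable fun w : SymCoord p => orderedEigenvalues (symOf w) :=
  (continuous_orderedEigenvalues_comp continuous_symOf symOf_isHermitian).measurable

theorem measurableSet_strictAnti : MeasurableSet {α : Fin p → ℝ | StrictAnti α} := by
  simp only [StrictAnti, Set.ofPred_forall]
  exact .iInter fun i => .iInter fun j => .iInter fun _ =>
    measurableSet_lt (measurable_pi_apply j) (measurable_pi_apply i)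

theorem measurableSet_antitone : MeasurableSet {α : Fin p → ℝ | Antitone α} := by
  simp only [Antitone, Set.ofPred_forall]
  exact .iInter fun i => .iInter fun j => .iInter fun _ =>
    measurableSet_le (measurable_pi_apply j) (measurable_pi_apply i)

theorem prod_upperIndex (g : Fin p → Fin p → ℝ) :
    ∏ a : UpperIndex p, g a.1.1 a.1.2 = ∏ k, ∏ j ∈ Finset.Ioi k, g k j := by
  have h : ∀ k, ∏ j ∈ Finset.Ioi k, g k j = ∏ j, if k < j then g k j else 1 := fun k => by
    rw [← Finset.prod_filter]
    congr 1
    ext j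
    simp
  simp only [h]
  rw [← Fintype.prod_prod_type' (f := fun k j => if k < j then g k j else 1),
    ← Finset.prod_filter]
  exact (Finset.prod_subtype (f := fun a : Fin p × Fin p => g a.1 a.2) _ (by simp)).symm

theorem abs_prod_gap {α : Fin p → ℝ} (hα : Antitone α) :
    |∏ a : UpperIndex p, (α a.1.2 - α a.1.1)| = ∏ k, ∏ j ∈ Finset.Ioi k, (α k - α j) := by
  rw [← prod_upperIndex fun k j => α k - α j, Finset.abs_prod]
  refine Finset.prod_congr rfl fun a _ => ?_
  rw [abs_sub_comm, abs_of_nonneg (sub_nonneg.mpr (hα a.2.le))]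

theorem prod_gap_eq_zero {α : Fin p → ℝ} (hα : Antitone α) (h : ¬StrictAnti α) :
    ∏ a : UpperIndex p, (α a.1.2 - α a.1.1) = 0 := by
  simp only [StrictAnti, not_forall, not_lt] at h
  obtain ⟨i, j, hij, h⟩ := h
  exact Finset.prod_eq_zero (Finset.mem_univ (⟨(i, j), hij⟩ : UpperIndex p))
    (sub_eq_zero.mpr (le_antisymm (hα hij.le) h))

theorem unnormalizedDensity_of_antitone {α : Fin p → ℝ} (hα : Antitone α) :
    unnormalizedDensity α = Real.exp (-(1 / 4) * ∑ j, α j ^ 2) *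
      |∏ a : UpperIndex p, (α a.1.2 - α a.1.1)| := by
  rw [unnormalizedDensity, if_pos hα, abs_prod_gap hα]

theorem unnormalizedDensity_nonneg (α : Fin p → ℝ) : 0 ≤ unnormalizedDensity α := by
  by_cases hα : Antitone α
  · rw [unnormalizedDensity_of_antitone hα]
    positivity
  · rw [unnormalizedDensity, if_neg hα]

theorem unnormalizedDensity_of_not_strictAnti {α : Fin p → ℝ} (h : ¬StrictAnti α) :
    unnormalizedDensity α = 0 := by
  by_cases hα : Antitone α
  · rw [unnormalizedDensity_of_antitone hα, prod_gap_eq_zero hα h, abs_zero, mul_zero]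
  · rw [unnormalizedDensity, if_neg hα]

theorem measurable_unnormalizedDensity :
    Measurable (unnormalizedDensity : (Fin p → ℝ) → ℝ) :=
  Measurable.ite measurableSet_antitone (by fun_prop) measurable_const

instance : (volume : Measure (SymCoord p)).IsAddHaarMeasure :=
  Measure.prod.instIsAddHaarMeasure (volume : Measure (Fin p → ℝ))
    (volume : Measure (UpperIndex p → ℝ))

theorem hasFDerivAt_spectralMap (z : SymCoord p) :
    HasFDerivAt spectralMap (fderiv ℝ spectralMap z) z := by
  obtain ⟨L, hL, -⟩ := exists_hasFDerivAt_spectralMap z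
  exact hL.differentiableAt.hasFDerivAt

theorem image_spectralMap (B : Set (Fin p → ℝ)) :
    spectralMap '' ((B ∩ {α | StrictAnti α}) ×ˢ frameDomain p) =
      {w | orderedEigenvalues (symOf w) ∈ B ∧ StrictAnti (orderedEigenvalues (symOf w))} := by
  ext w
  constructor
  · rintro ⟨z, ⟨⟨hB, hs⟩, -⟩, rfl⟩
    have hs' : StrictAnti z.1 := hs
    rw [Set.mem_ofPred_eq, orderedEigenvalues_symOf_spectralMap hs'.antitone]
    exact ⟨hB, hs'⟩
  · rintro ⟨hB, hs⟩
    obtain ⟨a, ha, h⟩ := exists_mem_frameDomain w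
    exact ⟨(orderedEigenvalues (symOf w), a), ⟨⟨hB, hs⟩, ha⟩, h⟩

/-- Sard's argument: matrices with a repeated eigenvalue lie in the image of points where a gap, and
with it the Jacobian, vanishes. -/
theorem ae_strictAnti_orderedEigenvalues :
    ∀ᵐ w : SymCoord p, StrictAnti (orderedEigenvalues (symOf w)) := by
  obtain ⟨h, -, -, hdet⟩ := exists_measurable_abs_det_fderiv p
  refine measure_mono_null (t := spectralMap '' {z | Antitone z.1 ∧ ¬StrictAnti z.1}) ?_ ?_
  · intro w hw
    obtain ⟨a, -, ha⟩ := exists_mem_frameDomain w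
    exact ⟨(orderedEigenvalues (symOf w), a), ⟨orderedEigenvalues_antitone _, hw⟩, ha⟩
  · refine addHaar_image_eq_zero_of_det_fderivWithin_eq_zero volume
      (fun z _ => (hasFDerivAt_spectralMap z).hasFDerivWithinAt) fun z hz => ?_
    rw [← abs_eq_zero, hdet, prod_gap_eq_zero hz.1 hz.2, abs_zero, zero_mul]

/-- After the change of variables the integrand is a product, since the Frobenius norm depends on
the eigenvalues only and the Jacobian splits. The frame integral goes into `K`, whose finiteness is
not needed here. -/
theorem exists_symGaussian_orderedEigenvalues (p : ℕ) :
    ∃ K : ENNReal, ∀ B : Set (Fin p → ℝ), MeasurableSet B →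
      (symGaussian p).map (fun w => orderedEigenvalues (symOf w)) B =
        K * ∫⁻ x in B, ENNReal.ofReal (unnormalizedDensity x) := by
  obtain ⟨h, hm, h0, hdet⟩ := exists_measurable_abs_det_fderiv p
  obtain ⟨c, hc, hγ⟩ := exists_symGaussian_eq_withDensity p
  refine ⟨ENNReal.ofReal c * ∫⁻ a in frameDomain p, ENNReal.ofReal (h a), fun B hB => ?_⟩
  have hBs : MeasurableSet (B ∩ {α | StrictAnti α}) := hB.inter measurableSet_strictAnti
  have hs := hBs.prod (measurableSet_frameDomain (p := p))
  have hinj : Set.InjOn spectralMap ((B ∩ {α | StrictAnti α}) ×ˢ frameDomain p) :=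
    injOn_spectralMap.mono (Set.prod_mono_left Set.inter_subset_right)
  have hS : MeasurableSet (spectralMap '' ((B ∩ {α | StrictAnti α}) ×ˢ frameDomain p)) := by
    rw [image_spectralMap]
    exact (measurable_orderedEigenvalues_symOf hB).inter
      (measurable_orderedEigenvalues_symOf measurableSet_strictAnti)
  have hae : (fun w => orderedEigenvalues (symOf w)) ⁻¹' B =ᵐ[symGaussian p]
      spectralMap '' ((B ∩ {α | StrictAnti α}) ×ˢ frameDomain p) := by
    rw [image_spectralMap, hγ]
    filter_upwards [(withDensity_absolutelyContinuous _ _).ae_le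
      (ae_strictAnti_orderedEigenvalues (p := p))] with w hw
    exact propext ⟨fun h => ⟨h, hw⟩, fun h => h.1⟩
  rw [Measure.map_apply measurable_orderedEigenvalues_symOf hB, measure_congr hae, hγ,
    withDensity_apply _ hS, lintegral_image_eq_lintegral_abs_det_fderiv_mul volume hs
      (fun z _ => (hasFDerivAt_spectralMap z).hasFDerivWithinAt) hinj]
  have hcongr : ∀ z ∈ (B ∩ {α | StrictAnti α}) ×ˢ frameDomain p,
      ENNReal.ofReal |(fderiv ℝ spectralMap z).det| * ENNReal.ofReal (c * Real.exp
        (-(1 / 4) * ∑ i, ∑ j, symOf (spectralMap z) i j ^ 2)) =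
      ENNReal.ofReal (c * unnormalizedDensity z.1) * ENNReal.ofReal (h z.2) := by
    intro z hz
    have hz' : StrictAnti z.1 := hz.1.2
    rw [← sum_sq_eigenvalues (symOf_isHermitian _),
      orderedEigenvalues_symOf_spectralMap hz'.antitone, hdet,
      unnormalizedDensity_of_antitone hz'.antitone, ← ENNReal.ofReal_mul (by
        have := h0 z.2
        positivity), ← ENNReal.ofReal_mul (by positivity)]
    congr 1
    ring
  rw [setLIntegral_congr_fun hs hcongr, Measure.volume_eq_prod, ← Measure.prod_restrict,
    lintegral_prod_mul
      (measurable_unnormalizedDensity.const_mul c).ennreal_ofReal.aemeasurable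
      hm.ennreal_ofReal.aemeasurable]
  have hint : ∫⁻ x in B ∩ {α | StrictAnti α}, ENNReal.ofReal (c * unnormalizedDensity x) =
      ENNReal.ofReal c * ∫⁻ x in B, ENNReal.ofReal (unnormalizedDensity x) := by
    rw [← lintegral_const_mul _ measurable_unnormalizedDensity.ennreal_ofReal,
      ← lintegral_indicator hBs, ← lintegral_indicator hB]
    refine lintegral_congr fun x => ?_
    by_cases hx : x ∈ B
    · by_cases hx' : StrictAnti x
      · rw [Set.indicator_of_mem (s := B ∩ {α | StrictAnti α}) ⟨hx, hx'⟩,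
          Set.indicator_of_mem hx, ENNReal.ofReal_mul hc.le]
      · rw [Set.indicator_of_notMem fun h => hx' h.2, Set.indicator_of_mem hx,
          unnormalizedDensity_of_not_strictAnti hx', ENNReal.ofReal_zero, mul_zero]
    · rw [Set.indicator_of_notMem fun h => hx h.1, Set.indicator_of_notMem hx]
  rw [hint]
  ring

theorem map_orderedEigenvalues_symGaussian (p : ℕ) :
    (symGaussian p).map (fun w => orderedEigenvalues (symOf w)) =
      volume.withDensity fun x : Fin p → ℝ => ENNReal.ofReal
        (normalizingConstant p * unnormalizedDensity x) := by
  obtain ⟨K, hK⟩ := exists_symGaussian_orderedEigenvalues p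
  have := Measure.isProbabilityMeasure_map (μ := symGaussian p)
    measurable_orderedEigenvalues_symOf.aemeasurable
  have hKJ := (hK Set.univ .univ).symm
  rw [measure_univ, setLIntegral_univ] at hKJ
  set J := ∫⁻ x : Fin p → ℝ, ENNReal.ofReal (unnormalizedDensity x) with hJ
  have hJ0 : J ≠ 0 := by
    intro h
    simp [h] at hKJ
  -- Total mass one reads `K * J = 1`, which excludes both `0` and `⊤` for `J` and makes `K` its
  -- inverse.
  have hJt : J ≠ ⊤ := by
    intro h
    rw [h] at hKJ
    by_cases h' : K = 0 <;> simp [h'] at hKJ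
  have hn : ENNReal.ofReal (normalizingConstant p) = K := by
    rw [normalizingConstant, integral_eq_lintegral_of_nonneg_ae
      (ae_of_all _ unnormalizedDensity_nonneg) measurable_unnormalizedDensity.aestronglyMeasurable,
      ← hJ, ENNReal.ofReal_inv_of_pos (ENNReal.toReal_pos hJ0 hJt), ENNReal.ofReal_toReal hJt]
    exact (ENNReal.eq_inv_of_mul_eq_one_left hKJ).symm
  have hn0 : 0 ≤ normalizingConstant p :=
    inv_nonneg.mpr (integral_nonneg unnormalizedDensity_nonneg)
  ext B hB
  rw [hK B hB, withDensity_apply _ hB, ← hn,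
    ← lintegral_const_mul _ measurable_unnormalizedDensity.ennreal_ofReal]
  simp only [ENNReal.ofReal_mul hn0]

/-- The ordered eigenvalues of `Z` have the density of the Gaussian orthogonal ensemble. -/
theorem hasLaw_orderedEigenvalues {m : ℕ} {Ω : Type*} [MeasurableSpace Ω] {Q : Measure Ω}
    {Z : Ω → Matrix (Fin (m + 1)) (Fin (m + 1)) ℝ} (hZ : HasLimitLaw 0 Z Q) :
    HasLaw (fun ω => orderedEigenvalues (Z ω))
      (volume.withDensity fun x : Fin (m + 1) → ℝ => ENNReal.ofReal
        (normalizingConstant (m + 1) * unnormalizedDensity x)) Q := by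
  have hm : Measurable fun t : EuclideanSpace ℝ (Fin (m + 1) × Fin (m + 1)) =>
      orderedEigenvalues (symMat t) :=
    (continuous_orderedEigenvalues_comp continuous_symMat symMat_isHermitian).measurable
  obtain ⟨h1, h2⟩ := hZ.map_eq_map (by norm_num) hm
  refine ⟨h1, h2.trans ?_⟩
  simp only [spikeRoot_zero, one_mul, transpose_one, mul_one]
  rw [multivariateGaussian_eq_map_symGaussian, Measure.map_map hm continuous_vec_symOf.measurable,
    ← map_orderedEigenvalues_symGaussian]
  congr 1
  ext1 w
  rw [Function.comp_apply, symMat_vec (symOf_isHermitian w)]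

end EigenvalueDensity

end SpikedPCA

/-- Joint weak limits of the normalized sample eigenvalues in the single-spiked Gaussian model of
dimension `p = m + 1`, in the four regimes for the strength `r n` of the spike. -/
theorem lemma2p2 {m : ℕ}
    (θ : EuclideanSpace ℝ (Fin (m + 1))) (hθ : ‖θ‖ = 1) (v : ℝ) (hv : 0 < v)
    (r : ℕ → ℝ) (hr : ∀ n, 1 ≤ n → 0 < r n) (hrb : BddAbove (Set.range r))
    -- for each `n`, a Gaussian sample `X n 0, …, X n (n - 1)` of size `n`
    {Ω : ℕ → Type*} [∀ n, MeasurableSpace (Ω n)]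
    (P : ∀ n, Measure (Ω n)) [∀ n, IsProbabilityMeasure (P n)]
    (X : ∀ n, Fin n → Ω n → EuclideanSpace ℝ (Fin (m + 1)))
    (hXindep : ∀ n, iIndepFun (X n) (P n))
    (hXlaw : ∀ n i,
      HasLaw (X n i) (multivariateGaussian 0 (SpikedPCA.spikedCov θ (r n * v))) (P n))
    -- the random matrices `Z(v)` and `Z(0)`
    {Ω' : Type*} [MeasurableSpace Ω'] (Q : Measure Ω') [IsProbabilityMeasure Q]
    (Z : ℝ → Ω' → Matrix (Fin (m + 1)) (Fin (m + 1)) ℝ)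
    (hZv : SpikedPCA.HasLimitLaw v (Z v) Q) (hZ0 : SpikedPCA.HasLimitLaw 0 (Z 0) Q) :
    -- (i)
    ((∀ n, 1 ≤ n → r n = 1) →
      ∃ ℓ : Ω' → Fin (m + 1) → ℝ,
        TendstoInDistribution
          (fun n ω => SpikedPCA.normalizedEigenvalues (r n * v) (fun i => X n i ω)) atTop ℓ P Q ∧
        IndepFun (fun ω => ℓ ω 0) (fun ω => Fin.tail (ℓ ω)) Q ∧
        HasLaw (fun ω => ℓ ω 0) (gaussianReal 0 (2 * (1 + v) ^ 2).toNNReal) Q ∧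
        ∀ ω, Fin.tail (ℓ ω) = SpikedPCA.orderedEigenvalues (SpikedPCA.lowerBlock (Z v ω))) ∧
    -- (ii)
    (Tendsto r atTop (𝓝 0) → Tendsto (fun n : ℕ => √(n : ℝ) * r n) atTop atTop →
      ∃ ℓ : Ω' → Fin (m + 1) → ℝ,
        TendstoInDistribution
          (fun n ω => SpikedPCA.normalizedEigenvalues (r n * v) (fun i => X n i ω)) atTop ℓ P Q ∧
        IndepFun (fun ω => ℓ ω 0) (fun ω => Fin.tail (ℓ ω)) Q ∧
        HasLaw (fun ω => ℓ ω 0) (gaussianReal 0 2) Q ∧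
        ∀ ω, Fin.tail (ℓ ω) = SpikedPCA.orderedEigenvalues (SpikedPCA.lowerBlock (Z 0 ω))) ∧
    -- (iii)
    ((∀ n : ℕ, 1 ≤ n → r n = 1 / √(n : ℝ)) →
      TendstoInDistribution
        (fun n ω => SpikedPCA.normalizedEigenvalues (r n * v) (fun i => X n i ω)) atTop
        (fun ω => (Fin.cons
          (SpikedPCA.orderedEigenvalues (Z 0 ω - diagonal (Fin.cons 0 fun _ => v)) 0)
          (Fin.tail (SpikedPCA.orderedEigenvalues (Z 0 ω + diagonal (Fin.cons v fun _ => 0)))) :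
            Fin (m + 1) → ℝ))
        P Q) ∧
    -- (iv)
    (r =o[atTop] (fun n : ℕ => 1 / √(n : ℝ)) →
      TendstoInDistribution
        (fun n ω => SpikedPCA.normalizedEigenvalues (r n * v) (fun i => X n i ω)) atTop
        (fun ω => SpikedPCA.orderedEigenvalues (Z 0 ω)) P Q ∧
      HasLaw (fun ω => SpikedPCA.orderedEigenvalues (Z 0 ω))
        (volume.withDensity fun x : Fin (m + 1) → ℝ => ENNReal.ofReal
          (SpikedPCA.normalizingConstant (m + 1) * SpikedPCA.unnormalizedDensity x)) Q) := by
  have hρ : ∀ n, 1 ≤ n → 0 ≤ 1 + r n * v := fun n hn => by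
    have := hr n hn
    positivity
  have hsq : Tendsto (fun n : ℕ => √(n : ℝ)) atTop atTop :=
    Real.tendsto_sqrt_atTop.comp tendsto_natCast_atTop_atTop
  refine ⟨fun h => ?_, fun h0 htop => ?_, fun h => ?_, fun h => ⟨?_, ?_⟩⟩
  · have he : (fun n => r n * v) =ᶠ[atTop] fun _ => v := by
      filter_upwards [eventually_ge_atTop 1] with n hn
      rw [h n hn, one_mul]
    refine SpikedPCA.tendstoInDistribution_of_spike_atTop hθ hρ hXindep hXlaw (by positivity) hZv
      (tendsto_const_nhds.congr' he.symm) ?_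
    refine (hsq.atTop_mul_const hv).congr' ?_
    filter_upwards [he] with n hn
    rw [hn]
  · have h1 := SpikedPCA.tendstoInDistribution_of_spike_atTop hθ hρ hXindep hXlaw (by norm_num) hZ0
      (by simpa using h0.mul_const v)
      (by simpa only [mul_assoc] using htop.atTop_mul_const hv)
    have h2 : (2 * (1 + (0 : ℝ)) ^ 2).toNNReal = 2 := by norm_num
    rwa [h2] at h1
  · have ha : Tendsto (fun n : ℕ => √(n : ℝ) * (r n * v)) atTop (𝓝 v) := by
      refine tendsto_const_nhds.congr' ?_
      filter_upwards [eventually_ge_atTop 1] with n hn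
      have : √(n : ℝ) ≠ 0 := by positivity
      rw [h n hn]
      field_simp
    refine (SpikedPCA.tendstoInDistribution_of_spike_nhds hθ hρ hXindep hXlaw hZ0 ha).congr
      (fun n => ae_eq_rfl) ?_
    -- Shifting the spectrum by a multiple of the identity requires symmetry of `Z 0 ω`, which holds
    -- only almost surely.
    filter_upwards [hZ0.ae_eq_symMat (by norm_num)] with ω hω
    have hH : (Z 0 ω).IsHermitian := by
      rw [hω]
      exact SpikedPCA.symMat_isHermitian _
    have hd : diagonal (Fin.cons v fun _ => 0) = SpikedPCA.corner (m := m) v 0 := by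
      rw [← SpikedPCA.corner_diagonal, ← diagonal_zero]
    have hN : (SpikedPCA.corner v 0 + Z 0 ω).IsHermitian :=
      (SpikedPCA.corner_isHermitian _ (by simp [IsHermitian])).add hH
    -- The two matrices of this regime differ by `v` times the identity, so subtracting `v` from the
    -- top eigenvalue of one gives that of the other.
    have hd' : Z 0 ω - diagonal (Fin.cons 0 fun _ => v) =
        (1 : ℝ) • (SpikedPCA.corner v 0 + Z 0 ω) + (-v) • 1 := by
      have : SpikedPCA.corner v 0 = v • 1 - diagonal (Fin.cons 0 fun _ : Fin m => v) := by
        rw [← hd, ← diagonal_one, ← diagonal_smul, diagonal_sub]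
        congr 1
        ext i
        refine Fin.cases ?_ (fun i => ?_) i <;> simp
      rw [this, one_smul, neg_smul]
      abel
    rw [hd', SpikedPCA.orderedEigenvalues_smul_add hN zero_le_one, hd, add_comm (Z 0 ω)]
    simp only [one_mul, sub_eq_add_neg]
  -- This is the bounded regime with `a = 0`: the spike leaves no trace in the limit.
  · have ha : Tendsto (fun n : ℕ => √(n : ℝ) * (r n * v)) atTop (𝓝 0) := by
      have h1 := (h.tendsto_div_nhds_zero).mul_const v
      rw [zero_mul] at h1
      refine h1.congr fun n => ?_
      rw [div_div_eq_mul_div, div_one]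
      ring
    refine (SpikedPCA.tendstoInDistribution_of_spike_nhds hθ hρ hXindep hXlaw hZ0 ha).congr
      (fun n => ae_eq_rfl) (ae_of_all _ fun ω => ?_)
    simp only [SpikedPCA.corner_zero_zero_eq, zero_add, sub_zero]
    exact Fin.cons_self_tail _
  · exact SpikedPCA.hasLaw_orderedEigenvalues hZ0
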